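/- Let $d,d'\ge 1$ be integers, $0<s<d$, $\alpha\in(0,1]$, $\Lambda>0$. Let $K:\mathbb{R}^d\setminus\{0\}\to\mathbb{C}^{d'}$ be a homogeneous $s$-dimensional Calder\'on--Zygmund kernel: $|K(x)|\le |x|^{-s}$, $K(-x)=-K(x)$, $x\mapsto |x|^{s+\alpha}K(x)$ is H\"older continuous of order $\alpha$, and $K(\lambda x)=\lambda^{-s}K(x)$ for $\lambda>0$. Suppose that $K$ is smooth, i.e. $K(x)=\Omega(x/|x|)/|x|^s$ with $\Omega\in C^\infty(\mathbb{S}^{d-1})$, and non-degenerate, i.e. the Fourier transform of $K$ (as a tempered distribution) is the function $m(\xi/|\xi|)/|\xi|^{d-s}$ with $m$ continuous and $m(\theta)\ne 0$ for every $\theta\in\mathbb{S}^{d-1}$. All measures are non-negative locally finite Borel measures on $\mathbb{R}^d$, $m_d$ is Lebesgue measure, and $\operatorname{Lip}_0$ denotes the compactly supported complex-valued Lipschitz functions on $\mathbb{R}^d$. A measure $\mu$ is $\Lambda$-nice if $\mu(B(x,r))\le\Lambda r^s$ for every ball $B(x,r)$. For $\mu$ diffuse (i.e. $|x-y|^{1-s}\in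 L^1_{\mathrm{loc}}(\mu\times\mu)$) and $f,\varphi\in\operatorname{Lip}_0$, put $$\langle T(f\mu),\varphi\rangle_\mu=\iint K(x-y)\,\tfrac12\bigl[f(y)\varphi(x)-\varphi(y)f(x)\bigr]\,d\mu(x)\,d\mu(y).$$ If moreover $\int_{|x|\ge1}|x|^{-s-\alpha}d\mu(x)<\infty$ and $\int f\,d\mu=0$, put $$\langle T(f\mu),1\rangle_\mu=\langle T(f\mu),\psi\rangle_\mu+\int (1-\psi(x))\Bigl(\int K(x-y)f(y)\,d\mu(y)\Bigr)d\mu(x),$$ where $\psi\in\operatorname{Lip}_0$ equals $1$ on a neighbourhood of $\operatorname{supp} f$ (the value does not depend on $\psi$). A diffuse measure with $\int_{|x|\ge1}|x|^{-s-\alpha}d\mu(x)<\infty$ is reflectionless if $\langle T(f\mu),1\rangle_\mu=0$ for all $f\in\operatorname{Lip}_0$ with $\int f\,d\mu=0$. For a non-zero $\Lambda$-nice reflectionless measure $\mu$, pick $\varphi_0\in\operatorname{Lip}_0$ with $\int\varphi_0\,d\mu=1$ and set $$\overline T_\mu(1)(x)=\int K(y-x)\psi_R(y)\,d\mu(y)-\langle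 T(\varphi_0\mu),\psi_R\rangle_\mu+\iint [K(y-x)-K(y-z)](1-\psi_R(y))\varphi_0(z)\,d\mu(y)\,d\mu(z),$$ where $\psi_R\in\operatorname{Lip}_0$ is supported in $B(0,2R)$ and equals $1$ on $B(0,R)$, and $R$ is so large that $x\in B(0,R/2)$ and $\operatorname{supp}\varphi_0\subset B(0,R/2)$. This is well defined for $m_d$-almost every $x$ and for every $x\notin\operatorname{supp}\mu$, and does not depend on $R$, $\psi_R$ or $\varphi_0$. Proposition. If there is a non-zero $\Lambda$-nice reflectionless measure, then there is a $\Lambda$-nice reflectionless measure $\mu^\star$ such that $\operatorname{dist}(0,\operatorname{supp}\mu^\star)=1$ and $$\bigl|\overline T_{\mu^\star}(1)(0)\bigr|=\bigl\|\overline T_{\mu^\star}(1)\bigr\|_{L^\infty(m_d)}.$$ -/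

import Mathlib

open MeasureTheory Metric Set Filter Topology
open scoped NNReal ContDiff SchwartzMap FourierTransform

namespace Reflectionless

/-- `ℝ^d` with the Euclidean norm. -/
abbrev RSpace (d : ℕ) := EuclideanSpace ℝ (Fin d)

/-- `ℂ^{d'}` with the Euclidean norm. -/
abbrev CSpace (d' : ℕ) := EuclideanSpace ℂ (Fin d')

/-- Homogeneous `s`-dimensional Calderón–Zygmund kernels `K : ℝ^d \ {0} → ℂ^{d'}` of regularity
`α ∈ (0,1]`. The value `K 0` is irrelevant. -/
structure IsCZKernel {d d' : ℕ} (s α : ℝ) (K : RSpace d → CSpace d') : Prop where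
  alpha_pos : 0 < α
  alpha_le_one : α ≤ 1
  size : ∀ x, x ≠ 0 → ‖K x‖ ≤ 1 / ‖x‖ ^ s
  odd : ∀ x, x ≠ 0 → K (-x) = -K x
  holder : ∃ C : ℝ, ∀ x y, x ≠ 0 → y ≠ 0 →
    ‖‖x‖ ^ (s + α) • K x - ‖y‖ ^ (s + α) • K y‖ ≤ C * ‖x - y‖ ^ α
  homogeneous : ∀ (t : ℝ) (x), 0 < t → x ≠ 0 → K (t • x) = t ^ (-s) • K x

/-- Smoothness of the kernel away from the origin. For a homogeneous kernel
`K x = Ω (x / |x|) / |x| ^ s` this says exactly that `Ω` is smooth on the unit sphere. -/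
def IsSmoothKernel {d d' : ℕ} (K : RSpace d → CSpace d') : Prop :=
  ContDiffOn ℝ ∞ K {0}ᶜ

/-- The Fourier transform of (the tempered distribution) `K` is the function
`ξ ↦ m (ξ / |ξ|) / |ξ| ^ (d - s)`. -/
def HasAngularMultiplier {d d' : ℕ} (s : ℝ) (K m : RSpace d → CSpace d') : Prop :=
  ∀ φ : 𝓢(RSpace d, ℂ),
    ∫ x, (𝓕 φ) x • K x = ∫ ξ, φ ξ • ((1 / ‖ξ‖ ^ ((d : ℝ) - s)) • m (‖ξ‖⁻¹ • ξ))

/-- Non-degeneracy: the (continuous) angular part `m` of the Fourier transform of `K` does not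
vanish anywhere on the unit sphere. -/
def IsNondegenerate {d d' : ℕ} (s : ℝ) (K : RSpace d → CSpace d') : Prop :=
  ∃ m : RSpace d → CSpace d', ContinuousOn m (sphere 0 1) ∧
    HasAngularMultiplier s K m ∧ ∀ θ ∈ sphere (0 : RSpace d) 1, m θ ≠ 0

/-- `Λ`-nice measures: `μ (B(x,r)) ≤ Λ r ^ s` for every ball. -/
def IsNice {d : ℕ} (s Λ : ℝ) (μ : Measure (RSpace d)) : Prop :=
  ∀ x r, 0 < r → μ (ball x r) ≤ ENNReal.ofReal (Λ * r ^ s)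

/-- `|x - y| ^ (1 - s)` is locally integrable with respect to `μ × μ`. The power is taken in
`[0, ∞]`, so that it is `∞` on the diagonal if `s > 1`. -/
def IsDiffuse {d : ℕ} (s : ℝ) (μ : Measure (RSpace d)) : Prop :=
  ∀ S : Set (RSpace d × RSpace d), IsCompact S →
    ∫⁻ p in S, edist p.1 p.2 ^ (1 - s) ∂(μ.prod μ) < ⊤

/-- Restricted growth at infinity. -/
def HasRestrictedGrowth {d : ℕ} (s α : ℝ) (μ : Measure (RSpace d)) : Prop :=
  ∫⁻ x in {x | 1 ≤ ‖x‖}, ‖x‖ₑ ^ (-(s + α)) ∂μ < ⊤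

/-- `Lip_0(ℝ^d)`: compactly supported (complex-valued) Lipschitz functions. -/
def IsLip0 {d : ℕ} (f : RSpace d → ℂ) : Prop :=
  (∃ C : ℝ≥0, LipschitzWith C f) ∧ HasCompactSupport f

/-- The bilinear form `⟨T(f μ), φ⟩_μ = ∬ K(x - y) H(x, y) dμ(x) dμ(y)`, where
`H(x, y) = (f(y) φ(x) - φ(y) f(x)) / 2`, for `f, φ ∈ Lip_0`. -/
noncomputable def pairing {d d' : ℕ} (K : RSpace d → CSpace d') (μ : Measure (RSpace d))
    (f φ : RSpace d → ℂ) : CSpace d' :=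
  ∫ p, ((1 / 2 : ℂ) * (f p.2 * φ p.1 - φ p.2 * f p.1)) • K (p.1 - p.2) ∂(μ.prod μ)

/-- `T(f μ)(x) = ∫ K(x - y) f(y) dμ(y)`, used for `x` outside the support of `f`. -/
noncomputable def offSupport {d d' : ℕ} (K : RSpace d → CSpace d') (μ : Measure (RSpace d))
    (f : RSpace d → ℂ) (x : RSpace d) : CSpace d' :=
  ∫ y, f y • K (x - y) ∂μ

/-- The extension of `⟨T(f μ), φ⟩_μ` to bounded Lipschitz `φ` and to `f ∈ Lip_0` of `μ`-mean zero,
computed with a cut-off `ψ ∈ Lip_0` that is `1` near the support of `f`. -/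
noncomputable def extPairing {d d' : ℕ} (K : RSpace d → CSpace d') (μ : Measure (RSpace d))
    (f φ ψ : RSpace d → ℂ) : CSpace d' :=
  pairing K μ f (fun x => ψ x * φ x) + ∫ x, ((1 - ψ x) * φ x) • offSupport K μ f x ∂μ

/-- Reflectionless measures: diffuse measures with restricted growth at infinity such that
`⟨T(f μ), 1⟩_μ = 0` for every `f ∈ Lip_0` with `∫ f dμ = 0`. (The value of the form does not depend
on the cut-off `ψ`.) -/
structure IsReflectionless {d d' : ℕ} (s α : ℝ) (K : RSpace d → CSpace d')
    (μ : Measure (RSpace d)) : Prop where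
  locallyFinite : IsLocallyFiniteMeasure μ
  diffuse : IsDiffuse s μ
  growth : HasRestrictedGrowth s α μ
  vanishing : ∀ f, IsLip0 f → ∫ x, f x ∂μ = 0 →
    ∀ ψ, IsLip0 ψ → (∀ᶠ x in 𝓝ˢ (tsupport f), ψ x = 1) → extPairing K μ f (fun _ => 1) ψ = 0

/-- A Lipschitz cut-off which is `1` on `B(0, R)` and is compactly supported in `B(0, 2R)`. -/
noncomputable def cutoff {d : ℕ} (R : ℝ) (x : RSpace d) : ℂ :=
  ((max 0 (min 1 (3 - 2 * ‖x‖ / R)) : ℝ) : ℂ)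

/-- `∫ K(y-x) dμ(y) - ⟨T(φ₀ μ), 1⟩_μ`, with the common tail of the two terms (`|y| ≥ R`) combined
into one absolutely convergent double integral. In the last integral `p = (y, z)`. -/
noncomputable def TbarAt {d d' : ℕ} (K : RSpace d → CSpace d') (μ : Measure (RSpace d))
    (φ₀ : RSpace d → ℂ) (R : ℝ) (x : RSpace d) : CSpace d' :=
  ∫ y, cutoff R y • K (y - x) ∂μ - pairing K μ φ₀ (cutoff R)
    + ∫ p, ((1 - cutoff R p.1) * φ₀ p.2) • (K (p.1 - x) - K (p.1 - p.2)) ∂(μ.prod μ)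

/-- A radius `R` with `x ∈ B(0, R/2)` and `supp φ₀ ⊆ B(0, R/2)`. -/
noncomputable def largeRadius {d : ℕ} (φ₀ : RSpace d → ℂ) (x : RSpace d) : ℝ :=
  2 * (‖x‖ + sSup (norm '' tsupport φ₀) + 1)

/-- The function `T̄_μ(1)`, defined with `φ₀ ∈ Lip_0`, `∫ φ₀ dμ = 1`. (The value does not depend on
the choice of a large `R`.) -/
noncomputable def Tbar {d d' : ℕ} (K : RSpace d → CSpace d') (μ : Measure (RSpace d))
    (φ₀ : RSpace d → ℂ) (x : RSpace d) : CSpace d' :=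
  TbarAt K μ φ₀ (largeRadius φ₀ x) x

end Reflectionless

/-! The measure sought is a maximiser. Consider nice reflectionless measures for which `ball 0 1` is
null and `ball 0 2` is charged (`IsAdmissible`), and let S be the supremum of |T̄(1)(0)| over them.
Niceness, reflectionlessness and T̄(1) are compatible with the maps y ↦ (y - a)/r, so the value of
T̄(1) at a point off the support, when its distance to the support is taken as the unit of length,
is the value at 0 of an admissible measure (`exists_admissible`). Thus S also bounds T̄(1) off the
support of every measure considered.

On the support T̄(1) vanishes at every point with finite s-potential, hence Lebesgue almost
everywhere (`Tbar_eq_zero_of_mem_support`). This rests on `enorm_Tbar_zero_le`. Since the measure is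
reflectionless, T̄(1) does not depend on the normalising function φ₀, and φ₀ may be taken to be a
bump near 0, at a point and scale δ where the measure is doubling and has growth exponent d + 1 > s
at scales above δ. The pairing with this bump is then controlled by a small parameter plus a
multiple of the mass of a large ball, and the tail by 1/R. Consequently a small potential at 0
forces a small T̄(1)(0) (`exists_small_potential`). Zooming in at a point of the support makes the
potential as small as desired while keeping the value of T̄(1), so this value is 0.

The same estimate shows that S is finite and that a maximising sequence cannot lose its mass to
infinity when S > 0. A vague limit is then non-zero. It is reflectionless and attains S
(`exists_extremal`), because the vanishing of ⟨T(fμ), 1⟩ is used in the quantitative form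
`PairDecay`, whose constants are uniform. A final dilation makes the distance from 0 to the support
equal to 1, and the two bounds above together with continuity at 0 identify S with the L^∞ norm
(`exists_extremal_measure`).

It remains to see that S > 0, i.e. that T̄(1) is not almost everywhere zero (`not_ae_Tbar_eq_zero`).
Smoothness of K makes its multiplier smooth away from 0 (`contDiffOn_multiplier`), and
non-degeneracy allows division by it. So every function whose Fourier transform is smooth and
compactly supported away from 0 is a sum of components of K * ψ_j, with ψ_j Schwartz of mean zero
(`exists_convolution_eq`). If T̄(1) = 0 a.e., such functions have μ-integral zero: the Fourier
transform of μ lives at the origin. Growth of order s < d then forces μ to annihilate all test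
functions, contradicting ∫ φ dμ = 1. -/

namespace Reflectionless

/-! ### Dyadic estimates for integrals of powers of the distance -/

section PowerIntegrals

variable {E : Type*} [NormedAddCommGroup E] [MeasurableSpace E] [BorelSpace E]

/-- Every point of `S` other than `z` is at a distance within a factor 2 of some scale `ρ n`, so the
power is dominated by a sum of constants on balls, which is integrated term by term. The factor `2 ^
|p|` covers both signs of `p`; negative exponents occur later as `p = s - 1`. -/
theorem lintegral_rpow_le_of_scales {p q a : ℝ} (ha : 0 ≤ a) (ν : Measure E) (z : E) (S : Set E)
    (ρ : ℕ → ℝ) (hρ : ∀ n, 0 < ρ n) (hz : ν {z} = 0)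
    (hS : ∀ y ∈ S, y ≠ z → ∃ n, ‖y - z‖ < ρ n ∧ ρ n ≤ 2 * ‖y - z‖)
    (hν : ∀ n, ν (ball z (ρ n)) ≤ ENNReal.ofReal (a * ρ n ^ q))
    (hsum : Summable fun n => ρ n ^ (q - p)) (hSm : MeasurableSet S) :
    ∫⁻ y in S, ‖y - z‖ₑ ^ (-p) ∂ν ≤ ENNReal.ofReal (2 ^ |p| * a * ∑' n, ρ n ^ (q - p)) := by
  have h1 : ∀ y ∈ S, y ≠ z → ‖y - z‖ₑ ^ (-p) ≤
      ∑' n, (ball z (ρ n)).indicator (fun _ => ENNReal.ofReal (2 ^ |p| * ρ n ^ (-p))) y := by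
    intro y hy hyz
    obtain ⟨n, hn1, hn2⟩ := hS y hy hyz
    refine le_trans ?_ (ENNReal.le_tsum n)
    have hpos : 0 < ‖y - z‖ := norm_pos_iff.2 (sub_ne_zero.2 hyz)
    have hmem : y ∈ ball z (ρ n) := by simpa [mem_ball, dist_eq_norm] using hn1
    rw [indicator_of_mem hmem, ← ofReal_norm, ENNReal.ofReal_rpow_of_pos hpos]
    refine ENNReal.ofReal_le_ofReal ?_
    rcases le_total 0 p with hp | hp
    · rw [abs_of_nonneg hp, Real.rpow_neg hpos.le, Real.rpow_neg (hρ n).le, ← div_eq_mul_inv,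
        le_div_iff₀ (Real.rpow_pos_of_pos (hρ n) _), inv_mul_le_iff₀ (Real.rpow_pos_of_pos hpos _),
        mul_comm, ← Real.mul_rpow (by norm_num) hpos.le]
      exact Real.rpow_le_rpow (hρ n).le hn2 hp
    · have h3 : ‖y - z‖ ^ (-p) ≤ ρ n ^ (-p) := Real.rpow_le_rpow hpos.le hn1.le (by linarith)
      have h4 : (1 : ℝ) ≤ 2 ^ |p| := Real.one_le_rpow (by norm_num) (abs_nonneg p)
      nlinarith [Real.rpow_nonneg hpos.le (-p)]
  have hne : ∀ᵐ y ∂(ν.restrict S), y ≠ z := by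
    refine ae_restrict_of_ae ?_
    rw [ae_iff]; simpa using hz
  calc ∫⁻ y in S, ‖y - z‖ₑ ^ (-p) ∂ν
      ≤ ∫⁻ y in S, ∑' n, (ball z (ρ n)).indicator
          (fun _ => ENNReal.ofReal (2 ^ |p| * ρ n ^ (-p))) y ∂ν := by
        refine lintegral_mono_ae ?_
        filter_upwards [hne, ae_restrict_mem hSm] with y hy1 hy2 using h1 y hy2 hy1
    _ ≤ ∫⁻ y, ∑' n, (ball z (ρ n)).indicator
          (fun _ => ENNReal.ofReal (2 ^ |p| * ρ n ^ (-p))) y ∂ν := lintegral_mono' Measure.restrict_le_self le_rfl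
    _ = ∑' n, ENNReal.ofReal (2 ^ |p| * ρ n ^ (-p)) * ν (ball z (ρ n)) := by
        rw [lintegral_tsum]
        · refine tsum_congr fun n => ?_
          rw [lintegral_indicator measurableSet_ball, setLIntegral_const]
        · intro n
          exact (measurable_const.indicator measurableSet_ball).aemeasurable
    _ ≤ ∑' n, ENNReal.ofReal (2 ^ |p| * a * ρ n ^ (q - p)) := by
        refine ENNReal.tsum_le_tsum fun n => ?_
        refine (mul_le_mul_right (hν n) _).trans ?_
        rw [← ENNReal.ofReal_mul (by have := (hρ n).le; positivity)]
        refine ENNReal.ofReal_le_ofReal (le_of_eq ?_)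
        rw [sub_eq_add_neg, Real.rpow_add (hρ n)]
        ring
    _ = ENNReal.ofReal (2 ^ |p| * a * ∑' n, ρ n ^ (q - p)) := by
        rw [← ENNReal.ofReal_tsum_of_nonneg, tsum_mul_left]
        · intro n; have := (hρ n).le; positivity
        · exact hsum.mul_left _

theorem summable_rpow_half {b T : ℝ} (hb : 0 < b) (hT : 0 < T) :
    (Summable fun n : ℕ => (T * (1 / 2) ^ n) ^ b) ∧
      ∑' n : ℕ, (T * (1 / 2) ^ n) ^ b = (1 - (1 / 2) ^ b)⁻¹ * T ^ b := by
  have h0 : (0 : ℝ) ≤ (1 / 2) ^ b := by positivity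
  have h1 : ((1 : ℝ) / 2) ^ b < 1 := Real.rpow_lt_one (by norm_num) (by norm_num) hb
  have : (fun n : ℕ => (T * (1 / 2) ^ n) ^ b) = fun n : ℕ => T ^ b * ((1 / 2) ^ b) ^ n := by
    ext n
    rw [Real.mul_rpow hT.le (by positivity), ← Real.rpow_natCast, ← Real.rpow_natCast,
      ← Real.rpow_mul (by norm_num), ← Real.rpow_mul (by norm_num), mul_comm (n : ℝ)]
  rw [this]
  refine ⟨(summable_geometric_of_lt_one h0 h1).mul_left _, ?_⟩
  rw [tsum_mul_left, tsum_geometric_of_lt_one h0 h1, mul_comm]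

omit [BorelSpace E] in
theorem measure_singleton_of_growth {q a T : ℝ} (hq : 0 < q) (hT : 0 < T) (ν : Measure E) (z : E)
    (hν : ∀ t, 0 < t → t ≤ T → ν (ball z t) ≤ ENNReal.ofReal (a * t ^ q)) : ν {z} = 0 := by
  have h1 : Tendsto (fun t : ℝ => ENNReal.ofReal (a * t ^ q)) (𝓝[>] 0) (𝓝 0) := by
    have : Tendsto (fun t : ℝ => a * t ^ q) (𝓝[>] 0) (𝓝 0) := by
      have h := (Real.continuousAt_rpow_const 0 q (Or.inr hq.le)).tendsto.const_mul a
      rw [Real.zero_rpow hq.ne', mul_zero] at h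
      exact h.mono_left nhdsWithin_le_nhds
    simpa using ENNReal.tendsto_ofReal this
  refine le_antisymm (ge_of_tendsto h1 ?_) bot_le
  filter_upwards [Ioc_mem_nhdsGT hT] with t ht
  exact (measure_mono (singleton_subset_iff.2 (mem_ball_self ht.1))).trans (hν t ht.1 ht.2)

/-- The constant in the dyadic estimates of power integrals. -/
noncomputable def growthConst (p q : ℝ) : ℝ := 2 ^ |p| * (1 - (1 / 2) ^ |q - p|)⁻¹

theorem growthConst_pos {p q : ℝ} (h : p ≠ q) : 0 < growthConst p q := by
  have h1 : ((1 : ℝ) / 2) ^ |q - p| < 1 :=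
    Real.rpow_lt_one (by norm_num) (by norm_num) (abs_pos.2 (sub_ne_zero.2 h.symm))
  have : 0 < 1 - ((1 : ℝ) / 2) ^ |q - p| := by linarith
  unfold growthConst
  positivity

theorem lintegral_ball_rpow_le {p q a T : ℝ} (hq : 0 < q) (hpq : p < q) (ha : 0 ≤ a) (hT : 0 < T)
    (ν : Measure E) (z : E)
    (hν : ∀ t, 0 < t → t ≤ T → ν (ball z t) ≤ ENNReal.ofReal (a * t ^ q)) :
    ∫⁻ y in ball z T, ‖y - z‖ₑ ^ (-p) ∂ν ≤
      ENNReal.ofReal (growthConst p q * a * T ^ (q - p)) := by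
  obtain ⟨hs, hs'⟩ := summable_rpow_half (b := q - p) (by linarith) hT
  have hle : ∀ n : ℕ, T * (1 / 2) ^ n ≤ T := fun n =>
    mul_le_of_le_one_right hT.le (pow_le_one₀ (by norm_num) (by norm_num))
  refine (lintegral_rpow_le_of_scales (q := q) ha ν z (ball z T) (fun n : ℕ => T * (1 / 2) ^ n)
    (fun n => by positivity) (measure_singleton_of_growth hq hT ν z hν) ?_
    (fun n => hν _ (by positivity) (hle n)) hs measurableSet_ball).trans ?_
  · intro y hy hyz
    have hpos : 0 < ‖y - z‖ := norm_pos_iff.2 (sub_ne_zero.2 hyz)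
    have hlt : ‖y - z‖ < T := by simpa [mem_ball, dist_eq_norm] using hy
    obtain ⟨n, hn1, hn2⟩ := exists_nat_pow_near_of_lt_one (x := ‖y - z‖ / T) (y := 1 / 2)
      (by positivity) ((div_le_one hT).2 hlt.le) (by norm_num) (by norm_num)
    rw [lt_div_iff₀ hT] at hn1
    rw [div_le_iff₀ hT] at hn2
    -- The balls are open: when the distance equals a scale exactly, the next larger scale is used
    -- instead.
    rcases hn2.lt_or_eq with h | h
    · exact ⟨n, by linarith, by rw [pow_succ] at hn1; linarith⟩
    · cases n with
      | zero => simp at h; linarith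
      | succ k =>
        rw [pow_succ] at h
        have : 0 < (1 / 2 : ℝ) ^ k * T := by positivity
        exact ⟨k, by linarith, by linarith⟩
  · rw [hs', growthConst, abs_of_pos (by linarith : 0 < q - p)]
    exact ENNReal.ofReal_le_ofReal (le_of_eq (by ring))

theorem lintegral_compl_ball_rpow_le {p q a T : ℝ} (hpq : q < p) (ha : 0 ≤ a)
    (hT : 0 < T) (ν : Measure E) (z : E)
    (hν : ∀ t, T ≤ t → ν (ball z t) ≤ ENNReal.ofReal (a * t ^ q)) :
    ∫⁻ y in (ball z T)ᶜ, ‖y - z‖ₑ ^ (-p) ∂ν ≤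
      ENNReal.ofReal (growthConst p q * a * T ^ (q - p)) := by
  -- The growing scales `2 * T * 2 ^ n` are inverses of the shrinking scales that start at `(2 *
  -- T)⁻¹`, so the same geometric series applies with exponent `p - q`.
  obtain ⟨hs, hs'⟩ := summable_rpow_half (b := p - q) (T := (2 * T)⁻¹) (by linarith)
    (by positivity)
  have hfun : (fun n : ℕ => ((2 * T)⁻¹ * (1 / 2) ^ n) ^ (p - q)) =
      fun n : ℕ => (2 * T * 2 ^ n) ^ (q - p) := by
    ext n
    rw [← neg_sub q p, Real.rpow_neg (by positivity), ← Real.inv_rpow (by positivity)]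
    congr 1
    simp [mul_comm]
  rw [hfun] at hs hs'
  have hle : ∀ n : ℕ, T ≤ 2 * T * 2 ^ n := fun n => by
    have : (1 : ℝ) ≤ 2 ^ n := one_le_pow₀ (by norm_num)
    nlinarith
  -- Nothing is known about `ν` at scales below `T`; after restriction to the complement of the ball
  -- the centre is trivially null.
  have hne : (ν.restrict (ball z T)ᶜ) {z} = 0 := by
    rw [Measure.restrict_apply' measurableSet_ball.compl]
    have : {z} ∩ (ball z T)ᶜ = ∅ := by
      ext y; simp only [mem_inter_iff, mem_singleton_iff, mem_compl_iff, mem_empty_iff_false,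
        iff_false]
      rintro ⟨rfl, h⟩; exact h (mem_ball_self hT)
    simp [this]
  have key := lintegral_rpow_le_of_scales (p := p) (q := q) ha (ν.restrict (ball z T)ᶜ) z
    (ball z T)ᶜ (fun n : ℕ => 2 * T * 2 ^ n) (fun n => by positivity) hne ?_
    (fun n => (Measure.restrict_apply_le _ _).trans (hν _ (hle n))) hs measurableSet_ball.compl
  · rw [Measure.restrict_restrict measurableSet_ball.compl, inter_self] at key
    refine key.trans (ENNReal.ofReal_le_ofReal ?_)
    rw [hs', growthConst, abs_of_neg (by linarith : q - p < 0), neg_sub]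
    have h1 : ((1 : ℝ) / 2) ^ (p - q) < 1 :=
      Real.rpow_lt_one (by norm_num) (by norm_num) (by linarith)
    have h2 : ((2 * T)⁻¹) ^ (p - q) ≤ T ^ (q - p) := by
      rw [← neg_sub p q, Real.rpow_neg hT.le, ← Real.inv_rpow hT.le]
      refine Real.rpow_le_rpow (by positivity) ?_ (by linarith)
      exact inv_anti₀ hT (by linarith)
    have h3 : 0 ≤ 2 ^ |p| * a * (1 - ((1 : ℝ) / 2) ^ (p - q))⁻¹ := by
      have : 0 < 1 - ((1 : ℝ) / 2) ^ (p - q) := by linarith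
      positivity
    calc _ = 2 ^ |p| * a * (1 - ((1 : ℝ) / 2) ^ (p - q))⁻¹ * ((2 * T)⁻¹) ^ (p - q) := by ring
      _ ≤ 2 ^ |p| * a * (1 - ((1 : ℝ) / 2) ^ (p - q))⁻¹ * T ^ (q - p) :=
        mul_le_mul_of_nonneg_left h2 h3
      _ = _ := by ring
  · intro y hy hyz
    have hge : T ≤ ‖y - z‖ := by simpa [mem_ball, dist_eq_norm] using hy
    obtain ⟨n, hn1, hn2⟩ := exists_nat_pow_near (x := ‖y - z‖ / T) (y := 2)
      ((one_le_div hT).2 hge) (by norm_num)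
    rw [div_lt_iff₀ hT, pow_succ] at hn2
    rw [le_div_iff₀ hT] at hn1
    exact ⟨n, by linarith, by linarith⟩

end PowerIntegrals
-- Consequences of the growth bound for nice measures
section Nice

variable {d : ℕ} {s Λ : ℝ} {μ : Measure (RSpace d)}

theorem IsNice.isLocallyFinite (h : IsNice s Λ μ) : IsLocallyFiniteMeasure μ :=
  ⟨fun x => ⟨ball x 1, ball_mem_nhds x one_pos,
    (h x 1 one_pos).trans_lt ENNReal.ofReal_lt_top⟩⟩

theorem IsNice.measure_singleton (hs : 0 < s) (h : IsNice s Λ μ) (x : RSpace d) : μ {x} = 0 :=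
  measure_singleton_of_growth hs one_pos μ x fun t ht _ => h x t ht

theorem IsNice.lintegral_ball_le (hs : 0 < s) (hΛ : 0 < Λ) (h : IsNice s Λ μ) {p T : ℝ}
    (hp : p < s) (hT : 0 < T) (z : RSpace d) :
    ∫⁻ y in ball z T, ‖y - z‖ₑ ^ (-p) ∂μ ≤
      ENNReal.ofReal (growthConst p s * Λ * T ^ (s - p)) :=
  lintegral_ball_rpow_le hs hp hΛ.le hT μ z fun t ht _ => h z t ht

theorem IsNice.lintegral_compl_ball_le (hΛ : 0 < Λ) (h : IsNice s Λ μ) {p T : ℝ}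
    (hp : s < p) (hT : 0 < T) (z : RSpace d) :
    ∫⁻ y in (ball z T)ᶜ, ‖y - z‖ₑ ^ (-p) ∂μ ≤
      ENNReal.ofReal (growthConst p s * Λ * T ^ (s - p)) :=
  lintegral_compl_ball_rpow_le hp hΛ.le hT μ z fun t ht => h z t (hT.trans_le ht)

theorem IsNice.hasRestrictedGrowth {α : ℝ} (hα : 0 < α) (hΛ : 0 < Λ)
    (h : IsNice s Λ μ) : HasRestrictedGrowth s α μ := by
  have h1 := h.lintegral_compl_ball_le hΛ (p := s + α) (by linarith) one_pos 0
  have h2 : {x : RSpace d | 1 ≤ ‖x‖} = (ball 0 1)ᶜ := by ext; simp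
  unfold HasRestrictedGrowth
  rw [h2]
  simp only [sub_zero] at h1
  exact h1.trans_lt ENNReal.ofReal_lt_top

theorem IsNice.measure_closedBall_le (h : IsNice s Λ μ) (x : RSpace d)
    {r : ℝ} (hr : 0 < r) : μ (closedBall x r) ≤ ENNReal.ofReal (2 ^ s * Λ * r ^ s) := by
  refine (measure_mono (closedBall_subset_ball (by linarith : r < 2 * r))).trans
    ((h x (2 * r) (by linarith)).trans (ENNReal.ofReal_le_ofReal (le_of_eq ?_)))
  rw [Real.mul_rpow (by norm_num) hr.le]; ring

theorem measurableSet_near_diagonal (c : RSpace d) (ρ T : ℝ) :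
    MeasurableSet {P : RSpace d × RSpace d | P.2 ∈ ball c ρ ∧ P.1 ∈ ball P.2 T} := by
  have h1 : IsOpen {P : RSpace d × RSpace d | P.2 ∈ ball c ρ} := isOpen_ball.preimage continuous_snd
  have h2 : IsOpen {P : RSpace d × RSpace d | P.1 ∈ ball P.2 T} := by
    simp only [mem_ball]
    exact isOpen_lt (by fun_prop) continuous_const
  exact (h1.inter h2).measurableSet

theorem lintegral_near_diagonal_le [SFinite μ] {z₀ : RSpace d} {ρ p c T : ℝ}
    (h : ∀ z, ∫⁻ y in ball z T, ‖y - z‖ₑ ^ (-p) ∂μ ≤ ENNReal.ofReal c) :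
    ∫⁻ P in {P | P.2 ∈ ball z₀ ρ ∧ P.1 ∈ ball P.2 T}, ‖P.1 - P.2‖ₑ ^ (-p) ∂(μ.prod μ) ≤
      ENNReal.ofReal c * μ (ball z₀ ρ) := by
  rw [← lintegral_indicator (measurableSet_near_diagonal z₀ ρ T), lintegral_prod_symm _
    ((Measurable.indicator (by fun_prop) (measurableSet_near_diagonal z₀ ρ T)).aemeasurable)]
  calc _ ≤ ∫⁻ y, (ball z₀ ρ).indicator (fun _ => ENNReal.ofReal c) y ∂μ := by
        refine lintegral_mono fun y => ?_
        by_cases hy : y ∈ ball z₀ ρ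
        · rw [indicator_of_mem hy]
          refine le_trans (le_of_eq ?_) (h y)
          rw [← lintegral_indicator measurableSet_ball]
          refine lintegral_congr fun x => ?_
          by_cases hx : x ∈ ball y T
          · rw [indicator_of_mem hx, indicator_of_mem (show (x, y) ∈ {P : RSpace d × RSpace d |
              P.2 ∈ ball z₀ ρ ∧ P.1 ∈ ball P.2 T} from ⟨hy, hx⟩)]
          · rw [indicator_of_notMem hx, indicator_of_notMem fun h => hx h.2]
        · rw [indicator_of_notMem hy]
          refine le_of_eq ?_
          rw [← lintegral_zero (μ := μ)]
          exact lintegral_congr fun x => indicator_of_notMem (fun h => hy h.1) _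
    _ = _ := by rw [lintegral_indicator measurableSet_ball, setLIntegral_const]

theorem IsNice.isDiffuse (hs : 0 < s) (hΛ : 0 < Λ) (h : IsNice s Λ μ) : IsDiffuse s μ := by
  have := h.isLocallyFinite
  intro S hS
  obtain ⟨ρ, hρ0, hρ⟩ := hS.isBounded.subset_ball_lt 0 0
  have h1 := lintegral_near_diagonal_le (μ := μ) (z₀ := 0) (ρ := ρ) fun z =>
    h.lintegral_ball_le hs hΛ (p := s - 1) (by linarith) (by linarith : 0 < 2 * ρ) z
  have h2 : S ⊆ {P | P.2 ∈ ball 0 ρ ∧ P.1 ∈ ball P.2 (2 * ρ)} := by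
    intro P hP
    have := hρ hP
    rw [mem_ball_zero_iff, Prod.norm_def, max_lt_iff] at this
    refine ⟨mem_ball_zero_iff.2 this.2, ?_⟩
    rw [mem_ball, dist_eq_norm]
    exact (norm_sub_le _ _).trans_lt (by linarith [this.1, this.2])
  simp only [edist_eq_enorm_sub]
  refine (lintegral_mono_set h2).trans_lt ?_
  rw [neg_sub] at h1
  exact h1.trans_lt (ENNReal.mul_lt_top ENNReal.ofReal_lt_top measure_ball_lt_top)

end Nice

/-! ### Estimates for the kernel -/

section Kernel

variable {d d' : ℕ}

/-- The estimates on the kernel `K` used for the measure-theoretic part of the argument. -/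
structure KernelBounds (s C : ℝ) (K : RSpace d → CSpace d') : Prop where
  s_pos : 0 < s
  C_pos : 0 < C
  size : ∀ x, ‖K x‖ₑ ≤ ‖x‖ₑ ^ (-s)
  odd : ∀ x, x ≠ 0 → K (-x) = -K x
  cont : ContinuousOn K {0}ᶜ
  homogeneous : ∀ (t : ℝ) (x), 0 < t → x ≠ 0 → K (t • x) = t ^ (-s) • K x
  diff : ∀ x z y, y ≠ 0 → ‖x‖ ≤ ‖y‖ / 2 → ‖z‖ ≤ ‖y‖ / 2 →
    ‖K (y - x) - K (y - z)‖ₑ ≤ ENNReal.ofReal (C * ‖x - z‖) * ‖y‖ₑ ^ (-(s + 1))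

/-- A smooth kernel is Lipschitz on the compact annulus 1/2 ≤ |u| ≤ 3/2. Scaling `y` to unit length
puts both `y - x` and `y - z` in this annulus, and homogeneity turns the Lipschitz bound into decay
of order s + 1. Smoothness thus replaces the Hölder exponent α by 1 throughout. -/
theorem IsCZKernel.exists_kernelBounds {s α : ℝ} (hs : 0 < s) {K : RSpace d → CSpace d'}
    (hK : IsCZKernel s α K) (hsm : IsSmoothKernel K) : ∃ C, KernelBounds s C K := by
  have hopen : IsOpen ({0}ᶜ : Set (RSpace d)) := isOpen_compl_singleton
  set A : Set (RSpace d) := closedBall 0 (3 / 2) \ ball 0 (1 / 2) with hA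
  have hAc : IsCompact A := (isCompact_closedBall _ _).diff isOpen_ball
  have hA0 : ∀ u ∈ A, u ≠ 0 := by
    rintro u ⟨_, hu⟩ rfl
    exact hu (mem_ball_self (by norm_num))
  obtain ⟨C, hC⟩ : ∃ C, LipschitzOnWith C K A := by
    refine LocallyLipschitzOn.exists_lipschitzOnWith_of_compact hAc fun x hx => ?_
    have h1 : ContDiffAt ℝ 1 K x :=
      ((hsm x (hA0 x hx)).contDiffAt (hopen.mem_nhds (hA0 x hx))).of_le (by norm_cast)
    obtain ⟨C, t, ht, hf⟩ := h1.exists_lipschitzOnWith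
    exact ⟨C, t, mem_nhdsWithin_of_mem_nhds ht, hf⟩
  refine ⟨C + 1, hs, by positivity, ?_, hK.odd, hsm.continuousOn, hK.homogeneous, ?_⟩
  · intro x
    rcases eq_or_ne x 0 with rfl | hx
    -- At the origin the bound holds whatever `K 0` is, because 0 to a negative power is ∞ in
    -- `ENNReal`.
    · simp [ENNReal.zero_rpow_of_neg (neg_lt_zero.2 hs)]
    · have hx' := norm_pos_iff.2 hx
      rw [← ofReal_norm, ← ofReal_norm, ENNReal.ofReal_rpow_of_pos hx', Real.rpow_neg hx'.le,
        ← one_div]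
      exact ENNReal.ofReal_le_ofReal (hK.size x hx)
  · intro x z y hy hx hz
    have hy' := norm_pos_iff.2 hy
    have hscale : ∀ w : RSpace d, ‖w‖ ≤ ‖y‖ / 2 → (‖y‖⁻¹ • (y - w)) ∈ A ∧
        K (y - w) = ‖y‖ ^ (-s) • K (‖y‖⁻¹ • (y - w)) := by
      intro w hw
      have h1 : ‖y‖ / 2 ≤ ‖y - w‖ := by
        have := norm_sub_norm_le y w
        linarith
      have h2 : ‖y - w‖ ≤ 3 / 2 * ‖y‖ := (norm_sub_le y w).trans (by linarith)
      have hne : ‖y‖⁻¹ • (y - w) ≠ 0 := by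
        refine smul_ne_zero (inv_ne_zero hy'.ne') fun h => ?_
        rw [h, norm_zero] at h1
        linarith
      refine ⟨⟨?_, ?_⟩, ?_⟩
      · rw [mem_closedBall_zero_iff, norm_smul, norm_inv, norm_norm, inv_mul_le_iff₀ hy']
        linarith
      · rw [mem_ball_zero_iff, norm_smul, norm_inv, norm_norm, not_lt, le_inv_mul_iff₀ hy']
        linarith
      · rw [← hK.homogeneous _ _ hy' hne, smul_inv_smul₀ hy'.ne']
    obtain ⟨hxA, hKx⟩ := hscale x hx
    obtain ⟨hzA, hKz⟩ := hscale z hz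
    have h3 : ‖K (y - x) - K (y - z)‖ ≤ (C + 1) * ‖x - z‖ * ‖y‖ ^ (-(s + 1)) := by
      rw [hKx, hKz, ← smul_sub, norm_smul, Real.norm_of_nonneg (by positivity)]
      have h4 := hC.dist_le_mul _ hxA _ hzA
      rw [dist_eq_norm, dist_eq_norm, ← smul_sub, norm_smul, norm_inv, norm_norm,
        sub_sub_sub_cancel_left, norm_sub_rev z x] at h4
      have h5 : ‖y‖ ^ (-(s + 1)) = ‖y‖ ^ (-s) * ‖y‖⁻¹ := by
        rw [neg_add, Real.rpow_add hy', Real.rpow_neg_one]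
      rw [h5]
      calc _ ≤ ‖y‖ ^ (-s) * (C * (‖y‖⁻¹ * ‖x - z‖)) := by gcongr
        _ ≤ ‖y‖ ^ (-s) * ((C + 1) * (‖y‖⁻¹ * ‖x - z‖)) := by gcongr; simp
        _ = _ := by ring
    rw [← ofReal_norm, ← ofReal_norm, ENNReal.ofReal_rpow_of_pos hy',
      ← ENNReal.ofReal_mul (by positivity)]
    exact ENNReal.ofReal_le_ofReal h3

variable {s C : ℝ} {K : RSpace d → CSpace d'}

theorem KernelBounds.measurable (hK : KernelBounds s C K) : Measurable K :=
  measurable_of_continuousOn_compl_singleton 0 hK.cont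

end Kernel

/-! ### Lipschitz test functions and cut-offs -/

section Lip0

variable {d : ℕ} {f g : RSpace d → ℂ} {μ : Measure (RSpace d)}

theorem IsLip0.continuous (hf : IsLip0 f) : Continuous f :=
  hf.1.choose_spec.continuous

theorem IsLip0.exists_bound (hf : IsLip0 f) : ∃ B, 0 < B ∧ ∀ x, ‖f x‖ ≤ B := by
  obtain ⟨B, hB⟩ := hf.2.exists_bound_of_continuous hf.continuous
  exact ⟨max B 1, by positivity, fun x => (hB x).trans (le_max_left _ _)⟩

theorem IsLip0.exists_radius (hf : IsLip0 f) : ∃ ρ, 0 < ρ ∧ ∀ x, ρ < ‖x‖ → f x = 0 := by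
  obtain ⟨ρ, hρ0, hρ⟩ := hf.2.isCompact.isBounded.subset_closedBall_lt 0 0
  refine ⟨ρ, hρ0, fun x hx => ?_⟩
  by_contra h
  have := hρ (subset_tsupport _ h)
  rw [mem_closedBall_zero_iff] at this
  linarith

theorem IsLip0.integrable [IsLocallyFiniteMeasure μ] (hf : IsLip0 f) : Integrable f μ :=
  hf.continuous.integrable_of_hasCompactSupport hf.2

theorem IsLip0.add (hf : IsLip0 f) (hg : IsLip0 g) : IsLip0 (fun x => f x + g x) := by
  obtain ⟨⟨C, hC⟩, hf2⟩ := hf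
  obtain ⟨⟨D, hD⟩, hg2⟩ := hg
  exact ⟨⟨C + D, hC.add hD⟩, hf2.add hg2⟩

theorem IsLip0.const_mul (hf : IsLip0 f) (c : ℂ) : IsLip0 (fun x => c * f x) := by
  obtain ⟨⟨C, hC⟩, hf2⟩ := hf
  refine ⟨⟨‖c‖₊ * C, LipschitzWith.of_dist_le_mul fun x y => ?_⟩, hf2.mul_left⟩
  rw [dist_eq_norm, ← mul_sub, norm_mul, NNReal.coe_mul, coe_nnnorm, mul_assoc, ← dist_eq_norm]
  exact mul_le_mul_of_nonneg_left (hC.dist_le_mul x y) (norm_nonneg _)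

theorem IsLip0.sub (hf : IsLip0 f) (hg : IsLip0 g) : IsLip0 (fun x => f x - g x) := by
  simpa [sub_eq_add_neg] using hf.add (hg.const_mul (-1))

/-- Antisymmetrisation gains a factor |x - y|. Against the kernel it leaves the singularity |x -
y|^(1-s), which is integrable for a nice measure although |x - y|^(-s) need not be. -/
theorem IsLip0.exists_antisymm_le (hf : IsLip0 f) (hg : IsLip0 g) : ∃ L, 0 < L ∧ ∀ x y,
    ‖(1 / 2 : ℂ) * (f y * g x - g y * f x)‖ ≤ L * ‖x - y‖ := by
  obtain ⟨B, hB0, hB⟩ := hf.exists_bound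
  obtain ⟨D, hD0, hD⟩ := hg.exists_bound
  obtain ⟨⟨F, hF⟩, -⟩ := hf
  obtain ⟨⟨G, hG⟩, -⟩ := hg
  refine ⟨B * G + D * F + 1, by positivity, fun x y => ?_⟩
  have e : f y * g x - g y * f x = f y * (g x - g y) - g y * (f x - f y) := by ring
  have h1 := hF.dist_le_mul x y
  have h2 := hG.dist_le_mul x y
  rw [dist_eq_norm, dist_eq_norm] at h1 h2
  have h3 : ‖f y * (g x - g y)‖ ≤ B * (G * ‖x - y‖) := by
    rw [norm_mul]; exact mul_le_mul (hB y) h2 (norm_nonneg _) hB0.le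
  have h4 : ‖g y * (f x - f y)‖ ≤ D * (F * ‖x - y‖) := by
    rw [norm_mul]; exact mul_le_mul (hD y) h1 (norm_nonneg _) hD0.le
  have h5 := norm_sub_le (f y * (g x - g y)) (g y * (f x - f y))
  rw [norm_mul, e, norm_div, norm_one, Complex.norm_ofNat]
  nlinarith [norm_nonneg (x - y), norm_nonneg (f y * (g x - g y) - g y * (f x - f y))]

/-- Cut-off functions that are `1` on the ball of radius `R`. -/
structure IsCut (R : ℝ) (g : RSpace d → ℂ) : Prop where
  isLip0 : IsLip0 g
  norm_le : ∀ x, ‖1 - g x‖ ≤ 1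
  eq_one : ∀ x, ‖x‖ ≤ R → g x = 1

theorem cutoff_eq_one {R : ℝ} (hR : 0 < R) {x : RSpace d} (hx : ‖x‖ ≤ R) : cutoff R x = 1 := by
  have : ‖x‖ / R ≤ 1 := (div_le_one hR).2 hx
  have h : (1 : ℝ) ≤ 3 - 2 * ‖x‖ / R := by rw [mul_div_assoc]; linarith
  simp [cutoff, min_eq_left h]

theorem cutoff_eq_zero {R : ℝ} (hR : 0 < R) {x : RSpace d} (hx : 3 / 2 * R ≤ ‖x‖) :
    cutoff R x = 0 := by
  have h : 3 - 2 * ‖x‖ / R ≤ 0 := by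
    rw [sub_nonpos, le_div_iff₀ hR]; linarith
  simp only [cutoff, Complex.ofReal_eq_zero]
  exact max_eq_left ((min_le_right _ _).trans h)

theorem norm_cutoff_sub_le {R : ℝ} (hR : 0 < R) (x y : RSpace d) :
    ‖cutoff R x - cutoff R y‖ ≤ 2 / R * ‖x - y‖ := by
  rw [cutoff, cutoff, ← Complex.ofReal_sub, Complex.norm_real, Real.norm_eq_abs]
  have h1 := abs_max_sub_max_le_abs (min 1 (3 - 2 * ‖x‖ / R)) (min 1 (3 - 2 * ‖y‖ / R)) 0
  have h2 : |min 1 (3 - 2 * ‖x‖ / R) - min 1 (3 - 2 * ‖y‖ / R)| ≤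
      |(3 - 2 * ‖x‖ / R) - (3 - 2 * ‖y‖ / R)| := by
    have := abs_min_sub_min_le_max 1 (3 - 2 * ‖x‖ / R) 1 (3 - 2 * ‖y‖ / R)
    simpa using this
  have h3 : (3 - 2 * ‖x‖ / R) - (3 - 2 * ‖y‖ / R) = 2 / R * (‖y‖ - ‖x‖) := by ring
  rw [max_comm _ (0 : ℝ), max_comm _ (0 : ℝ)] at h1
  rw [h3, abs_mul, abs_of_pos (by positivity : 0 < 2 / R)] at h2
  refine (h1.trans h2).trans ?_
  rw [norm_sub_rev x y]
  exact mul_le_mul_of_nonneg_left (abs_norm_sub_norm_le y x) (by positivity)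

theorem isCut_cutoff {R : ℝ} (hR : 0 < R) : IsCut R (cutoff (d := d) R) := by
  refine ⟨⟨⟨NNReal.mk (2 / R) (by positivity), LipschitzWith.of_dist_le_mul fun x y => ?_⟩, ?_⟩,
    ?_, fun x => cutoff_eq_one hR⟩
  · rw [dist_eq_norm, dist_eq_norm]
    exact norm_cutoff_sub_le hR x y
  · refine HasCompactSupport.intro (isCompact_closedBall (0 : RSpace d) (3 / 2 * R)) fun x hx => ?_
    rw [mem_closedBall_zero_iff, not_le] at hx
    exact cutoff_eq_zero hR hx.le
  · intro x
    have h0 : 0 ≤ max 0 (min 1 (3 - 2 * ‖x‖ / R)) := le_max_left _ _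
    have h1 : max 0 (min 1 (3 - 2 * ‖x‖ / R)) ≤ 1 := max_le zero_le_one (min_le_left _ _)
    rw [cutoff, ← Complex.ofReal_one, ← Complex.ofReal_sub, Complex.norm_real, Real.norm_eq_abs,
      abs_of_nonneg (by linarith)]
    linarith

theorem IsCut.norm_le_two {R : ℝ} (hg : IsCut R g) (x : RSpace d) : ‖g x‖ ≤ 2 := by
  have h := norm_sub_le 1 (1 - g x)
  have h2 := hg.norm_le x
  rw [sub_sub_cancel, norm_one] at h
  linarith

end Lip0

/-! ### The bilinear form and its tails -/

section Pairing

variable {d d' : ℕ} {s C Λ : ℝ} {K : RSpace d → CSpace d'} {μ : Measure (RSpace d)}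
  {f g h φ : RSpace d → ℂ}

/-- The integrand of `pairing`. -/
noncomputable def pairInt (K : RSpace d → CSpace d') (f g : RSpace d → ℂ)
    (p : RSpace d × RSpace d) : CSpace d' :=
  ((1 / 2 : ℂ) * (f p.2 * g p.1 - g p.2 * f p.1)) • K (p.1 - p.2)

/-- The integrand of the tail in `TbarAt`. -/
noncomputable def tailInt (K : RSpace d → CSpace d') (φ g : RSpace d → ℂ) (x : RSpace d)
    (p : RSpace d × RSpace d) : CSpace d' :=
  ((1 - g p.1) * φ p.2) • (K (p.1 - x) - K (p.1 - p.2))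

theorem pairing_eq (K : RSpace d → CSpace d') (μ : Measure (RSpace d)) (f g : RSpace d → ℂ) :
    pairing K μ f g = ∫ p, pairInt K f g p ∂(μ.prod μ) := rfl

theorem KernelBounds.measurable_pairInt (hK : KernelBounds s C K) (hf : IsLip0 f) (hg : IsLip0 g) :
    Measurable (pairInt K f g) := by
  have h1 := hf.continuous.measurable
  have h2 := hg.continuous.measurable
  have h3 := hK.measurable
  unfold pairInt
  fun_prop

theorem KernelBounds.measurable_tailInt (hK : KernelBounds s C K) (hf : Measurable φ)
    (hg : Measurable g) (x : RSpace d) : Measurable (tailInt K φ g x) := by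
  have h3 := hK.measurable
  unfold tailInt
  fun_prop

theorem KernelBounds.enorm_pairInt_le (hK : KernelBounds s C K) {L : ℝ}
    (p : RSpace d × RSpace d)
    (hL : ‖(1 / 2 : ℂ) * (f p.2 * g p.1 - g p.2 * f p.1)‖ ≤ L * ‖p.1 - p.2‖) :
    ‖pairInt K f g p‖ₑ ≤ ENNReal.ofReal L * ‖p.1 - p.2‖ₑ ^ (-(s - 1)) := by
  rcases eq_or_ne p.1 p.2 with h | h
  · simp [pairInt, h, mul_comm]
  · have hpos : 0 < ‖p.1 - p.2‖ := norm_pos_iff.2 (sub_ne_zero.2 h)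
    rw [pairInt, enorm_smul]
    have h1 : ‖(1 / 2 : ℂ) * (f p.2 * g p.1 - g p.2 * f p.1)‖ₑ ≤
        ENNReal.ofReal L * ‖p.1 - p.2‖ₑ := by
      rw [← ofReal_norm, ← ofReal_norm, ← ENNReal.ofReal_mul' (norm_nonneg _)]
      exact ENNReal.ofReal_le_ofReal hL
    refine (mul_le_mul' h1 (hK.size _)).trans (le_of_eq ?_)
    rw [mul_assoc]
    congr 1
    rw [show -(s - 1) = 1 + -s by ring,
      ENNReal.rpow_add _ _ (by simpa [sub_eq_zero] using h) enorm_ne_top, ENNReal.rpow_one]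

theorem pairInt_eq_zero {ρ : ℝ} (hf : ∀ x, ρ ≤ ‖x‖ → f x = 0) (hg : ∀ x, ρ ≤ ‖x‖ → g x = 0)
    {p : RSpace d × RSpace d} (hp : ¬ (p.1 ∈ ball 0 ρ ∧ p.2 ∈ ball 0 ρ)) :
    pairInt K f g p = 0 := by
  simp only [mem_ball_zero_iff, not_and_or, not_lt] at hp
  rcases hp with h | h <;> simp [pairInt, hf _ h, hg _ h]

theorem exists_common_radius (hf : IsLip0 f) (hg : IsLip0 g) : ∃ ρ, 0 < ρ ∧
    (∀ x, ρ ≤ ‖x‖ → f x = 0) ∧ ∀ x, ρ ≤ ‖x‖ → g x = 0 := by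
  obtain ⟨a, ha, hfa⟩ := hf.exists_radius
  obtain ⟨b, hb, hgb⟩ := hg.exists_radius
  exact ⟨a + b, by positivity, fun x hx => hfa x (by linarith), fun x hx => hgb x (by linarith)⟩

theorem lintegral_pairInt_near_le (hK : KernelBounds s C K) (hΛ : 0 < Λ) (hμ : IsNice s Λ μ)
    {L ρ T : ℝ} (hT : 0 < T)
    (hL : ∀ x y, ‖(1 / 2 : ℂ) * (f y * g x - g y * f x)‖ ≤ L * ‖x - y‖) :
    ∫⁻ p in {P | P.2 ∈ ball 0 ρ ∧ P.1 ∈ ball P.2 T}, ‖pairInt K f g p‖ₑ ∂(μ.prod μ) ≤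
      ENNReal.ofReal L * (ENNReal.ofReal (growthConst (s - 1) s * Λ * T) * μ (ball 0 ρ)) := by
  have := hμ.isLocallyFinite
  have h1 := lintegral_near_diagonal_le (μ := μ) (z₀ := 0) (ρ := ρ) fun z =>
    hμ.lintegral_ball_le hK.s_pos hΛ (p := s - 1) (by linarith) hT z
  rw [sub_sub_cancel, Real.rpow_one] at h1
  calc _ ≤ ∫⁻ p in {P | P.2 ∈ ball 0 ρ ∧ P.1 ∈ ball P.2 T},
        ENNReal.ofReal L * ‖p.1 - p.2‖ₑ ^ (-(s - 1)) ∂(μ.prod μ) :=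
        lintegral_mono fun p => hK.enorm_pairInt_le p (hL _ _)
    _ = _ := lintegral_const_mul _ (by fun_prop)
    _ ≤ _ := mul_le_mul_right h1 _

theorem integrable_pairInt (hK : KernelBounds s C K) (hΛ : 0 < Λ) (hμ : IsNice s Λ μ)
    (hf : IsLip0 f) (hg : IsLip0 g) : Integrable (pairInt K f g) (μ.prod μ) := by
  have := hμ.isLocallyFinite
  refine ⟨(hK.measurable_pairInt hf hg).aestronglyMeasurable, ?_⟩
  obtain ⟨ρ, hρ, hfρ, hgρ⟩ := exists_common_radius hf hg
  obtain ⟨L, hL0, hL⟩ := hf.exists_antisymm_le hg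
  have h1 := lintegral_pairInt_near_le hK hΛ hμ (ρ := ρ) (T := 2 * ρ) (by linarith) hL
  rw [hasFiniteIntegral_iff_enorm]
  have h2 : ∫⁻ p, ‖pairInt K f g p‖ₑ ∂(μ.prod μ) =
      ∫⁻ p in {P | P.2 ∈ ball 0 ρ ∧ P.1 ∈ ball P.2 (2 * ρ)}, ‖pairInt K f g p‖ₑ ∂(μ.prod μ) := by
    rw [← lintegral_indicator (measurableSet_near_diagonal _ _ _)]
    refine lintegral_congr fun p => ?_
    by_cases hp : p ∈ {P : RSpace d × RSpace d | P.2 ∈ ball 0 ρ ∧ P.1 ∈ ball P.2 (2 * ρ)}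
    · rw [indicator_of_mem hp]
    · rw [indicator_of_notMem hp, pairInt_eq_zero hfρ hgρ, enorm_zero]
      rintro ⟨ha, hb⟩
      refine hp ⟨hb, ?_⟩
      rw [mem_ball_zero_iff] at ha hb
      rw [mem_ball, dist_eq_norm]
      exact (norm_sub_le _ _).trans_lt (by linarith)
  rw [h2]
  exact h1.trans_lt (ENNReal.mul_lt_top ENNReal.ofReal_lt_top
    (ENNReal.mul_lt_top ENNReal.ofReal_lt_top measure_ball_lt_top))

theorem pairing_sub_left (hK : KernelBounds s C K) (hΛ : 0 < Λ) (hμ : IsNice s Λ μ)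
    (hf : IsLip0 f) (hφ : IsLip0 φ) (hg : IsLip0 g) :
    pairing K μ (fun x => f x - φ x) g = pairing K μ f g - pairing K μ φ g := by
  rw [pairing_eq, pairing_eq, pairing_eq, ← integral_sub (integrable_pairInt hK hΛ hμ hf hg)
    (integrable_pairInt hK hΛ hμ hφ hg)]
  congr 1; ext1 p
  simp only [pairInt, ← sub_smul]
  congr 1; ring

theorem pairing_sub_right (hK : KernelBounds s C K) (hΛ : 0 < Λ) (hμ : IsNice s Λ μ)
    (hf : IsLip0 f) (hφ : IsLip0 φ) (hg : IsLip0 g) :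
    pairing K μ f (fun x => g x - φ x) = pairing K μ f g - pairing K μ f φ := by
  rw [pairing_eq, pairing_eq, pairing_eq, ← integral_sub (integrable_pairInt hK hΛ hμ hf hg)
    (integrable_pairInt hK hΛ hμ hf hφ)]
  congr 1; ext1 p
  simp only [pairInt, ← sub_smul]
  congr 1; ring

theorem pairing_const_mul_left (c : ℂ) :
    pairing K μ (fun x => c * f x) g = c • pairing K μ f g := by
  rw [pairing_eq, pairing_eq, ← integral_smul]
  congr 1; ext1 p
  simp only [pairInt, smul_smul]
  congr 1; ring

/-- The integrand of `pairing` for functions with separated supports. -/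
noncomputable def sepInt (K : RSpace d → CSpace d') (f h : RSpace d → ℂ)
    (p : RSpace d × RSpace d) : CSpace d' :=
  (h p.1 * f p.2) • K (p.1 - p.2)

theorem integrable_sepInt (hK : KernelBounds s C K) [IsLocallyFiniteMeasure μ]
    (hf : IsLip0 f) (hh : IsLip0 h) {ε : ℝ} (hε : 0 < ε)
    (hsep : ∀ x y, h x ≠ 0 → f y ≠ 0 → ε ≤ ‖x - y‖) :
    Integrable (sepInt K f h) (μ.prod μ) := by
  have hm : Measurable (sepInt K f h) := by
    have h1 := hf.continuous.measurable
    have h2 := hh.continuous.measurable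
    have h3 := hK.measurable
    unfold sepInt
    fun_prop
  have hint : Integrable (fun p : RSpace d × RSpace d => ε ^ (-s) * ‖h p.1 * f p.2‖)
      (μ.prod μ) := (hh.integrable.mul_prod hf.integrable).norm.const_mul _
  refine hint.mono' hm.aestronglyMeasurable (ae_of_all _ fun p => ?_)
  rw [sepInt, norm_smul, mul_comm]
  by_cases h0 : h p.1 * f p.2 = 0
  · simp [h0]
  · have h1 := hsep p.1 p.2 (left_ne_zero_of_mul h0) (right_ne_zero_of_mul h0)
    have hpos : 0 < ‖p.1 - p.2‖ := hε.trans_le h1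
    refine mul_le_mul_of_nonneg_right ?_ (norm_nonneg _)
    have h2 := hK.size (p.1 - p.2)
    rw [← ofReal_norm, ← ofReal_norm, ENNReal.ofReal_rpow_of_pos hpos] at h2
    refine ((ENNReal.ofReal_le_ofReal_iff (by positivity)).1 h2).trans ?_
    exact Real.rpow_le_rpow_of_nonpos hε h1 (by linarith [hK.s_pos])

/-- Without a singularity the two halves of the antisymmetric form may be integrated separately; as
K is odd, exchanging the variables shows that they are equal. -/
theorem pairing_eq_of_separated (hK : KernelBounds s C K) [IsLocallyFiniteMeasure μ]
    (hf : IsLip0 f) (hh : IsLip0 h) {ε : ℝ} (hε : 0 < ε)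
    (hsep : ∀ x y, h x ≠ 0 → f y ≠ 0 → ε ≤ ‖x - y‖) :
    pairing K μ f h = ∫ p, sepInt K f h p ∂(μ.prod μ) := by
  have hF := integrable_sepInt (μ := μ) hK hf hh hε hsep
  have h1 : ∀ p, pairInt K f h p =
      (1 / 2 : ℂ) • (sepInt K f h p + sepInt K f h p.swap) := by
    intro p
    simp only [pairInt, sepInt, Prod.fst_swap, Prod.snd_swap]
    rcases eq_or_ne p.1 p.2 with he | hne
    · have h0 : h p.2 * f p.2 = 0 := by
        by_contra h0
        have := hsep p.2 p.2 (left_ne_zero_of_mul h0) (right_ne_zero_of_mul h0)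
        simp at this; linarith
      rw [he, h0, mul_comm (f p.2), h0]
      simp
    · rw [← neg_sub p.1 p.2, hK.odd _ (sub_ne_zero.2 hne), smul_neg, ← sub_eq_add_neg, ← sub_smul,
        smul_smul]
      congr 1; ring
  rw [pairing_eq]
  simp_rw [h1]
  have hF' : Integrable (fun p : RSpace d × RSpace d => sepInt K f h p.swap) (μ.prod μ) := hF.swap
  rw [integral_smul, integral_add hF hF', integral_prod_swap, ← two_smul ℂ, smul_smul]
  norm_num

/-- The constant in the `L¹` estimate of the tails. -/
noncomputable def tailConstOne (s C Λ : ℝ) : ℝ := 2 * C * growthConst (s + 1) s * Λ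

/-- The constant in the estimate of the tails. -/
noncomputable def tailConst (s C Λ : ℝ) : ℝ := tailConstOne s C Λ * (2 ^ s * Λ)

theorem KernelBounds.tailConstOne_pos (hK : KernelBounds s C K) (hΛ : 0 < Λ) :
    0 < tailConstOne s C Λ := by
  have := hK.C_pos
  have := growthConst_pos (p := s + 1) (q := s) (by linarith)
  unfold tailConstOne
  positivity

theorem KernelBounds.tailConst_pos (hK : KernelBounds s C K) (hΛ : 0 < Λ) :
    0 < tailConst s C Λ := by
  have := hK.tailConstOne_pos hΛ
  unfold tailConst
  positivity

/-- For |y| > R ≥ 2ρ the difference of kernels is at most a multiple of ρ |y|^(-s-1), and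
integration over |y| ≥ R costs R^(-1) by the growth of `μ`. The bound involves only the L¹ norm of
`φ`, so it also serves for bumps at uncontrolled small scales, whose supremum may be huge. -/
theorem lintegral_tailInt_le_mul (hK : KernelBounds s C K) (hΛ : 0 < Λ) (hμ : IsNice s Λ μ)
    {ρ b R : ℝ} (hρ : 0 < ρ) (hb : 0 ≤ b) (hR : 2 * ρ ≤ R) {x : RSpace d}
    (hx : ‖x‖ ≤ ρ) (hφm : Measurable φ) (hφ : ∀ y, ρ < ‖y‖ → φ y = 0)
    (hgb : ∀ y, ‖1 - g y‖ ≤ b) (hg : ∀ y, ‖y‖ ≤ R → g y = 1) :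
    ∫⁻ p, ‖tailInt K φ g x p‖ₑ ∂(μ.prod μ) ≤
      ENNReal.ofReal (tailConstOne s C Λ * b * ρ / R) * ∫⁻ y, ‖φ y‖ₑ ∂μ := by
  have := hμ.isLocallyFinite
  have hC := hK.C_pos
  have hR0 : 0 < R := by linarith
  set F : RSpace d → ENNReal := (ball 0 R)ᶜ.indicator
    (fun y => ENNReal.ofReal (b * C * (2 * ρ)) * ‖y - 0‖ₑ ^ (-(s + 1))) with hF
  have hpt : ∀ p, ‖tailInt K φ g x p‖ₑ ≤ F p.1 * ‖φ p.2‖ₑ := by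
    intro p
    by_cases h1 : ‖p.1‖ ≤ R
    · simp [tailInt, hg _ h1]
    by_cases h2 : ρ < ‖p.2‖
    · simp [tailInt, hφ _ h2]
    push Not at h1 h2
    have hF1 : F p.1 = ENNReal.ofReal (b * C * (2 * ρ)) * ‖p.1‖ₑ ^ (-(s + 1)) := by
      rw [hF, indicator_of_mem (by simpa using h1.le), sub_zero]
    have hne : p.1 ≠ 0 := by
      rintro h; rw [h, norm_zero] at h1; linarith
    have h3 := hK.diff x p.2 p.1 hne (by linarith) (by linarith)
    have h4 : ‖x - p.2‖ ≤ 2 * ρ := (norm_sub_le _ _).trans (by linarith)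
    have h5 : ‖(1 - g p.1)‖ₑ ≤ ENNReal.ofReal b := by
      rw [← ofReal_norm]; exact ENNReal.ofReal_le_ofReal (hgb _)
    rw [tailInt, enorm_smul, enorm_mul, hF1]
    calc _ ≤ (ENNReal.ofReal b * ‖φ p.2‖ₑ) *
          (ENNReal.ofReal (C * (2 * ρ)) * ‖p.1‖ₑ ^ (-(s + 1))) := by
          gcongr
          refine h3.trans ?_
          gcongr
      _ = _ := by
          rw [mul_assoc b, ENNReal.ofReal_mul hb]; ring
  calc _ ≤ ∫⁻ p, F p.1 * ‖φ p.2‖ₑ ∂(μ.prod μ) := lintegral_mono hpt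
    _ = (∫⁻ y, F y ∂μ) * ∫⁻ z, ‖φ z‖ₑ ∂μ := by
        refine lintegral_prod_mul (f := F) (g := fun z => ‖φ z‖ₑ) ?_ ?_
        · exact (Measurable.indicator (by fun_prop) measurableSet_ball.compl).aemeasurable
        · exact hφm.enorm.aemeasurable
    _ ≤ (ENNReal.ofReal (b * C * (2 * ρ)) *
          ENNReal.ofReal (growthConst (s + 1) s * Λ * R ^ (s - (s + 1)))) *
        ∫⁻ z, ‖φ z‖ₑ ∂μ := by
        gcongr
        rw [lintegral_indicator measurableSet_ball.compl, lintegral_const_mul _ (by fun_prop)]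
        gcongr
        exact hμ.lintegral_compl_ball_le hΛ (by linarith) hR0 0
    _ = _ := by
        have hgc := growthConst_pos (p := s + 1) (q := s) (by linarith)
        rw [← ENNReal.ofReal_mul (by positivity)]
        congr 2
        have : s - (s + 1) = -1 := by ring
        rw [this, Real.rpow_neg_one, tailConstOne]
        field_simp

theorem lintegral_tailInt_le (hK : KernelBounds s C K) (hΛ : 0 < Λ) (hμ : IsNice s Λ μ)
    {ρ B b R : ℝ} (hρ : 0 < ρ) (hB : 0 ≤ B) (hb : 0 ≤ b) (hR : 2 * ρ ≤ R) {x : RSpace d}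
    (hx : ‖x‖ ≤ ρ) (hφm : Measurable φ) (hφB : ∀ y, ‖φ y‖ ≤ B) (hφ : ∀ y, ρ < ‖y‖ → φ y = 0)
    (hgb : ∀ y, ‖1 - g y‖ ≤ b) (hg : ∀ y, ‖y‖ ≤ R → g y = 1) :
    ∫⁻ p, ‖tailInt K φ g x p‖ₑ ∂(μ.prod μ) ≤
      ENNReal.ofReal (tailConst s C Λ * b * B * ρ ^ (s + 1) / R) := by
  have hR0 : 0 < R := by linarith
  have hT := hK.tailConstOne_pos hΛ
  have h1 : ∫⁻ y, ‖φ y‖ₑ ∂μ ≤ ENNReal.ofReal (B * (2 ^ s * Λ * ρ ^ s)) := by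
    calc _ ≤ ∫⁻ y, (closedBall 0 ρ).indicator (fun _ => ENNReal.ofReal B) y ∂μ := by
          refine lintegral_mono fun y => ?_
          by_cases h2 : ρ < ‖y‖
          · simp [hφ _ h2]
          · rw [indicator_of_mem (by simpa using h2), ← ofReal_norm]
            exact ENNReal.ofReal_le_ofReal (hφB _)
      _ ≤ _ := by
          rw [lintegral_indicator measurableSet_closedBall, setLIntegral_const,
            ENNReal.ofReal_mul hB]
          exact mul_le_mul_right (hμ.measure_closedBall_le 0 hρ) _
  refine (lintegral_tailInt_le_mul hK hΛ hμ hρ hb hR hx hφm hφ hgb hg).trans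
    ((mul_le_mul_right h1 _).trans ?_)
  rw [← ENNReal.ofReal_mul (by positivity)]
  refine ENNReal.ofReal_le_ofReal (le_of_eq ?_)
  rw [tailConst, Real.rpow_add hρ, Real.rpow_one]
  ring

theorem integrable_tailInt (hK : KernelBounds s C K) (hΛ : 0 < Λ) (hμ : IsNice s Λ μ)
    {ρ R : ℝ} (hρ : 0 < ρ) (hR : 2 * ρ ≤ R) {x : RSpace d}
    (hx : ‖x‖ ≤ ρ) (hφ : IsLip0 φ) (hφρ : ∀ y, ρ < ‖y‖ → φ y = 0)
    (hg : IsCut R g) : Integrable (tailInt K φ g x) (μ.prod μ) := by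
  obtain ⟨B, hB, hφB⟩ := hφ.exists_bound
  refine ⟨(hK.measurable_tailInt hφ.continuous.measurable
    hg.isLip0.continuous.measurable x).aestronglyMeasurable, ?_⟩
  exact (lintegral_tailInt_le hK hΛ hμ hρ hB.le zero_le_one hR hx
    hφ.continuous.measurable hφB hφρ hg.norm_le
    hg.eq_one).trans_lt ENNReal.ofReal_lt_top

theorem norm_integral_tailInt_le (hK : KernelBounds s C K) (hΛ : 0 < Λ) (hμ : IsNice s Λ μ)
    {ρ B R : ℝ} (hρ : 0 < ρ) (hB : 0 ≤ B) (hR : 2 * ρ ≤ R) {x : RSpace d}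
    (hx : ‖x‖ ≤ ρ) (hφm : Measurable φ) (hφB : ∀ y, ‖φ y‖ ≤ B) (hφ : ∀ y, ρ < ‖y‖ → φ y = 0)
    (hg : IsCut R g) :
    ‖∫ p, tailInt K φ g x p ∂(μ.prod μ)‖ ≤ tailConst s C Λ * B * ρ ^ (s + 1) / R := by
  have h1 := (enorm_integral_le_lintegral_enorm _).trans (lintegral_tailInt_le hK hΛ hμ hρ hB
    zero_le_one hR hx hφm hφB hφ hg.norm_le hg.eq_one)
  have := hK.tailConst_pos hΛ
  have hR0 : 0 < R := by linarith
  rw [← ofReal_norm, ENNReal.ofReal_le_ofReal_iff (by positivity), mul_one] at h1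
  exact h1

end Pairing

/-! ### Truncations of T̄(1), and reflectionlessness in quantitative form -/

section TruncatedPotential

variable {d d' : ℕ} {s C Λ : ℝ} {K : RSpace d → CSpace d'} {μ : Measure (RSpace d)}
  {f g h φ : RSpace d → ℂ}

theorem KernelBounds.norm_le_of_le (hK : KernelBounds s C K) {ε : ℝ} (hε : 0 < ε) {u : RSpace d}
    (hu : ε ≤ ‖u‖) : ‖K u‖ ≤ ε ^ (-s) := by
  have hpos : 0 < ‖u‖ := hε.trans_le hu
  have h2 := hK.size u
  rw [← ofReal_norm, ← ofReal_norm, ENNReal.ofReal_rpow_of_pos hpos] at h2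
  refine ((ENNReal.ofReal_le_ofReal_iff (by positivity)).1 h2).trans ?_
  exact Real.rpow_le_rpow_of_nonpos hε hu (by linarith [hK.s_pos])

theorem integrable_smul_kernel_off (hK : KernelBounds s C K) [IsLocallyFiniteMeasure μ]
    (hf : IsLip0 f) {ε : ℝ} (hε : 0 < ε) {x : RSpace d} (hsep : ∀ y, f y ≠ 0 → ε ≤ ‖x - y‖) :
    Integrable (fun y => f y • K (x - y)) μ := by
  have hm : Measurable (fun y => f y • K (x - y)) := by
    have h1 := hf.continuous.measurable
    have h3 := hK.measurable
    fun_prop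
  have hint : Integrable (fun y => ε ^ (-s) * ‖f y‖) μ := hf.integrable.norm.const_mul _
  refine hint.mono' hm.aestronglyMeasurable (ae_of_all _ fun y => ?_)
  rw [norm_smul, mul_comm]
  by_cases h0 : f y = 0
  · simp [h0]
  · exact mul_le_mul_of_nonneg_right (hK.norm_le_of_le hε (hsep y h0)) (norm_nonneg _)

/-- Finiteness of the `s`-dimensional potential of `μ` at `x`. -/
def HasPotential (s : ℝ) (μ : Measure (RSpace d)) (x : RSpace d) : Prop :=
  ∫⁻ y in ball x 1, ‖y - x‖ₑ ^ (-s) ∂μ < ⊤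

theorem integrable_smul_kernel (hK : KernelBounds s C K) [IsLocallyFiniteMeasure μ]
    (hg : IsLip0 g) {x : RSpace d} (hx : HasPotential s μ x) :
    Integrable (fun y => g y • K (y - x)) μ := by
  have hm : Measurable (fun y => g y • K (y - x)) := by
    have h1 := hg.continuous.measurable
    have h3 := hK.measurable
    fun_prop
  refine ⟨hm.aestronglyMeasurable, ?_⟩
  obtain ⟨B, hB0, hB⟩ := hg.exists_bound
  rw [hasFiniteIntegral_iff_enorm]
  calc ∫⁻ y, ‖g y • K (y - x)‖ₑ ∂μ
      ≤ ∫⁻ y, ((ball x 1).indicator (fun y => ENNReal.ofReal B * ‖y - x‖ₑ ^ (-s)) y + ‖g y‖ₑ) ∂μ := by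
        refine lintegral_mono fun y => ?_
        dsimp only
        rw [enorm_smul]
        by_cases hy : y ∈ ball x 1
        · rw [indicator_of_mem hy]
          refine le_trans ?_ le_self_add
          refine mul_le_mul' ?_ (hK.size _)
          rw [← ofReal_norm]; exact ENNReal.ofReal_le_ofReal (hB y)
        · rw [indicator_of_notMem hy, zero_add]
          refine mul_le_of_le_one_right' ?_
          rw [mem_ball, dist_eq_norm, not_lt] at hy
          rw [← ofReal_norm, ← ENNReal.ofReal_one]
          have := hK.norm_le_of_le one_pos hy
          rw [Real.one_rpow] at this
          exact ENNReal.ofReal_le_ofReal this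
    _ = ENNReal.ofReal B * ∫⁻ y in ball x 1, ‖y - x‖ₑ ^ (-s) ∂μ + ∫⁻ y, ‖g y‖ₑ ∂μ := by
        rw [lintegral_add_left (Measurable.indicator (by fun_prop) measurableSet_ball),
          lintegral_indicator measurableSet_ball, lintegral_const_mul _ (by fun_prop)]
    _ < ⊤ := ENNReal.add_lt_top.2 ⟨ENNReal.mul_lt_top ENNReal.ofReal_lt_top hx,
        hasFiniteIntegral_iff_enorm.1 hg.integrable.2⟩

/-- The part of `TbarAt` that only involves the cut-off integrals. -/
noncomputable def mainPart (K : RSpace d → CSpace d') (μ : Measure (RSpace d))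
    (φ g : RSpace d → ℂ) (x : RSpace d) : CSpace d' :=
  ∫ y, g y • K (y - x) ∂μ - pairing K μ φ g

theorem IsCut.mono {R R' : ℝ} (hg : IsCut R g) (h : R' ≤ R) : IsCut R' g :=
  ⟨hg.isLip0, hg.norm_le, fun x hx => hg.eq_one x (hx.trans h)⟩

theorem IsCut.separated {ρ R : ℝ} {g₁ g₂ : RSpace d → ℂ} (hR : 2 * ρ ≤ R)
    (h₁ : IsCut R g₁) (h₂ : IsCut R g₂) (hφ : ∀ y, ρ < ‖y‖ → φ y = 0) (x y : RSpace d)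
    (hx : g₁ x - g₂ x ≠ 0) (hy : φ y ≠ 0) : ρ ≤ ‖x - y‖ := by
  have h1 : R < ‖x‖ := by
    by_contra! h
    rw [h₁.eq_one x h, h₂.eq_one x h, sub_self] at hx
    exact hx rfl
  have h2 : ‖y‖ ≤ ρ := by
    by_contra! h
    exact hy (hφ y h)
  have := norm_sub_norm_le x y
  linarith

/-- Since `g₁ - g₂` lives away from the support of `φ`, the change in the pairing is an ordinary
integral. The normalisation of `φ` writes the change in the potential as a double integral as well,
and together they cancel the change in the tail. -/
theorem mainPart_add_tail_eq (hK : KernelBounds s C K) (hΛ : 0 < Λ) (hμ : IsNice s Λ μ)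
    {ρ R : ℝ} (hρ : 0 < ρ) (hR : 2 * ρ ≤ R) {x : RSpace d} (hx : ‖x‖ ≤ ρ)
    (hpot : HasPotential s μ x) (hφ : IsLip0 φ) (hφρ : ∀ y, ρ < ‖y‖ → φ y = 0)
    (hφ1 : ∫ y, φ y ∂μ = 1) {g₁ g₂ : RSpace d → ℂ} (h₁ : IsCut R g₁) (h₂ : IsCut R g₂) :
    mainPart K μ φ g₁ x + ∫ p, tailInt K φ g₁ x p ∂(μ.prod μ) =
      mainPart K μ φ g₂ x + ∫ p, tailInt K φ g₂ x p ∂(μ.prod μ) := by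
  have := hμ.isLocallyFinite
  have hh : IsLip0 (fun y => g₁ y - g₂ y) := h₁.isLip0.sub h₂.isLip0
  have hsep := IsCut.separated hR h₁ h₂ hφρ
  have e1 : pairing K μ φ g₁ - pairing K μ φ g₂ =
      ∫ p, sepInt K φ (fun y => g₁ y - g₂ y) p ∂(μ.prod μ) := by
    rw [← pairing_sub_right hK hΛ hμ hφ h₂.isLip0 h₁.isLip0,
      pairing_eq_of_separated hK hφ hh hρ hsep]
  have i1 := integrable_smul_kernel hK h₁.isLip0 hpot
  have i2 := integrable_smul_kernel hK h₂.isLip0 hpot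
  have e2 : ∫ p, φ p.2 • ((g₁ p.1 - g₂ p.1) • K (p.1 - x)) ∂(μ.prod μ) =
      ∫ y, g₁ y • K (y - x) ∂μ - ∫ y, g₂ y • K (y - x) ∂μ := by
    rw [← integral_sub i1 i2, ← integral_prod_swap]
    have := integral_prod_smul (μ := μ) (ν := μ) φ (fun y => (g₁ y - g₂ y) • K (y - x))
    simp only [Prod.fst_swap, Prod.snd_swap]
    rw [this, hφ1, one_smul]
    simp only [sub_smul]
  have i3 : Integrable (fun p : RSpace d × RSpace d =>
      φ p.2 • ((g₁ p.1 - g₂ p.1) • K (p.1 - x))) (μ.prod μ) := by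
    have : Integrable (fun y => (g₁ y - g₂ y) • K (y - x)) μ := by
      simp only [sub_smul]; exact i1.sub i2
    exact (Integrable.smul_prod hφ.integrable this).swap
  have e3 : ∫ p, tailInt K φ g₂ x p ∂(μ.prod μ) - ∫ p, tailInt K φ g₁ x p ∂(μ.prod μ) =
      ∫ p, φ p.2 • ((g₁ p.1 - g₂ p.1) • K (p.1 - x)) ∂(μ.prod μ) -
        ∫ p, sepInt K φ (fun y => g₁ y - g₂ y) p ∂(μ.prod μ) := by
    rw [← integral_sub (integrable_tailInt hK hΛ hμ hρ hR hx hφ hφρ h₂)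
      (integrable_tailInt hK hΛ hμ hρ hR hx hφ hφρ h₁),
      ← integral_sub i3 (integrable_sepInt hK hφ hh hρ hsep)]
    congr 1; ext1 p
    simp only [tailInt, sepInt, ← sub_smul, smul_smul]
    rw [mul_comm (φ p.2), ← smul_sub]
    congr 1; ring
  rw [e2, ← e1] at e3
  simp only [mainPart]
  have e4 := sub_eq_iff_eq_add.1 e3
  rw [e4]; abel

theorem norm_le_sSup_tsupport (hφ : IsLip0 φ) {y : RSpace d} (hy : φ y ≠ 0) :
    ‖y‖ ≤ sSup (norm '' tsupport φ) := by
  refine le_csSup ?_ ⟨y, subset_tsupport _ hy, rfl⟩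
  exact (hφ.2.isCompact.image continuous_norm).bddAbove

theorem Tbar_eq (hK : KernelBounds s C K) (hΛ : 0 < Λ) (hμ : IsNice s Λ μ)
    {ρ R : ℝ} (hρ : 0 < ρ) (hR : 2 * ρ ≤ R) {x : RSpace d} (hx : ‖x‖ ≤ ρ)
    (hpot : HasPotential s μ x) (hφ : IsLip0 φ) (hφρ : ∀ y, ρ < ‖y‖ → φ y = 0)
    (hφ1 : ∫ y, φ y ∂μ = 1) (hg : IsCut R g) :
    Tbar K μ φ x = mainPart K μ φ g x + ∫ p, tailInt K φ g x p ∂(μ.prod μ) := by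
  set a := sSup (norm '' tsupport φ) with ha
  have ha0 : 0 ≤ a := Real.sSup_nonneg (by rintro _ ⟨y, _, rfl⟩; exact norm_nonneg y)
  have hR0 : 0 < largeRadius φ x := by
    unfold largeRadius
    have := norm_nonneg x
    positivity
  -- This radius still contains `x` and the support of `φ`, and its double is below both `R` and the
  -- radius built into `Tbar`, so both cut-offs can be compared at the smaller of those two radii.
  set r := min ρ (‖x‖ + a + 1) with hr
  have hr0 : 0 < r := lt_min hρ (by have := norm_nonneg x; linarith)
  have h1 : 2 * r ≤ min R (largeRadius φ x) := by
    refine le_min ((mul_le_mul_of_nonneg_left (min_le_left _ _) (by norm_num)).trans hR) ?_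
    exact mul_le_mul_of_nonneg_left (min_le_right _ _) (by norm_num)
  refine mainPart_add_tail_eq hK hΛ hμ hr0 h1 (le_min hx (by linarith)) hpot hφ ?_ hφ1
    ((isCut_cutoff hR0).mono (min_le_right _ _)) (hg.mono (min_le_left _ _))
  intro y hy
  rw [hr, min_lt_iff] at hy
  rcases hy with h | h
  · exact hφρ y h
  · by_contra h0
    have := norm_le_sSup_tsupport hφ h0
    have := norm_nonneg x
    linarith

theorem norm_Tbar_sub_mainPart_le (hK : KernelBounds s C K) (hΛ : 0 < Λ) (hμ : IsNice s Λ μ)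
    {ρ B R : ℝ} (hρ : 0 < ρ) (hB : 0 ≤ B) (hR : 2 * ρ ≤ R) {x : RSpace d} (hx : ‖x‖ ≤ ρ)
    (hpot : HasPotential s μ x) (hφ : IsLip0 φ) (hφB : ∀ y, ‖φ y‖ ≤ B)
    (hφρ : ∀ y, ρ < ‖y‖ → φ y = 0) (hφ1 : ∫ y, φ y ∂μ = 1) (hg : IsCut R g) :
    ‖Tbar K μ φ x - mainPart K μ φ g x‖ ≤ tailConst s C Λ * B * ρ ^ (s + 1) / R := by
  rw [Tbar_eq hK hΛ hμ hρ hR hx hpot hφ hφρ hφ1 hg, add_sub_cancel_left]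
  exact norm_integral_tailInt_le hK hΛ hμ hρ hB hR hx hφ.continuous.measurable hφB hφρ hg

/-- As `f` has mean zero, K(x) can be subtracted from K(x - y) at no cost. The far part of T(fμ) is
therefore a tail integral with base point 0, up to sign. -/
theorem offSupport_tail (hK : KernelBounds s C K) (hΛ : 0 < Λ) (hμ : IsNice s Λ μ)
    {ρ R : ℝ} (hρ : 0 < ρ) (hR : 2 * ρ ≤ R) (hf : IsLip0 f) (hfρ : ∀ y, ρ < ‖y‖ → f y = 0)
    (hf0 : ∫ y, f y ∂μ = 0) (hg : IsCut R g) :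
    Integrable (fun x => (1 - g x) • offSupport K μ f x) μ ∧
      ∫ x, (1 - g x) • offSupport K μ f x ∂μ = -∫ p, tailInt K f g 0 p ∂(μ.prod μ) := by
  have := hμ.isLocallyFinite
  have hint := integrable_tailInt hK hΛ hμ hρ hR (x := 0) (by simpa using hρ.le) hf hfρ hg
  have key : ∀ x, (1 - g x) • offSupport K μ f x = -∫ y, tailInt K f g 0 (x, y) ∂μ := by
    intro x
    by_cases hx : ‖x‖ ≤ R
    · simp [tailInt, hg.eq_one x hx]
    · have i1 : Integrable (fun y => f y • K (x - y)) μ := by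
        refine integrable_smul_kernel_off hK hf hρ fun y hy => ?_
        have h2 : ‖y‖ ≤ ρ := by
          by_contra! h
          exact hy (hfρ y h)
        have := norm_sub_norm_le x y
        linarith
      have e1 : ∀ y, tailInt K f g 0 (x, y) =
          (1 - g x) • (f y • K x - f y • K (x - y)) := by
        intro y
        simp only [tailInt, sub_zero, ← smul_sub, smul_smul]
      simp_rw [e1]
      rw [integral_smul, integral_sub (hf.integrable.smul_const _) i1, integral_smul_const, hf0,
        zero_smul, zero_sub, smul_neg, neg_neg, offSupport]
  simp_rw [key]
  exact ⟨hint.integral_prod_left.neg, by rw [integral_neg, integral_prod _ hint]⟩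

/-- Quantitative form of the vanishing of `⟨T(f μ), 1⟩_μ`, with a rate of convergence. -/
def PairDecay (s T : ℝ) (K : RSpace d → CSpace d') (μ : Measure (RSpace d)) : Prop :=
  ∀ f, IsLip0 f → ∫ y, f y ∂μ = 0 → ∀ ρ B R : ℝ, 0 < ρ → 0 ≤ B → 2 * ρ ≤ R →
    (∀ y, ‖f y‖ ≤ B) → (∀ y, ρ < ‖y‖ → f y = 0) → ∀ g, IsCut R g →
    ‖pairing K μ f g‖ ≤ T * B * ρ ^ (s + 1) / R

/-- The two terms of the extended form must cancel, so the pairing with a cut-off equals a tail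
integral, which decays like 1/R. The constant depends only on s, C and Λ; this uniformity is what
survives rescaling and vague limits. -/
theorem IsReflectionless.pairDecay {α : ℝ} (hK : KernelBounds s C K) (hΛ : 0 < Λ)
    (hμ : IsNice s Λ μ) (h : IsReflectionless s α K μ) :
    PairDecay s (tailConst s C Λ) K μ := by
  intro f hf hf0 ρ B R hρ hB hR hfB hfρ g hg
  have h1 := h.vanishing f hf hf0 g hg.isLip0 ?_
  · simp only [extPairing, mul_one] at h1
    rw [(offSupport_tail hK hΛ hμ hρ hR hf hfρ hf0 hg).2, ← sub_eq_add_neg, sub_eq_zero] at h1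
    rw [h1]
    exact norm_integral_tailInt_le hK hΛ hμ hρ hB hR (by simpa using hρ.le)
      hf.continuous.measurable hfB hfρ hg
  · have h2 : tsupport f ⊆ ball 0 R := by
      have : tsupport f ⊆ closedBall 0 ρ := by
        refine closure_minimal (fun y hy => ?_) isClosed_closedBall
        rw [mem_closedBall_zero_iff]
        by_contra! h
        exact hy (hfρ y h)
      exact this.trans (closedBall_subset_ball (by linarith))
    filter_upwards [isOpen_ball.mem_nhdsSet.2 h2] with x hx
    exact hg.eq_one x (mem_ball_zero_iff.1 hx).le

/-- Converse direction: for every admissible ψ the extended form equals the pairing with a large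
cut-off minus a tail integral, and the latter tends to 0. The difference of the two cut-offs is
separated from the support of `f`, so it enters only through a plain integral. -/
theorem isReflectionless_of_tendsto {α : ℝ} (hα : 0 < α) (hK : KernelBounds s C K) (hΛ : 0 < Λ)
    (hμ : IsNice s Λ μ)
    (h : ∀ f, IsLip0 f → ∫ y, f y ∂μ = 0 →
      Tendsto (fun R => pairing K μ f (cutoff R)) atTop (𝓝 0)) :
    IsReflectionless s α K μ := by
  have := hμ.isLocallyFinite
  refine ⟨this, hμ.isDiffuse hK.s_pos hΛ, hμ.hasRestrictedGrowth hα hΛ, ?_⟩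
  intro f hf hf0 ψ hψ hψ1
  obtain ⟨ρ, hρ, hfρ⟩ := hf.exists_radius
  obtain ⟨B, hB, hfB⟩ := hf.exists_bound
  obtain ⟨U, hU, hfU, hU1⟩ := mem_nhdsSet_iff_exists.1 hψ1
  obtain ⟨ε, hε, hεU⟩ := hf.2.isCompact.exists_thickening_subset_open hU hfU
  have key : ∀ R, 2 * ρ ≤ R → extPairing K μ f (fun _ => 1) ψ =
      pairing K μ f (cutoff R) - ∫ p, tailInt K f (cutoff R) 0 p ∂(μ.prod μ) := by
    intro R hR
    have hg := isCut_cutoff (d := d) (by linarith : 0 < R)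
    obtain ⟨i1, e1⟩ := offSupport_tail hK hΛ hμ hρ hR hf hfρ hf0 hg
    have hh : IsLip0 (fun x => cutoff R x - ψ x) := hg.isLip0.sub hψ
    have hsep : ∀ x y, cutoff R x - ψ x ≠ 0 → f y ≠ 0 → min ε ρ ≤ ‖x - y‖ := by
      intro x y hx hy
      by_contra! hlt
      refine hx ?_
      have h1 : ψ x = 1 := by
        refine hU1 (hεU (mem_thickening_iff.2 ⟨y, subset_tsupport _ hy, ?_⟩))
        rw [dist_eq_norm]
        exact hlt.trans_le (min_le_left _ _)
      have h2 : ‖y‖ ≤ ρ := by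
        by_contra! h
        exact hy (hfρ y h)
      have h3 := norm_sub_norm_le x y
      have h4 := min_le_right ε ρ
      rw [h1, cutoff_eq_one (by linarith) (by linarith), sub_self]
    have hmin : 0 < min ε ρ := lt_min hε hρ
    have i2 := integrable_sepInt (μ := μ) hK hf hh hmin hsep
    have e2 := pairing_eq_of_separated (μ := μ) hK hf hh hmin hsep
    rw [pairing_sub_right hK hΛ hμ hf hψ hg.isLip0, integral_prod _ i2] at e2
    have e3 : ∀ x, ∫ y, sepInt K f (fun x => cutoff R x - ψ x) (x, y) ∂μ =
        (cutoff R x - ψ x) • offSupport K μ f x := by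
      intro x
      simp only [sepInt, offSupport, mul_smul]
      rw [integral_smul]
    have i3 : Integrable (fun x => (cutoff R x - ψ x) • offSupport K μ f x) μ := by
      simpa only [e3] using i2.integral_prod_left
    simp_rw [e3] at e2
    have e4 : ∀ x, (1 - ψ x) • offSupport K μ f x = (1 - cutoff R x) • offSupport K μ f x +
        (cutoff R x - ψ x) • offSupport K μ f x := by
      intro x; rw [← add_smul]; congr 1; ring
    simp only [extPairing, mul_one]
    simp_rw [e4]
    rw [integral_add i1 i3, e1, ← e2]
    abel
  have hT := hK.tailConst_pos hΛ
  have l1 : Tendsto (fun R : ℝ => ∫ p, tailInt K f (cutoff R) 0 p ∂(μ.prod μ)) atTop (𝓝 0) := by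
    have l2 : Tendsto (fun R : ℝ => tailConst s C Λ * B * ρ ^ (s + 1) / R) atTop (𝓝 0) :=
      tendsto_const_nhds.div_atTop tendsto_id
    refine squeeze_zero_norm' ?_ l2
    filter_upwards [eventually_ge_atTop (2 * ρ)] with R hR
    exact norm_integral_tailInt_le hK hΛ hμ hρ hB.le hR (by simpa using hρ.le)
      hf.continuous.measurable hfB hfρ
      (isCut_cutoff (by linarith))
  have l3 := (h f hf hf0).sub l1
  rw [sub_zero] at l3
  refine tendsto_nhds_unique (Tendsto.congr' ?_ tendsto_const_nhds) l3
  filter_upwards [eventually_ge_atTop (2 * ρ)] with R hR using key R hR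

/-- The error is a tail of size O(1/R). The family `G` with the shift `a` allows for cut-offs
carried along by an affine map, which are centred away from 0. -/
theorem tendsto_mainPart_cutoff (hK : KernelBounds s C K) (hΛ : 0 < Λ) (hμ : IsNice s Λ μ)
    {x : RSpace d} (hpot : HasPotential s μ x) (hφ : IsLip0 φ) (hφ1 : ∫ y, φ y ∂μ = 1)
    (G : ℝ → RSpace d → ℂ) (a : ℝ) (hG : ∀ᶠ R in atTop, IsCut (R - a) (G R)) :
    Tendsto (fun R => mainPart K μ φ (G R) x) atTop (𝓝 (Tbar K μ φ x)) := by
  obtain ⟨ρ, hρ, hfρ⟩ := hφ.exists_radius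
  obtain ⟨B, hB, hfB⟩ := hφ.exists_bound
  have l2 : Tendsto (fun R : ℝ => tailConst s C Λ * B * (ρ + ‖x‖) ^ (s + 1) / (R - a)) atTop
      (𝓝 0) :=
    tendsto_const_nhds.div_atTop (tendsto_atTop_add_const_right _ (-a) tendsto_id)
  rw [tendsto_iff_norm_sub_tendsto_zero]
  refine squeeze_zero' (Eventually.of_forall fun _ => norm_nonneg _) ?_ l2
  filter_upwards [hG, eventually_ge_atTop (2 * (ρ + ‖x‖) + a)] with R hR1 hR2
  rw [norm_sub_rev]
  have := norm_nonneg x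
  exact norm_Tbar_sub_mainPart_le hK hΛ hμ (by positivity) hB.le (by linarith) (by linarith) hpot
    hφ hfB (fun y hy => hfρ y (by linarith)) hφ1 hR1

theorem PairDecay.tendsto {T : ℝ} (h : PairDecay s T K μ) (hf : IsLip0 f) (hf0 : ∫ y, f y ∂μ = 0)
    (G : ℝ → RSpace d → ℂ) (a : ℝ) (hG : ∀ᶠ R in atTop, IsCut (R - a) (G R)) :
    Tendsto (fun R => pairing K μ f (G R)) atTop (𝓝 0) := by
  obtain ⟨ρ, hρ, hfρ⟩ := hf.exists_radius
  obtain ⟨B, hB, hfB⟩ := hf.exists_bound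
  have l2 : Tendsto (fun R : ℝ => T * B * ρ ^ (s + 1) / (R - a)) atTop (𝓝 0) :=
    tendsto_const_nhds.div_atTop (tendsto_atTop_add_const_right _ (-a) tendsto_id)
  refine squeeze_zero_norm' ?_ l2
  filter_upwards [hG, eventually_ge_atTop (2 * ρ + a)] with R hR1 hR2
  exact h f hf hf0 ρ B (R - a) hρ hB.le (by linarith) hfB hfρ _ hR1

theorem isCut_cutoff_sub_zero : ∀ᶠ R in atTop, IsCut (R - 0) (cutoff (d := d) R) := by
  filter_upwards [eventually_gt_atTop 0] with R hR
  rw [sub_zero]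
  exact isCut_cutoff hR

/-- Here reflectionlessness enters: changing the normalising function alters the truncations by a
pairing with a function of mean zero, and that pairing tends to 0. The function can thus be chosen
to suit the estimate. -/
theorem Tbar_eq_Tbar {T : ℝ} (hK : KernelBounds s C K) (hΛ : 0 < Λ) (hμ : IsNice s Λ μ)
    (hd : PairDecay s T K μ) {x : RSpace d} (hpot : HasPotential s μ x)
    (hφ : IsLip0 φ) (hφ1 : ∫ y, φ y ∂μ = 1) (hf : IsLip0 f) (hf1 : ∫ y, f y ∂μ = 1) :
    Tbar K μ φ x = Tbar K μ f x := by
  have := hμ.isLocallyFinite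
  have l1 := tendsto_mainPart_cutoff hK hΛ hμ hpot hφ hφ1 cutoff 0 isCut_cutoff_sub_zero
  have l2 := tendsto_mainPart_cutoff hK hΛ hμ hpot hf hf1 cutoff 0 isCut_cutoff_sub_zero
  have l3 := hd.tendsto (hf.sub hφ)
    (by rw [integral_sub hf.integrable hφ.integrable, hf1, hφ1, sub_self]) cutoff 0
    isCut_cutoff_sub_zero
  have l4 := l1.sub l2
  refine sub_eq_zero.1 (tendsto_nhds_unique (l4.congr' ?_) l3)
  filter_upwards [eventually_gt_atTop 0] with R hR
  rw [pairing_sub_left hK hΛ hμ hf hφ (isCut_cutoff hR).isLip0]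
  simp only [mainPart]
  abel

end TruncatedPotential

/-! ### Invariance under translations and dilations -/

section Rescale

variable {d d' : ℕ} {s C Λ : ℝ} {K : RSpace d → CSpace d'} {μ : Measure (RSpace d)}
  {f g h φ : RSpace d → ℂ} {a : RSpace d} {r : ℝ}

/-- The map `y ↦ r⁻¹ (y - a)`. -/
noncomputable def rescaleMap (a : RSpace d) (r : ℝ) (y : RSpace d) : RSpace d := r⁻¹ • (y - a)

theorem measurable_rescaleMap : Measurable (rescaleMap a r) := by unfold rescaleMap; fun_prop

theorem measurableEmbedding_rescaleMap (hr : 0 < r) : MeasurableEmbedding (rescaleMap a r) :=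
  ((Homeomorph.subRight a).trans
    (Homeomorph.smulOfNeZero r⁻¹ (inv_ne_zero hr.ne'))).measurableEmbedding

theorem rescaleMap_sub (y z : RSpace d) :
    rescaleMap a r y - rescaleMap a r z = r⁻¹ • (y - z) := by
  rw [rescaleMap, rescaleMap, ← smul_sub, sub_sub_sub_cancel_right]

theorem rescaleMap_sub_right (hr : 0 < r) (y x : RSpace d) :
    rescaleMap a r y - x = r⁻¹ • (y - (a + r • x)) := by
  rw [rescaleMap, ← sub_sub, smul_sub _ (y - a), inv_smul_smul₀ hr.ne']

theorem rescaleMap_preimage_ball (hr : 0 < r) (x : RSpace d) (t : ℝ) :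
    rescaleMap a r ⁻¹' ball x t = ball (a + r • x) (r * t) := by
  ext y
  rw [mem_preimage, mem_ball, mem_ball, dist_eq_norm, dist_eq_norm, rescaleMap_sub_right hr,
    norm_smul, norm_inv, Real.norm_of_nonneg hr.le, inv_mul_lt_iff₀ hr]

/-- The rescaled measure `A ↦ r ^ (-s) μ(a + r A)`. -/
noncomputable def rescale (s : ℝ) (a : RSpace d) (r : ℝ) (μ : Measure (RSpace d)) :
    Measure (RSpace d) :=
  ENNReal.ofReal (r ^ (-s)) • μ.map (rescaleMap a r)

theorem rescale_ball (hr : 0 < r) (x : RSpace d) (t : ℝ) :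
    rescale s a r μ (ball x t) = ENNReal.ofReal (r ^ (-s)) * μ (ball (a + r • x) (r * t)) := by
  rw [rescale, Measure.smul_apply, smul_eq_mul,
    Measure.map_apply measurable_rescaleMap measurableSet_ball, rescaleMap_preimage_ball hr]

theorem rescale_ball_pos (hr : 0 < r) (x : RSpace d) (t : ℝ) :
    0 < rescale s a r μ (ball x t) ↔ 0 < μ (ball (a + r • x) (r * t)) := by
  rw [rescale_ball hr, pos_iff_ne_zero, pos_iff_ne_zero, mul_ne_zero_iff]
  simp [Real.rpow_pos_of_pos hr]

theorem IsNice.rescale (hμ : IsNice s Λ μ) (hr : 0 < r) : IsNice s Λ (rescale s a r μ) := by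
  intro x t ht
  rw [rescale_ball hr]
  refine (mul_le_mul_right (hμ _ _ (by positivity)) _).trans ?_
  rw [← ENNReal.ofReal_mul (by positivity), Real.mul_rpow hr.le ht.le, Real.rpow_neg hr.le]
  refine ENNReal.ofReal_le_ofReal (le_of_eq ?_)
  have := Real.rpow_pos_of_pos hr s
  field_simp

theorem integral_rescale {E : Type*} [NormedAddCommGroup E] [NormedSpace ℝ E] (hr : 0 < r)
    (F : RSpace d → E) :
    ∫ x, F x ∂(rescale s a r μ) = r ^ (-s) • ∫ y, F (rescaleMap a r y) ∂μ := by
  rw [rescale, integral_smul_measure, (measurableEmbedding_rescaleMap hr).integral_map,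
    ENNReal.toReal_ofReal (by positivity)]

theorem rescale_prod [SFinite μ] (s : ℝ) (a : RSpace d) (r : ℝ) :
    (rescale s a r μ).prod (rescale s a r μ) =
      (ENNReal.ofReal (r ^ (-s)) * ENNReal.ofReal (r ^ (-s))) •
        (μ.prod μ).map (Prod.map (rescaleMap a r) (rescaleMap a r)) := by
  rw [rescale, Measure.prod_smul_left, Measure.prod_smul_right, smul_smul,
    Measure.map_prod_map _ _ measurable_rescaleMap measurable_rescaleMap]

theorem kernel_inv_smul (hK : KernelBounds s C K) (hr : 0 < r) {u : RSpace d} (hu : u ≠ 0) :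
    K (r⁻¹ • u) = r ^ s • K u := by
  rw [hK.homogeneous _ _ (inv_pos.2 hr) hu, Real.rpow_neg (inv_pos.2 hr).le, Real.inv_rpow hr.le,
    inv_inv]

/-- The two copies of the measure contribute r^(-2s) and the homogeneity of K contributes r^s. -/
theorem pairing_rescale (hK : KernelBounds s C K) [SFinite μ] (hr : 0 < r) :
    pairing K (rescale s a r μ) f g =
      r ^ (-s) • pairing K μ (f ∘ rescaleMap a r) (g ∘ rescaleMap a r) := by
  rw [pairing_eq, pairing_eq, rescale_prod, integral_smul_measure,
    ((measurableEmbedding_rescaleMap hr).prodMap (measurableEmbedding_rescaleMap hr)).integral_map,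
    ENNReal.toReal_mul, ENNReal.toReal_ofReal (by positivity), mul_smul, ← integral_smul]
  congr 2; ext1 p
  simp only [pairInt, Prod.map_fst, Prod.map_snd, Function.comp_apply]
  rcases eq_or_ne p.1 p.2 with h | h
  · simp [h, mul_comm]
  · rw [rescaleMap_sub, kernel_inv_smul hK hr (sub_ne_zero.2 h), smul_comm _ (r ^ s), smul_smul,
      ← Real.rpow_add hr, neg_add_cancel, Real.rpow_zero, one_smul]

theorem IsLip0.comp_rescaleMap (hf : IsLip0 f) (hr : 0 < r) : IsLip0 (f ∘ rescaleMap a r) := by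
  obtain ⟨⟨D, hD⟩, hf2⟩ := hf
  constructor
  · refine ⟨D * ‖r⁻¹‖₊, hD.comp (LipschitzWith.of_dist_le_mul fun x y => ?_)⟩
    rw [dist_eq_norm, rescaleMap_sub, norm_smul, dist_eq_norm, coe_nnnorm]
  · exact hf2.comp_homeomorph ((Homeomorph.subRight a).trans
      (Homeomorph.smulOfNeZero r⁻¹ (inv_ne_zero hr.ne')))

theorem IsCut.comp_rescaleMap {R : ℝ} (hg : IsCut R g) (hr : 0 < r) :
    IsCut (r * R - ‖a‖) (g ∘ rescaleMap a r) := by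
  refine ⟨hg.isLip0.comp_rescaleMap hr, fun x => hg.norm_le _, fun x hx => hg.eq_one _ ?_⟩
  rw [rescaleMap, norm_smul, norm_inv, Real.norm_of_nonneg hr.le, inv_mul_le_iff₀ hr]
  have := norm_sub_le x a
  linarith

theorem isCut_cutoff_comp (hr : 0 < r) (a : RSpace d) :
    ∀ᶠ R in atTop, IsCut (R - ‖a‖) (cutoff (R / r) ∘ rescaleMap a r) := by
  filter_upwards [eventually_gt_atTop 0] with R hR
  have := (isCut_cutoff (d := d) (by positivity : 0 < R / r)).comp_rescaleMap (a := a) hr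
  rwa [mul_div_cancel₀ _ hr.ne'] at this

theorem mainPart_rescale (hK : KernelBounds s C K) (hμ : IsNice s Λ μ) (hr : 0 < r)
    (x : RSpace d) :
    mainPart K (rescale s a r μ) φ g x =
      mainPart K μ (fun y => ((r ^ (-s) : ℝ) : ℂ) * φ (rescaleMap a r y)) (g ∘ rescaleMap a r)
        (a + r • x) := by
  have := hμ.isLocallyFinite
  rw [mainPart, mainPart, pairing_rescale hK hr, integral_rescale hr]
  congr 1
  · rw [← integral_smul]
    refine integral_congr_ae ?_
    have h0 : ∀ᵐ y ∂μ, y ≠ a + r • x := by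
      rw [ae_iff]; simpa using hμ.measure_singleton hK.s_pos _
    filter_upwards [h0] with y hy
    rw [rescaleMap_sub_right hr, kernel_inv_smul hK hr (sub_ne_zero.2 hy), smul_comm _ (r ^ s),
      smul_smul, ← Real.rpow_add hr, neg_add_cancel, Real.rpow_zero, one_smul]
    rfl
  · have := pairing_const_mul_left (K := K) (μ := μ) (f := φ ∘ rescaleMap a r)
      (g := g ∘ rescaleMap a r) ((r ^ (-s) : ℝ) : ℂ)
    simp only [Function.comp_apply] at this
    rw [this, Complex.coe_smul]

/-- The truncated potential of `μ` at `x`. -/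
noncomputable def potential (s : ℝ) (μ : Measure (RSpace d)) (x : RSpace d) (T : ℝ) : ENNReal :=
  ∫⁻ y in ball x T, ‖y - x‖ₑ ^ (-s) ∂μ

theorem HasPotential.potential_lt_top [IsLocallyFiniteMeasure μ] (hs : 0 < s) {x : RSpace d}
    (hx : HasPotential s μ x) (T : ℝ) : potential s μ x T < ⊤ := by
  have h1 : ball x T ⊆ ball x 1 ∪ (ball x T \ ball x 1) := by
    rw [union_sdiff_self]; exact subset_union_right
  refine (lintegral_mono_set h1).trans_lt ((lintegral_union_le _ _ _).trans_lt
    (ENNReal.add_lt_top.2 ⟨hx, ?_⟩))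
  refine (lt_of_le_of_lt (setLIntegral_mono measurable_const (g := fun _ => 1) fun y hy => ?_)
    (?_ : ∫⁻ y in ball x T \ ball x 1, (1 : ENNReal) ∂μ < ⊤))
  · have h2 : 1 ≤ ‖y - x‖ := by simpa [dist_eq_norm] using hy.2
    rw [← ofReal_norm, ENNReal.ofReal_rpow_of_pos (by linarith), ← ENNReal.ofReal_one]
    exact ENNReal.ofReal_le_ofReal (Real.rpow_le_one_of_one_le_of_nonpos h2 (by linarith))
  · rw [setLIntegral_one]
    exact (measure_mono sdiff_subset).trans_lt measure_ball_lt_top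

theorem potential_rescale (hr : 0 < r) (x : RSpace d) (T : ℝ) :
    potential s (rescale s a r μ) x T = potential s μ (a + r • x) (r * T) := by
  rw [potential, potential, rescale, Measure.restrict_smul, lintegral_smul_measure,
    Measure.restrict_map measurable_rescaleMap measurableSet_ball,
    lintegral_map (by fun_prop) measurable_rescaleMap, rescaleMap_preimage_ball hr, smul_eq_mul,
    ← lintegral_const_mul _ (by unfold rescaleMap; fun_prop)]
  refine lintegral_congr fun y => ?_
  have hr' : ENNReal.ofReal r ≠ 0 := by simpa using hr
  rw [rescaleMap_sub_right hr, enorm_smul, ENNReal.mul_rpow_of_ne_top enorm_ne_top enorm_ne_top,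
    ← mul_assoc, ← ofReal_norm r⁻¹, norm_inv, Real.norm_of_nonneg hr.le,
    ENNReal.ofReal_rpow_of_pos (inv_pos.2 hr), ← ENNReal.ofReal_mul (by positivity),
    Real.inv_rpow hr.le, mul_inv_cancel₀ (by positivity), ENNReal.ofReal_one, one_mul]

theorem HasPotential.rescale (hμ : IsNice s Λ μ) (hs : 0 < s) (hr : 0 < r) {x : RSpace d}
    (hx : HasPotential s μ (a + r • x)) : HasPotential s (rescale s a r μ) x := by
  have := hμ.isLocallyFinite
  have h := potential_rescale (s := s) (a := a) (μ := μ) hr x 1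
  have h2 := hx.potential_lt_top hs (r * 1)
  rw [← h] at h2
  exact h2

theorem integral_rescale_density (hr : 0 < r) :
    ∫ y, φ y ∂(rescale s a r μ) =
      ∫ y, ((r ^ (-s) : ℝ) : ℂ) * φ (rescaleMap a r y) ∂μ := by
  rw [integral_rescale hr, integral_const_mul, Complex.real_smul]

theorem Tbar_rescale (hK : KernelBounds s C K) (hΛ : 0 < Λ) (hμ : IsNice s Λ μ) (hr : 0 < r)
    {x : RSpace d} (hpot : HasPotential s μ (a + r • x)) (hφ : IsLip0 φ)
    (hφ1 : ∫ y, φ y ∂(rescale s a r μ) = 1) :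
    Tbar K (rescale s a r μ) φ x =
      Tbar K μ (fun y => ((r ^ (-s) : ℝ) : ℂ) * φ (rescaleMap a r y)) (a + r • x) := by
  have l1 := tendsto_mainPart_cutoff hK hΛ (hμ.rescale hr) (hpot.rescale hμ hK.s_pos hr) hφ hφ1
    cutoff 0 isCut_cutoff_sub_zero
  have l2 := tendsto_mainPart_cutoff hK hΛ hμ hpot
    (φ := fun y => ((r ^ (-s) : ℝ) : ℂ) * φ (rescaleMap a r y))
    ((hφ.comp_rescaleMap hr).const_mul _) (by rw [← integral_rescale_density hr, hφ1])
    (fun R => cutoff (R / r) ∘ rescaleMap a r) ‖a‖ (isCut_cutoff_comp hr a)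
  -- Along the radii `r * R` the transported cut-off is exactly `cutoff R` composed with the
  -- rescaling, so the two truncations coincide term by term.
  have l3 : Tendsto (fun R : ℝ => r * R) atTop atTop := tendsto_id.const_mul_atTop hr
  refine tendsto_nhds_unique l1 ((l2.comp l3).congr fun R => ?_)
  rw [mainPart_rescale hK hμ hr, Function.comp_apply, mul_div_cancel_left₀ _ hr.ne']

theorem PairDecay.isReflectionless_rescale {α T : ℝ} (hα : 0 < α) (hK : KernelBounds s C K)
    (hΛ : 0 < Λ) (hμ : IsNice s Λ μ) (hd : PairDecay s T K μ) (hr : 0 < r) :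
    IsReflectionless s α K (rescale s a r μ) := by
  have := hμ.isLocallyFinite
  refine isReflectionless_of_tendsto hα hK hΛ (hμ.rescale hr) fun f hf hf0 => ?_
  have h0 : ∫ y, (f ∘ rescaleMap a r) y ∂μ = 0 := by
    rw [integral_rescale hr, smul_eq_zero] at hf0
    exact hf0.resolve_left (Real.rpow_pos_of_pos hr _).ne'
  have l2 := hd.tendsto (hf.comp_rescaleMap hr) h0
    (fun R => cutoff (R / r) ∘ rescaleMap a r) ‖a‖ (isCut_cutoff_comp hr a)
  have l3 : Tendsto (fun R : ℝ => r * R) atTop atTop := tendsto_id.const_mul_atTop hr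
  have l4 := (l2.comp l3).const_smul (r ^ (-s))
  rw [smul_zero] at l4
  refine l4.congr fun R => ?_
  rw [Function.comp_apply, mul_div_cancel_left₀ _ hr.ne', pairing_rescale hK hr]

end Rescale

/-! ### Distance to the support in terms of balls -/

section Support

variable {d : ℕ} {μ : Measure (RSpace d)}

theorem infDist_support_le {x : RSpace d} {t : ℝ} (h : 0 < μ (ball x t)) :
    infDist x μ.support < t := by
  obtain ⟨y, hy, hy'⟩ := Measure.nonempty_inter_support_of_pos h
  exact (infDist_le_dist_of_mem hy').trans_lt (by rwa [dist_comm])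

theorem measure_ball_pos_of_infDist_lt (hμ : μ ≠ 0) {x : RSpace d} {t : ℝ}
    (h : infDist x μ.support < t) : 0 < μ (ball x t) := by
  obtain ⟨y, hy, hyt⟩ := (infDist_lt_iff (Measure.nonempty_support hμ)).1 h
  exact (Measure.mem_support_iff_forall y).1 hy _ (isOpen_ball.mem_nhds (by rwa [mem_ball, dist_comm]))

theorem measure_ball_infDist (x : RSpace d) : μ (ball x (infDist x μ.support)) = 0 := by
  refine measure_mono_null (t := μ.supportᶜ) (fun y hy hy' => ?_) Measure.measure_compl_support
  have := infDist_le_dist_of_mem (x := x) hy'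
  rw [mem_ball, dist_comm] at hy
  linarith

theorem le_infDist_of_ball_null (hμ : μ ≠ 0) {x : RSpace d} {t : ℝ} (h : μ (ball x t) = 0) :
    t ≤ infDist x μ.support := by
  by_contra! hlt
  exact (measure_ball_pos_of_infDist_lt hμ hlt).ne' h

end Support

/-! ### Points and scales of doubling -/

section MainEstimate

variable {d d' : ℕ} {s C Λ : ℝ} {K : RSpace d → CSpace d'} {μ : Measure (RSpace d)}
  {f g h φ : RSpace d → ℂ}

/-- By Besicovitch differentiation, the ratio of the volume of a small ball to its μ-mass converges
μ-almost everywhere to a Radon–Nikodym derivative that is finite there. So the mass is at least a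
constant times t^d. -/
theorem ae_lower_growth [IsLocallyFiniteMeasure μ] : ∀ᵐ z ∂μ, ∃ c > 0, ∃ r₀ > 0,
    ∀ t, 0 < t → t < r₀ → c * t ^ d ≤ μ.real (closedBall z t) := by
  filter_upwards [Besicovitch.ae_tendsto_rnDeriv (volume : Measure (RSpace d)) μ,
    Measure.rnDeriv_lt_top (volume : Measure (RSpace d)) μ] with z hz hlt
  obtain ⟨L, hL1, hL2⟩ := exists_between hlt
  have h1 := (hz.eventually_lt_const hL1)
  rw [eventually_nhdsWithin_iff, Metric.eventually_nhds_iff] at h1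
  obtain ⟨r₀, hr₀, h2⟩ := h1
  have hv0 : (volume (ball (0 : RSpace d) 1)) ≠ 0 := (measure_ball_pos _ _ one_pos).ne'
  have hvt : (volume (ball (0 : RSpace d) 1)) ≠ ⊤ := measure_ball_lt_top.ne
  have hvpos := ENNReal.toReal_pos hv0 hvt
  have hL0 : 0 < L.toReal := ENNReal.toReal_pos (pos_of_gt hL1).ne' hL2.ne
  refine ⟨(volume (ball (0 : RSpace d) 1)).toReal / L.toReal, by positivity, r₀, hr₀,
    fun t ht htr => ?_⟩
  have h3 := h2 (y := t) (by rw [Real.dist_eq, sub_zero, abs_of_pos ht]; exact htr) ht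
  have hμt : μ (closedBall z t) ≠ ⊤ := measure_closedBall_lt_top.ne
  have hμ0 : μ (closedBall z t) ≠ 0 := by
    intro h0
    rw [h0, ENNReal.div_zero (measure_closedBall_pos _ _ ht).ne'] at h3
    exact (not_top_lt h3)
  rw [ENNReal.div_lt_iff (Or.inl hμ0) (Or.inl hμt),
    Measure.addHaar_closedBall _ _ ht.le, finrank_euclideanSpace_fin] at h3
  have h4 := ENNReal.toReal_mono (ENNReal.mul_ne_top hL2.ne hμt) h3.le
  rw [ENNReal.toReal_mul, ENNReal.toReal_mul, ENNReal.toReal_ofReal (by positivity)] at h4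
  rw [div_mul_eq_mul_div, div_le_iff₀ hL0, Measure.real]
  linarith

/-- If the sequence lost a factor larger than 2^N at every step, it would be at most 2^(-jN) a₀,
below the assumed lower bound of order 2^(-jd), since N > d. At the first index without such a loss,
all earlier losses give the stated decay. -/
theorem exists_doubling_index (a : ℕ → ℝ) {N d : ℕ} (hN : d < N) (ha0 : ∀ j, 0 ≤ a j) {c : ℝ}
    (hc : 0 < c) {j₀ : ℕ} (ha : ∀ j, j₀ ≤ j → c * ((1 / 2) ^ j) ^ d ≤ a j) :
    ∃ j, a j ≤ 2 ^ N * a (j + 1) ∧ ∀ i ≤ j, a i ≤ ((1 / 2) ^ i) ^ N * a 0 := by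
  have step : ∀ j, (∀ i < j, ¬ a i ≤ 2 ^ N * a (i + 1)) →
      a j ≤ ((1 / 2) ^ j) ^ N * a 0 := by
    intro j
    induction j with
    | zero => intro _; simp
    | succ k ih =>
      intro hk
      have h1 := ih fun i hi => hk i (hi.trans (Nat.lt_succ_self k))
      have h2 := hk k (Nat.lt_succ_self k)
      push Not at h2
      have h3 : ((1 / 2 : ℝ) ^ (k + 1)) ^ N = ((1 / 2) ^ k) ^ N * ((1 / 2) ^ N) := by
        rw [pow_succ, mul_pow]
      have h4 : (2 : ℝ) ^ N * (1 / 2) ^ N = 1 := by rw [← mul_pow]; norm_num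
      have h5 : (0 : ℝ) < (1 / 2) ^ N := by positivity
      rw [h3]
      calc a (k + 1) = (1 / 2) ^ N * (2 ^ N * a (k + 1)) := by
            rw [← mul_assoc, mul_comm ((1 / 2 : ℝ) ^ N), h4, one_mul]
        _ ≤ (1 / 2) ^ N * (((1 / 2) ^ k) ^ N * a 0) :=
            mul_le_mul_of_nonneg_left (h2.le.trans h1) h5.le
        _ = _ := by ring
  have hex : ∃ j, a j ≤ 2 ^ N * a (j + 1) := by
    by_contra! hcon
    have h1 : ∀ j, j₀ ≤ j → c ≤ (1 / 2) ^ j * a 0 := by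
      intro j hj
      have h2 := (ha j hj).trans (step j fun i _ => not_le.2 (hcon i))
      have hp : (0 : ℝ) < ((1 / 2) ^ j) ^ d := by positivity
      have h3 : ((1 / 2 : ℝ) ^ j) ^ N ≤ ((1 / 2) ^ j) ^ (d + 1) :=
        pow_le_pow_of_le_one (by positivity) (pow_le_one₀ (by norm_num) (by norm_num)) hN
      have h4 := h2.trans (mul_le_mul_of_nonneg_right h3 (ha0 0))
      rw [pow_succ] at h4
      by_contra! h5
      have := mul_lt_mul_of_pos_right h5 hp
      linarith
    have h2 : Tendsto (fun j : ℕ => (1 / 2 : ℝ) ^ j * a 0) atTop (𝓝 (0 * a 0)) :=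
      (tendsto_pow_atTop_nhds_zero_of_lt_one (by norm_num) (by norm_num)).mul_const _
    have h3 := ge_of_tendsto h2 (eventually_atTop.2 ⟨j₀, h1⟩)
    linarith
  classical
  refine ⟨Nat.find hex, Nat.find_spec hex, fun i hi => step i fun k hk => ?_⟩
  exact Nat.find_min hex (hk.trans_le hi)

/-- The previous lemma is applied with N = d + 1 to dyadic balls about a typical point. Doubling at
δ controls the Lipschitz constant of a normalised bump, while the exponent d + 1 > s above δ makes
the part of the potential away from the bump small with the mass. -/
theorem exists_doubling_scale [IsLocallyFiniteMeasure μ] (h : 0 < μ (ball 0 2)) :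
    ∃ z₀ ∈ ball (0 : RSpace d) 2, ∃ δ : ℝ, 0 < δ ∧ δ ≤ 1 ∧ 0 < μ.real (ball z₀ (δ / 2)) ∧
      μ.real (ball z₀ δ) ≤ 2 ^ (d + 1) * μ.real (ball z₀ (δ / 2)) ∧
      ∀ t, δ ≤ t → t ≤ 1 → μ.real (ball z₀ t) ≤ (2 * t) ^ (d + 1) * μ.real (ball 0 3) := by
  have hex : ∃ z ∈ ball (0 : RSpace d) 2, ∃ c > 0, ∃ r₀ > 0,
      ∀ t, 0 < t → t < r₀ → c * t ^ d ≤ μ.real (closedBall z t) := by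
    by_contra! hcon
    refine h.ne' (measure_mono_null ?_ (ae_iff.1 (ae_lower_growth (μ := μ))))
    intro z hz
    simp only [mem_ofPred_eq]
    push Not
    exact hcon z hz
  obtain ⟨z, hz, c, hc, r₀, hr₀, hlow⟩ := hex
  obtain ⟨j₀, hj₀⟩ := exists_pow_lt_of_lt_one hr₀ (by norm_num : (1 / 2 : ℝ) < 1)
  have hlow' : ∀ j, j₀ ≤ j → (c * (1 / 2) ^ d) * ((1 / 2) ^ j) ^ d ≤
      μ.real (ball z ((1 / 2) ^ j)) := by
    intro j hj
    have h1 : (1 / 2 : ℝ) ^ j ≤ (1 / 2) ^ j₀ :=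
      pow_le_pow_of_le_one (by norm_num) (by norm_num) hj
    have hp : (0 : ℝ) < (1 / 2) ^ j := by positivity
    have h2 := hlow ((1 / 2) * (1 / 2) ^ j) (by positivity) (by linarith)
    rw [mul_pow, ← mul_assoc] at h2
    refine h2.trans (measureReal_mono (closedBall_subset_ball (by linarith))
      measure_ball_lt_top.ne)
  obtain ⟨j, hj1, hj2⟩ := exists_doubling_index (fun j => μ.real (ball z ((1 / 2) ^ j)))
    (Nat.lt_succ_self d) (fun j => measureReal_nonneg) (by positivity) hlow'
  have hpos : 0 < μ.real (ball z ((1 / 2) ^ (j + 1))) := by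
    have hp : (0 : ℝ) < (1 / 2) ^ (j + 1) := by positivity
    set t := min ((1 / 2 : ℝ) ^ (j + 1) / 2) (r₀ / 2) with ht
    have ht0 : 0 < t := by positivity
    have h2 := hlow t ht0 ((min_le_right _ _).trans_lt (by linarith))
    have h3 : 0 < c * t ^ d := by positivity
    refine h3.trans_le (h2.trans (measureReal_mono (closedBall_subset_ball
      ((min_le_left _ _).trans_lt (by linarith))) measure_ball_lt_top.ne))
  have e1 : (1 / 2 : ℝ) ^ (j + 1) = (1 / 2) ^ j / 2 := by rw [pow_succ]; ring
  rw [e1] at hpos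
  simp only [e1] at hj1
  refine ⟨z, hz, (1 / 2) ^ j, by positivity, pow_le_one₀ (by norm_num) (by norm_num), hpos, hj1,
    fun t ht1 ht2 => ?_⟩
  have ht0 : 0 < t := lt_of_lt_of_le (by positivity) ht1
  obtain ⟨n, hn1, hn2⟩ := exists_nat_pow_near_of_lt_one ht0 ht2 (by norm_num : (0 : ℝ) < 1 / 2)
    (by norm_num)
  have hball : ball z ((1 / 2) ^ 0) ⊆ ball 0 3 := by
    refine ball_subset_ball' ?_
    rw [mem_ball] at hz
    linarith
  have hη : μ.real (ball z ((1 / 2) ^ 0)) ≤ μ.real (ball 0 3) :=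
    measureReal_mono hball measure_ball_lt_top.ne
  have key : ∀ i ≤ j, t ≤ (1 / 2 : ℝ) ^ i → (1 / 2 : ℝ) ^ i ≤ 2 * t →
      μ.real (ball z t) ≤ (2 * t) ^ (d + 1) * μ.real (ball 0 3) := by
    intro i hi h1 h2
    calc μ.real (ball z t) ≤ μ.real (ball z ((1 / 2) ^ i)) :=
          measureReal_mono (ball_subset_ball h1) measure_ball_lt_top.ne
      _ ≤ ((1 / 2) ^ i) ^ (d + 1) * μ.real (ball z ((1 / 2) ^ 0)) := hj2 i hi
      _ ≤ _ := by gcongr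
  rw [pow_succ] at hn1
  rcases le_or_gt n j with h | h
  · exact key n h hn2 (by linarith)
  -- In this case t ≤ 2^(-n) ≤ 2^(-j) ≤ t, so t is the doubling scale itself.
  · have h3 : (1 / 2 : ℝ) ^ n ≤ (1 / 2) ^ j :=
      pow_le_pow_of_le_one (by norm_num) (by norm_num) h.le
    exact key j le_rfl (by linarith) (by linarith)

end MainEstimate

/-! ### A small potential forces a small value of T̄(1) -/

section BumpEstimate

variable {d d' : ℕ} {s C Λ : ℝ} {K : RSpace d → CSpace d'} {μ : Measure (RSpace d)}
  {f g h φ : RSpace d → ℂ}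

/-- The constant in the estimate of the non-singular part of the pairing with a bump. -/
noncomputable def farConst (d : ℕ) (s τ R : ℝ) : ℝ :=
  growthConst s (d + 1) * (4 / τ) ^ ((d : ℝ) + 1) * (3 * R) ^ ((d : ℝ) + 1 - s)

/-- Once the ball of radius τδ about y is removed, the measure has growth exponent d + 1 about y at
all scales up to 3R: a ball of radius t > τδ lies in the ball of radius 2t/τ about z₀, at a cost of
(4/τ)^(d+1). As s < d + 1, the potential is a multiple of the total mass. -/
theorem lintegral_far_le [IsLocallyFiniteMeasure μ] (hs0 : 0 < s) (hsd : s < d) {z₀ : RSpace d}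
    (hz₀ : z₀ ∈ ball (0 : RSpace d) 2) {δ τ R : ℝ} (hδ0 : 0 < δ) (hδ1 : δ ≤ 1) (hτ0 : 0 < τ)
    (hτ1 : τ ≤ 1) (hR : 6 ≤ R)
    (hgrowth : ∀ t, δ ≤ t → t ≤ 1 → μ.real (ball z₀ t) ≤ (2 * t) ^ (d + 1) * μ.real (ball 0 3))
    {y : RSpace d} (hy : y ∈ ball z₀ δ) :
    ∫⁻ x in ball 0 (2 * R) \ ball y (τ * δ), ‖x - y‖ₑ ^ (-s) ∂μ ≤
      ENNReal.ofReal (farConst d s τ R * μ.real (ball 0 (2 * R))) := by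
  set η := μ.real (ball (0 : RSpace d) (2 * R)) with hη
  have hη0 : 0 ≤ η := measureReal_nonneg
  set S := ball (0 : RSpace d) (2 * R) \ ball y (τ * δ) with hS
  have hSm : MeasurableSet S := measurableSet_ball.diff measurableSet_ball
  have hy2 : ‖y‖ < 3 := by
    rw [mem_ball_zero_iff] at hz₀
    rw [mem_ball, dist_eq_norm] at hy
    have := norm_sub_norm_le y z₀
    linarith
  have hSsub : S ⊆ ball y (3 * R) := by
    intro x hx
    have h1 := mem_ball_zero_iff.1 hx.1
    rw [mem_ball, dist_eq_norm]
    have := norm_sub_le x y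
    linarith
  have key : ∀ t, 0 < t → t ≤ 3 * R → (μ.restrict S) (ball y t) ≤
      ENNReal.ofReal (((4 / τ) ^ ((d : ℝ) + 1) * η) * t ^ ((d : ℝ) + 1)) := by
    intro t ht _
    rcases le_or_gt t (τ * δ) with h | h
    · have : ball y t ∩ S = ∅ := by
        ext x
        simp only [mem_inter_iff, mem_empty_iff_false, iff_false, not_and]
        intro h1 h2
        exact h2.2 (ball_subset_ball h h1)
      rw [Measure.restrict_apply measurableSet_ball, this, measure_empty]
      exact zero_le
    · have e1 : ((4 / τ) ^ ((d : ℝ) + 1) * η) * t ^ ((d : ℝ) + 1) =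
          (2 * (2 * t / τ)) ^ (d + 1) * η := by
        have h4 : 2 * (2 * t / τ) = 4 / τ * t := by ring
        rw [h4, mul_pow, ← Real.rpow_natCast, ← Real.rpow_natCast]
        push_cast
        ring
      rw [e1]
      have h1 : δ ≤ t / τ := by rw [le_div_iff₀ hτ0]; linarith
      have h2 : t ≤ t / τ := by rw [le_div_iff₀ hτ0]; nlinarith
      have h3 : 2 * t / τ = t / τ + t / τ := by ring
      have hsub : ball y t ⊆ ball z₀ (2 * t / τ) := by
        refine ball_subset_ball' ?_
        rw [mem_ball] at hy
        linarith
      -- Growth about z₀ is known only up to scale 1. Beyond it the total mass suffices, since the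
      -- factor in front of `η` is then at least 1.
      rcases le_or_gt (2 * t / τ) 1 with hu | hu
      · calc (μ.restrict S) (ball y t) ≤ μ (ball y t) := Measure.restrict_apply_le _ _
          _ ≤ μ (ball z₀ (2 * t / τ)) := measure_mono hsub
          _ = ENNReal.ofReal (μ.real (ball z₀ (2 * t / τ))) :=
            (ofReal_measureReal measure_ball_lt_top.ne).symm
          _ ≤ _ := by
            refine ENNReal.ofReal_le_ofReal ((hgrowth _ (by linarith) hu).trans ?_)
            refine mul_le_mul_of_nonneg_left ?_ (by positivity)
            exact measureReal_mono (ball_subset_ball (by linarith)) measure_ball_lt_top.ne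
      · calc (μ.restrict S) (ball y t) ≤ (μ.restrict S) univ := measure_mono (subset_univ _)
          _ = μ S := by rw [Measure.restrict_apply_univ]
          _ ≤ μ (ball 0 (2 * R)) := measure_mono sdiff_subset
          _ = ENNReal.ofReal η := (ofReal_measureReal measure_ball_lt_top.ne).symm
          _ ≤ _ := by
            refine ENNReal.ofReal_le_ofReal (le_mul_of_one_le_left hη0 ?_)
            exact one_le_pow₀ (by linarith)
  have h1 := lintegral_ball_rpow_le (p := s) (q := (d : ℝ) + 1) (T := 3 * R) (by linarith)
    (by linarith) (by positivity) (by linarith) (μ.restrict S) y key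
  rw [Measure.restrict_restrict measurableSet_ball, inter_eq_right.2 hSsub] at h1
  refine h1.trans (ENNReal.ofReal_le_ofReal (le_of_eq ?_))
  rw [farConst]; ring

theorem cutoff_norm_le (R : ℝ) (x : RSpace d) : ‖cutoff R x‖ ≤ 1 := by
  rw [cutoff, Complex.norm_real, Real.norm_eq_abs, abs_of_nonneg (le_max_left _ _)]
  exact max_le zero_le_one (min_le_left _ _)

/-- Near the diagonal the cut-off is 1, so the integrand reduces to (f(y) - f(x)) K(x - y)/2 and the
Lipschitz bound gives a term of order τ. Away from the diagonal each of the two terms is bounded by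
the far potential, integrated against the L¹-normalised bump. -/
theorem lintegral_pairInt_bump_le (hK : KernelBounds s C K) (hΛ : 0 < Λ) (hμ : IsNice s Λ μ)
    (hsd : s < d) {z₀ : RSpace d}
    (hz₀ : z₀ ∈ ball (0 : RSpace d) 2) {δ τ R l D : ℝ} (hδ0 : 0 < δ) (hδ1 : δ ≤ 1) (hτ0 : 0 < τ)
    (hτ1 : τ ≤ 1 / 4) (hR : 6 ≤ R)
    (hgrowth : ∀ t, δ ≤ t → t ≤ 1 → μ.real (ball z₀ t) ≤ (2 * t) ^ (d + 1) * μ.real (ball 0 3))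
    (hf : IsLip0 f) (hf0 : ∀ y, 3 / 4 * δ ≤ ‖y - z₀‖ → f y = 0) (hl : 0 ≤ l)
    (hfl : ∀ x y, ‖f x - f y‖ ≤ l * ‖x - y‖) (hf1 : ∫⁻ y, ‖f y‖ₑ ∂μ ≤ 1)
    (hD : l * δ * μ.real (ball z₀ δ) ≤ D) :
    ∫⁻ p, ‖pairInt K f (cutoff R) p‖ₑ ∂(μ.prod μ) ≤
      ENNReal.ofReal (growthConst (s - 1) s * Λ * D * τ) +
        ENNReal.ofReal (2 * farConst d s τ R * μ.real (ball 0 (2 * R))) := by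
  have := hμ.isLocallyFinite
  have hs := hK.s_pos
  have hgc := growthConst_pos (p := s - 1) (q := s) (by linarith)
  set A := {P : RSpace d × RSpace d | P.2 ∈ ball z₀ δ ∧ P.1 ∈ ball P.2 (τ * δ)} with hA
  have hAm : MeasurableSet A := measurableSet_near_diagonal z₀ δ (τ * δ)
  rw [← lintegral_add_compl _ hAm]
  have hz : ‖z₀‖ < 2 := mem_ball_zero_iff.1 hz₀
  refine add_le_add ?_ ?_
  · have h1 := lintegral_near_diagonal_le (μ := μ) (z₀ := z₀) (ρ := δ) fun z =>
      hμ.lintegral_ball_le hs hΛ (p := s - 1) (T := τ * δ) (by linarith) (by positivity) z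
    rw [sub_sub_cancel, Real.rpow_one] at h1
    calc _ ≤ ∫⁻ p in A, ENNReal.ofReal l * ‖p.1 - p.2‖ₑ ^ (-(s - 1)) ∂(μ.prod μ) := by
          refine setLIntegral_mono' hAm fun p hp => hK.enorm_pairInt_le p ?_
          obtain ⟨hp1, hp2⟩ := hp
          rw [mem_ball, dist_eq_norm] at hp1 hp2
          have h3 : τ * δ ≤ 1 := by nlinarith
          have h4 := norm_sub_norm_le p.2 z₀
          have h5 := norm_sub_norm_le p.1 p.2
          rw [cutoff_eq_one (by linarith) (by linarith), cutoff_eq_one (by linarith) (by linarith),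
            mul_one, one_mul, norm_mul, norm_div, norm_one, Complex.norm_ofNat, norm_sub_rev]
          have := hfl p.1 p.2
          have := norm_nonneg (f p.1 - f p.2)
          linarith
      _ = ENNReal.ofReal l * ∫⁻ p in A, ‖p.1 - p.2‖ₑ ^ (-(s - 1)) ∂(μ.prod μ) :=
          lintegral_const_mul _ (by fun_prop)
      _ ≤ ENNReal.ofReal l * (ENNReal.ofReal (growthConst (s - 1) s * Λ * (τ * δ)) *
            μ (ball z₀ δ)) := mul_le_mul_right h1 _
      _ = ENNReal.ofReal (l * (growthConst (s - 1) s * Λ * (τ * δ) * μ.real (ball z₀ δ))) := by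
          rw [ENNReal.ofReal_mul hl,
            ENNReal.ofReal_mul (p := growthConst (s - 1) s * Λ * (τ * δ)) (by positivity),
            ofReal_measureReal measure_ball_lt_top.ne]
      _ ≤ _ := by
          refine ENNReal.ofReal_le_ofReal ?_
          calc _ = growthConst (s - 1) s * Λ * τ * (l * δ * μ.real (ball z₀ δ)) := by ring
            _ ≤ growthConst (s - 1) s * Λ * τ * D :=
              mul_le_mul_of_nonneg_left hD (by positivity)
            _ = _ := by ring
  · set U := {P : RSpace d × RSpace d | P.1 ∈ ball 0 (2 * R) ∧ P.1 ∉ ball P.2 (τ * δ)} with hU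
    have hUm : MeasurableSet U := by
      have h1 : IsOpen {P : RSpace d × RSpace d | P.1 ∈ ball 0 (2 * R)} :=
        isOpen_ball.preimage continuous_fst
      have h2 : IsClosed {P : RSpace d × RSpace d | P.1 ∉ ball P.2 (τ * δ)} := by
        simp only [mem_ball, not_lt]
        exact isClosed_le continuous_const (by fun_prop)
      exact h1.measurableSet.inter h2.measurableSet
    set F : RSpace d × RSpace d → ENNReal :=
      U.indicator fun p => ‖f p.2‖ₑ * ‖p.1 - p.2‖ₑ ^ (-s) with hF
    have hFm : Measurable F := by
      have := hf.continuous.measurable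
      exact Measurable.indicator (by fun_prop) hUm
    have hpt : ∀ p ∈ Aᶜ, ‖pairInt K f (cutoff R) p‖ₑ ≤ F p + F p.swap := by
      intro p hp
      by_cases hclose : p.1 ∈ ball p.2 (τ * δ)
      -- Since τ ≤ 1/4, a point within τδ of one outside the δ-ball is still at distance at least
      -- 3δ/4 from z₀, where the bump vanishes.
      · have hp2 : p.2 ∉ ball z₀ δ := fun h => hp ⟨h, hclose⟩
        rw [mem_ball, dist_eq_norm] at hp2 hclose
        have h1 : f p.2 = 0 := hf0 _ (by linarith)
        have h2 : f p.1 = 0 := by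
          refine hf0 _ ?_
          have h3 : ‖p.2 - z₀‖ ≤ ‖p.1 - p.2‖ + ‖p.1 - z₀‖ := by
            rw [norm_sub_rev p.1 p.2]
            have := norm_add_le (p.2 - p.1) (p.1 - z₀)
            rwa [sub_add_sub_cancel] at this
          nlinarith
        simp [pairInt, h1, h2]
      · have hterm : ∀ a b : RSpace d, a ∉ ball b (τ * δ) →
            ‖f b * cutoff R a‖ₑ * ‖a - b‖ₑ ^ (-s) ≤ F (a, b) := by
          intro a b hab
          by_cases ha : a ∈ ball (0 : RSpace d) (2 * R)
          · rw [hF, indicator_of_mem (show (a, b) ∈ U from ⟨ha, hab⟩), enorm_mul]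
            refine mul_le_mul_left (mul_le_of_le_one_right' ?_) _
            rw [← ofReal_norm, ← ENNReal.ofReal_one]
            exact ENNReal.ofReal_le_ofReal (cutoff_norm_le R a)
          · rw [mem_ball_zero_iff, not_lt] at ha
            rw [cutoff_eq_zero (by linarith) (by linarith)]
            simp
        have hsym : p.2 ∉ ball p.1 (τ * δ) := by rwa [mem_ball_comm]
        have h1 := hterm p.1 p.2 hclose
        have h2 := hterm p.2 p.1 hsym
        rw [← enorm_neg (p.2 - p.1), neg_sub] at h2
        refine le_trans ?_ (add_le_add h1 h2)
        rw [pairInt, enorm_smul, ← add_mul]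
        refine mul_le_mul' ?_ (hK.size _)
        rw [enorm_mul]
        have h3 : ‖(1 / 2 : ℂ)‖ₑ ≤ 1 := by
          rw [← ofReal_norm, ← ENNReal.ofReal_one]
          exact ENNReal.ofReal_le_ofReal (by norm_num)
        refine (mul_le_of_le_one_left' h3).trans ((enorm_sub_le).trans (le_of_eq ?_))
        rw [mul_comm (cutoff R p.2)]
    have hFint : ∫⁻ p, F p ∂(μ.prod μ) ≤
        ENNReal.ofReal (farConst d s τ R * μ.real (ball 0 (2 * R))) := by
      rw [lintegral_prod_symm _ hFm.aemeasurable]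
      calc ∫⁻ y, ∫⁻ x, F (x, y) ∂μ ∂μ
          ≤ ∫⁻ y, ‖f y‖ₑ * ENNReal.ofReal (farConst d s τ R * μ.real (ball 0 (2 * R))) ∂μ := by
            refine lintegral_mono fun y => ?_
            by_cases hy : 3 / 4 * δ ≤ ‖y - z₀‖
            · have : ∀ x, F (x, y) = 0 := by
                intro x
                rw [hF, indicator_apply_eq_zero]
                intro _
                simp [hf0 y hy]
              simp [this]
            · have hy' : y ∈ ball z₀ δ := by
                rw [mem_ball, dist_eq_norm]; linarith
              have e1 : ∀ x, F (x, y) = (ball 0 (2 * R) \ ball y (τ * δ)).indicator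
                  (fun x => ‖f y‖ₑ * ‖x - y‖ₑ ^ (-s)) x := by
                intro x
                simp only [hF, indicator]
                rfl
              simp_rw [e1]
              rw [lintegral_indicator (measurableSet_ball.diff measurableSet_ball),
                lintegral_const_mul _ (by fun_prop)]
              exact mul_le_mul_right (lintegral_far_le hs hsd hz₀ hδ0 hδ1 hτ0 (by linarith) hR
                hgrowth hy') _
        _ = (∫⁻ y, ‖f y‖ₑ ∂μ) * ENNReal.ofReal (farConst d s τ R * μ.real (ball 0 (2 * R))) :=
            lintegral_mul_const _ hf.continuous.measurable.enorm
        _ ≤ _ := mul_le_of_le_one_left' hf1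
    calc ∫⁻ p in Aᶜ, ‖pairInt K f (cutoff R) p‖ₑ ∂(μ.prod μ)
        ≤ ∫⁻ p in Aᶜ, (F p + F p.swap) ∂(μ.prod μ) := setLIntegral_mono' hAm.compl hpt
      _ ≤ ∫⁻ p, (F p + F p.swap) ∂(μ.prod μ) := lintegral_mono' Measure.restrict_le_self le_rfl
      _ = ∫⁻ p, F p ∂(μ.prod μ) + ∫⁻ p, F p ∂(μ.prod μ) := by
          rw [lintegral_add_left hFm, lintegral_prod_swap]
      _ ≤ ENNReal.ofReal (farConst d s τ R * μ.real (ball 0 (2 * R))) +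
          ENNReal.ofReal (farConst d s τ R * μ.real (ball 0 (2 * R))) := add_le_add hFint hFint
      _ = _ := by
          rw [← two_mul, mul_assoc 2, ENNReal.ofReal_mul (p := 2) (by norm_num)]
          norm_num

/-- The function `φ` is exchanged for a normalised bump at a doubling scale. The three groups of
terms bound the potential integral, the pairing and the tail; none involves δ or `φ`. -/
theorem enorm_Tbar_zero_le (hK : KernelBounds s C K) (hΛ : 0 < Λ) (hμ : IsNice s Λ μ)
    (hsd : s < d) {T : ℝ} (hd : PairDecay s T K μ) (h : 0 < μ (ball 0 2))
    (hpot : HasPotential s μ 0) (hφ : IsLip0 φ) (hφ1 : ∫ y, φ y ∂μ = 1) {τ R : ℝ} (hτ0 : 0 < τ)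
    (hτ1 : τ ≤ 1 / 4) (hR : 6 ≤ R) :
    ‖Tbar K μ φ 0‖ₑ ≤ potential s μ 0 (2 * R) +
      (ENNReal.ofReal (growthConst (s - 1) s * Λ * (4 * 2 ^ (d + 1)) * τ) +
        ENNReal.ofReal (2 * farConst d s τ R * μ.real (ball 0 (2 * R)))) +
      ENNReal.ofReal (tailConstOne s C Λ * 3 / R) := by
  have := hμ.isLocallyFinite
  obtain ⟨z₀, hz₀, δ, hδ0, hδ1, hpos, hdbl, hgrowth⟩ := exists_doubling_scale (μ := μ) h
  have hδ2 : 0 < δ / 2 := by linarith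
  set b : RSpace d → ℂ := cutoff (δ / 2) ∘ rescaleMap z₀ 1 with hb
  have hbval : ∀ y, b y = cutoff (δ / 2) (y - z₀) := by
    intro y; simp [hb, rescaleMap]
  have hbL : IsLip0 b := (isCut_cutoff hδ2).isLip0.comp_rescaleMap one_pos
  have hbnorm : ∀ y, b y = ((‖b y‖ : ℝ) : ℂ) := by
    intro y
    rw [hbval, cutoff, Complex.norm_real, Real.norm_eq_abs, abs_of_nonneg (le_max_left _ _)]
  set m : ℝ := ∫ y, ‖b y‖ ∂μ with hm
  have hbm : ∫ y, b y ∂μ = (m : ℂ) := by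
    rw [hm, ← integral_complex_ofReal]
    exact integral_congr_ae (ae_of_all _ hbnorm)
  have hm0 : μ.real (ball z₀ (δ / 2)) ≤ m := by
    rw [hm, ← integral_indicator_one measurableSet_ball]
    refine integral_mono ((integrable_indicator_iff measurableSet_ball).2
      (integrableOn_const measure_ball_lt_top.ne)) hbL.integrable.norm fun y => ?_
    by_cases hy : y ∈ ball z₀ (δ / 2)
    · rw [indicator_of_mem hy, hbval, cutoff_eq_one hδ2]
      · simp
      · rw [mem_ball, dist_eq_norm] at hy; exact hy.le
    · rw [indicator_of_notMem hy]; exact norm_nonneg _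
  have hmpos : 0 < m := hpos.trans_le hm0
  set f : RSpace d → ℂ := fun y => (m : ℂ)⁻¹ * b y with hf
  have hfL : IsLip0 f := hbL.const_mul _
  have hf1 : ∫ y, f y ∂μ = 1 := by
    rw [hf, integral_const_mul, hbm, inv_mul_cancel₀ (by exact_mod_cast hmpos.ne')]
  have hfn : ∫⁻ y, ‖f y‖ₑ ∂μ = 1 := by
    rw [← ofReal_integral_norm_eq_lintegral_enorm hfL.integrable]
    simp only [hf, norm_mul, norm_inv, Complex.norm_real, Real.norm_of_nonneg hmpos.le]
    rw [integral_const_mul, ← hm, inv_mul_cancel₀ hmpos.ne', ENNReal.ofReal_one]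
  have hf0 : ∀ y, 3 / 4 * δ ≤ ‖y - z₀‖ → f y = 0 := by
    intro y hy
    rw [hf]; dsimp only
    rw [hbval, cutoff_eq_zero hδ2 (by linarith), mul_zero]
  have hfl : ∀ x y, ‖f x - f y‖ ≤ 4 / (δ * m) * ‖x - y‖ := by
    intro x y
    simp only [hf]
    rw [← mul_sub, norm_mul, norm_inv, Complex.norm_real, Real.norm_of_nonneg hmpos.le, hbval,
      hbval]
    have h1 := norm_cutoff_sub_le hδ2 (x - z₀) (y - z₀)
    rw [sub_sub_sub_cancel_right] at h1
    calc _ ≤ m⁻¹ * (2 / (δ / 2) * ‖x - y‖) := by gcongr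
      _ = _ := by field_simp; ring
  -- The normalising mass `m` is at least the mass of the half ball, so doubling absorbs the mass of
  -- the full ball.
  have hD : 4 / (δ * m) * δ * μ.real (ball z₀ δ) ≤ 4 * 2 ^ (d + 1) := by
    have h1 : μ.real (ball z₀ δ) ≤ 2 ^ (d + 1) * m :=
      hdbl.trans (mul_le_mul_of_nonneg_left hm0 (by positivity))
    calc 4 / (δ * m) * δ * μ.real (ball z₀ δ) ≤ 4 / (δ * m) * δ * (2 ^ (d + 1) * m) := by gcongr
      _ = _ := by field_simp
  have hfρ : ∀ y, 3 < ‖y‖ → f y = 0 := by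
    intro y hy
    refine hf0 y ?_
    have := norm_sub_norm_le y z₀
    have := mem_ball_zero_iff.1 hz₀
    linarith
  have hR0 : 0 < R := by linarith
  have hcut := isCut_cutoff (d := d) hR0
  rw [Tbar_eq_Tbar hK hΛ hμ hd hpot hφ hφ1 hfL hf1,
    Tbar_eq hK hΛ hμ (ρ := 3) (R := R) (by norm_num) (by linarith) (by simp) hpot hfL hfρ hf1 hcut]
  have b1 : ‖∫ y, cutoff R y • K (y - 0) ∂μ‖ₑ ≤ potential s μ 0 (2 * R) := by
    refine (enorm_integral_le_lintegral_enorm _).trans ?_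
    rw [potential, ← lintegral_indicator measurableSet_ball]
    refine lintegral_mono fun y => ?_
    by_cases hy : y ∈ ball (0 : RSpace d) (2 * R)
    · rw [indicator_of_mem hy, enorm_smul]
      refine (mul_le_mul_right (hK.size _) _).trans (mul_le_of_le_one_left' ?_)
      rw [← ofReal_norm, ← ENNReal.ofReal_one]
      exact ENNReal.ofReal_le_ofReal (cutoff_norm_le R y)
    · rw [mem_ball_zero_iff, not_lt] at hy
      rw [cutoff_eq_zero hR0 (by linarith)]
      simp
  have b2 := (enorm_integral_le_lintegral_enorm _).trans
    (lintegral_pairInt_bump_le hK hΛ hμ hsd hz₀ hδ0 hδ1 hτ0 hτ1 hR hgrowth hfL hf0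
      (by positivity) hfl hfn.le hD)
  have b3 := (enorm_integral_le_lintegral_enorm _).trans
    (lintegral_tailInt_le_mul hK hΛ hμ (ρ := 3) (by norm_num) zero_le_one
      (by linarith : 2 * 3 ≤ R) (x := 0) (by simp) hfL.continuous.measurable hfρ hcut.norm_le
      hcut.eq_one)
  rw [hfn, mul_one, mul_one] at b3
  refine (enorm_add_le _ _).trans (add_le_add ?_ b3)
  rw [mainPart]
  exact enorm_sub_le.trans (add_le_add b1 b2)

theorem measure_ball_le_potential (hs : 0 < s) {R : ℝ} (hR : 0 < R) :
    μ (ball 0 R) ≤ ENNReal.ofReal (R ^ s) * potential s μ 0 R := by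
  rw [potential, ← lintegral_const_mul _ (by fun_prop), ← setLIntegral_one]
  refine setLIntegral_mono' measurableSet_ball fun y hy => ?_
  rw [mem_ball_zero_iff] at hy
  rw [sub_zero]
  rcases eq_or_ne y 0 with rfl | h0
  · rw [enorm_zero, ENNReal.zero_rpow_of_neg (by linarith), ENNReal.mul_top]
    · exact le_top
    · simpa using Real.rpow_pos_of_pos hR s
  · have hy0 := norm_pos_iff.2 h0
    rw [← ofReal_norm, ENNReal.ofReal_rpow_of_pos hy0, ← ENNReal.ofReal_mul (by positivity),
      ← ENNReal.ofReal_one]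
    refine ENNReal.ofReal_le_ofReal ?_
    rw [Real.rpow_neg hy0.le, ← div_eq_mul_inv, one_le_div (by positivity)]
    exact Real.rpow_le_rpow hy0.le hy.le hs.le

/-- The parameters are chosen in order: τ against the near-diagonal term, R against the tail, and
then c against the far term, whose constant depends on τ and R. The mass of the ball is itself
controlled by the potential. The choice is uniform in the measure. -/
theorem exists_small_potential (hK : KernelBounds s C K) (hΛ : 0 < Λ) (hsd : s < d) {ε : ℝ}
    (hε : 0 < ε) : ∃ R > 0, ∃ c > 0, ∀ (μ : Measure (RSpace d)) (T : ℝ) (φ : RSpace d → ℂ),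
      IsNice s Λ μ → PairDecay s T K μ → 0 < μ (ball 0 2) → HasPotential s μ 0 → IsLip0 φ →
      ∫ y, φ y ∂μ = 1 → potential s μ 0 R ≤ ENNReal.ofReal c → ‖Tbar K μ φ 0‖ ≤ ε := by
  have hs := hK.s_pos
  have h1 := growthConst_pos (p := s - 1) (q := s) (by linarith)
  have h2 := hK.tailConstOne_pos hΛ
  have h3 := growthConst_pos (p := s) (q := (d : ℝ) + 1) (by linarith)
  set a := growthConst (s - 1) s * Λ * (4 * 2 ^ (d + 1)) with ha
  have ha0 : 0 < a := by positivity
  set τ := min (1 / 4) (ε / (4 * a)) with hτ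
  have hτ0 : 0 < τ := by positivity
  set R := max 6 (4 * (tailConstOne s C Λ * 3) / ε) with hR
  have hR6 : 6 ≤ R := le_max_left _ _
  have hR0 : 0 < R := by linarith
  set b := 2 * farConst d s τ R with hb
  have hb0 : 0 < b := by rw [hb, farConst]; positivity
  refine ⟨2 * R, by positivity, min (ε / 4) (ε / (4 * b * (2 * R) ^ s)), by positivity, ?_⟩
  intro μ T φ hμ hd hpos hpot hφ hφ1 hc
  have := hμ.isLocallyFinite
  have key := enorm_Tbar_zero_le hK hΛ hμ hsd hd hpos hpot hφ hφ1 hτ0 (min_le_left _ _) hR6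
  have k1 : a * τ ≤ ε / 4 := by
    have : τ ≤ ε / (4 * a) := min_le_right _ _
    rw [le_div_iff₀ (by positivity)] at this
    linarith
  have k2 : b * μ.real (ball 0 (2 * R)) ≤ ε / 4 := by
    have h4 := (measure_ball_le_potential (μ := μ) hs (by linarith : 0 < 2 * R)).trans
      (mul_le_mul_right (hc.trans (ENNReal.ofReal_le_ofReal (min_le_right _ _))) _)
    rw [← ENNReal.ofReal_mul (by positivity)] at h4
    have h5 := ENNReal.toReal_le_of_le_ofReal (by positivity) h4
    have h6 := mul_le_mul_of_nonneg_left h5 hb0.le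
    refine h6.trans (le_of_eq ?_)
    field_simp
  have k3 : tailConstOne s C Λ * 3 / R ≤ ε / 4 := by
    have : 4 * (tailConstOne s C Λ * 3) / ε ≤ R := le_max_right _ _
    rw [div_le_iff₀ hε] at this
    rw [div_le_iff₀ hR0]
    linarith
  have k4 : ‖Tbar K μ φ 0‖ₑ ≤ ENNReal.ofReal ε := by
    refine key.trans ?_
    calc _ ≤ ENNReal.ofReal (ε / 4) + (ENNReal.ofReal (ε / 4) + ENNReal.ofReal (ε / 4)) +
          ENNReal.ofReal (ε / 4) := by
          gcongr
          exact hc.trans (ENNReal.ofReal_le_ofReal (min_le_left _ _))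
      _ = ENNReal.ofReal ε := by
          rw [← ENNReal.ofReal_add (by positivity) (by positivity),
            ← ENNReal.ofReal_add (by positivity) (by positivity),
            ← ENNReal.ofReal_add (by positivity) (by positivity)]
          congr 1; ring
  rw [← ofReal_norm] at k4
  exact (ENNReal.ofReal_le_ofReal_iff hε.le).1 k4

theorem potential_le_of_ball_null (hs : 0 < s) (h : μ (ball 0 1) = 0) (R : ℝ) :
    potential s μ 0 R ≤ μ (ball 0 R) := by
  have h1 : ∀ᵐ y ∂μ, 1 ≤ ‖y‖ := by
    rw [ae_iff]
    refine measure_mono_null (fun y hy => ?_) h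
    simpa using hy
  rw [potential, ← setLIntegral_one]
  refine lintegral_mono_ae (ae_restrict_of_ae ?_)
  filter_upwards [h1] with y hy
  rw [sub_zero, ← ofReal_norm, ENNReal.ofReal_rpow_of_pos (by linarith), ← ENNReal.ofReal_one]
  exact ENNReal.ofReal_le_ofReal (Real.rpow_le_one_of_one_le_of_nonpos hy (by linarith))

theorem hasPotential_of_ball_null [IsLocallyFiniteMeasure μ] (hs : 0 < s)
    (h : μ (ball 0 1) = 0) : HasPotential s μ 0 :=
  (potential_le_of_ball_null hs h 1).trans_lt measure_ball_lt_top

/-- Fixed values of τ and R suffice, because the potential at the centre of a null unit ball is at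
most the mass of the larger ball. This makes the supremum in the extremal problem finite. -/
theorem exists_Tbar_bound (hK : KernelBounds s C K) (hΛ : 0 < Λ) (hsd : s < d) :
    ∃ S : ℝ, ∀ (μ : Measure (RSpace d)) (T : ℝ) (φ : RSpace d → ℂ),
      IsNice s Λ μ → PairDecay s T K μ → μ (ball 0 1) = 0 → 0 < μ (ball 0 2) → IsLip0 φ →
      ∫ y, φ y ∂μ = 1 → ‖Tbar K μ φ 0‖ ≤ S := by
  have hs := hK.s_pos
  have h1 := growthConst_pos (p := s - 1) (q := s) (by linarith)
  have h2 := hK.tailConstOne_pos hΛ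
  have h3 := growthConst_pos (p := s) (q := (d : ℝ) + 1) (by linarith)
  set η := Λ * (2 * 6 : ℝ) ^ s with hη
  set b := 2 * farConst d s (1 / 4) 6 with hb
  have hb0 : 0 < b := by rw [hb, farConst]; positivity
  refine ⟨η + (growthConst (s - 1) s * Λ * (4 * 2 ^ (d + 1)) * (1 / 4) + b * η) +
    tailConstOne s C Λ * 3 / 6, ?_⟩
  intro μ T φ hμ hd h0 hpos hφ hφ1
  have := hμ.isLocallyFinite
  have key := enorm_Tbar_zero_le hK hΛ hμ hsd hd hpos (hasPotential_of_ball_null hs h0) hφ hφ1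
    (τ := 1 / 4) (R := 6) (by norm_num) le_rfl le_rfl
  have k1 : μ (ball 0 (2 * 6)) ≤ ENNReal.ofReal η := hμ 0 _ (by norm_num)
  have hη0 : 0 < η := by positivity
  have k2 : μ.real (ball 0 (2 * 6)) ≤ η := ENNReal.toReal_le_of_le_ofReal hη0.le k1
  have k4 : ‖Tbar K μ φ 0‖ₑ ≤ ENNReal.ofReal (η +
      (growthConst (s - 1) s * Λ * (4 * 2 ^ (d + 1)) * (1 / 4) + b * η) +
      tailConstOne s C Λ * 3 / 6) := by
    refine key.trans ?_
    rw [ENNReal.ofReal_add (by positivity) (by positivity),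
      ENNReal.ofReal_add (by positivity) (by positivity),
      ENNReal.ofReal_add (by positivity) (by positivity)]
    gcongr
    exact (potential_le_of_ball_null hs h0 _).trans k1
  rw [← ofReal_norm] at k4
  exact (ENNReal.ofReal_le_ofReal_iff (by positivity)).1 k4

end BumpEstimate

/-! ### Vague limits of nice measures -/

section VagueConvergence

variable {d d' : ℕ} {s Λ : ℝ}

/-- Vague convergence of a sequence of measures along a filter. -/
def VagueTendsto (F : Filter ℕ) (μ : ℕ → Measure (RSpace d)) (ν : Measure (RSpace d)) : Prop :=
  ∀ f : RSpace d → ℝ, Continuous f → HasCompactSupport f →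
    Tendsto (fun k => ∫ x, f x ∂(μ k)) F (𝓝 (∫ x, f x ∂ν))

open CompactlySupported in
-- Along a non-principal ultrafilter every bounded sequence of reals converges, so no subsequences
-- have to be extracted. The limits define a positive functional, represented by a measure through
-- Riesz–Markov.
theorem exists_vague_limit {μ : ℕ → Measure (RSpace d)} (hμ : ∀ k, IsNice s Λ (μ k)) :
    ∃ ν : Measure (RSpace d), ν.Regular ∧ VagueTendsto (hyperfilter ℕ : Filter ℕ) μ ν := by
  have hloc := fun k => (hμ k).isLocallyFinite
  have hlim : ∀ f : C_c(RSpace d, ℝ), ∃ l : ℝ,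
      Tendsto (fun k => ∫ x, f x ∂(μ k)) (hyperfilter ℕ : Filter ℕ) (𝓝 l) := by
    intro f
    obtain ⟨B, hB⟩ := f.hasCompactSupport.exists_bound_of_continuous f.continuous
    obtain ⟨ρ, hρ0, hρ⟩ := f.hasCompactSupport.isCompact.isBounded.subset_ball_lt 0 0
    have hbound : ∀ k, ∫ x, f x ∂(μ k) ∈ closedBall (0 : ℝ) (B * |Λ * ρ ^ s|) := by
      intro k
      have h1 : ∫ x, f x ∂(μ k) = ∫ x in ball 0 ρ, f x ∂(μ k) := by
        rw [setIntegral_eq_integral_of_forall_compl_eq_zero]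
        intro x hx
        by_contra h
        exact hx (hρ (subset_tsupport _ h))
      have h2 := norm_setIntegral_le_of_norm_le_const (μ := μ k) (s := ball (0 : RSpace d) ρ)
        (f := f) measure_ball_lt_top (fun x _ => hB x)
      have hB0 : 0 ≤ B := (norm_nonneg _).trans (hB 0)
      have h3 : (μ k).real (ball 0 ρ) ≤ |Λ * ρ ^ s| := by
        refine ENNReal.toReal_le_of_le_ofReal (abs_nonneg _) ((hμ k 0 ρ hρ0).trans ?_)
        exact ENNReal.ofReal_le_ofReal (le_abs_self _)
      rw [mem_closedBall_zero_iff, h1]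
      exact h2.trans (mul_le_mul_of_nonneg_left h3 hB0)
    obtain ⟨l, -, hl⟩ := (isCompact_closedBall (0 : ℝ) (B * |Λ * ρ ^ s|)).ultrafilter_le_nhds
      ((hyperfilter ℕ).map fun k => ∫ x, f x ∂(μ k))
      (by simp only [Ultrafilter.coe_map, le_principal_iff, mem_map]
          exact Eventually.of_forall hbound)
    exact ⟨l, hl⟩
  choose L hL using hlim
  have hint : ∀ (f : C_c(RSpace d, ℝ)) k, Integrable f (μ k) := fun f k =>
    f.continuous.integrable_of_hasCompactSupport f.hasCompactSupport
  let Lin : C_c(RSpace d, ℝ) →ₗ[ℝ] ℝ :=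
    { toFun := L
      map_add' := fun f g => by
        refine tendsto_nhds_unique (hL (f + g)) (((hL f).add (hL g)).congr fun k => ?_)
        rw [← integral_add (hint f k) (hint g k)]; rfl
      map_smul' := fun c f => by
        refine tendsto_nhds_unique (hL (c • f)) (((hL f).const_mul c).congr fun k => ?_)
        rw [← integral_const_mul]; rfl }
  let P : C_c(RSpace d, ℝ) →ₚ[ℝ] ℝ := PositiveLinearMap.mk₀ Lin fun f hf =>
    ge_of_tendsto (hL f) (Eventually.of_forall fun k => integral_nonneg fun x => hf x)
  refine ⟨RealRMK.rieszMeasure P, inferInstance, fun f hf hfc => ?_⟩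
  have h1 := RealRMK.integral_rieszMeasure P ⟨⟨f, hf⟩, hfc⟩
  have h2 : P ⟨⟨f, hf⟩, hfc⟩ = L ⟨⟨f, hf⟩, hfc⟩ := rfl
  rw [h2] at h1
  have h3 := hL ⟨⟨f, hf⟩, hfc⟩
  rw [← h1] at h3
  exact h3

variable {F : Filter ℕ} [F.NeBot] {μ : ℕ → Measure (RSpace d)} {ν : Measure (RSpace d)}

theorem VagueTendsto.measure_le_of_isOpen (h : VagueTendsto F μ ν) [ν.Regular]
    (hloc : ∀ k, IsLocallyFiniteMeasure (μ k)) {U : Set (RSpace d)} (hU : IsOpen U) {c : ℝ}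
    (hc : ∀ k, μ k U ≤ ENNReal.ofReal c) : ν U ≤ ENNReal.ofReal c := by
  rw [hU.measure_eq_iSup_isCompact]
  refine iSup₂_le fun S hSU => iSup_le fun hS => ?_
  obtain ⟨f, hf1, hfc, hfU, hf01⟩ := exists_continuousMap_one_of_isCompact_subset_isOpen hS hU hSU
  have hle : ∀ k, ∫ x, f x ∂(μ k) ≤ max c 0 := by
    intro k
    have h1 : ∫ x, f x ∂(μ k) ≤ (μ k).real U := by
      rw [← integral_indicator_one hU.measurableSet]
      refine integral_mono (f.continuous.integrable_of_hasCompactSupport hfc)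
        ((integrable_indicator_iff hU.measurableSet).2 (integrableOn_const
          ((hc k).trans_lt ENNReal.ofReal_lt_top).ne)) fun x => ?_
      by_cases hx : x ∈ U
      · rw [indicator_of_mem hx]; exact (hf01 x).2
      · rw [indicator_of_notMem hx]
        refine le_of_eq ?_
        by_contra h0
        exact hx (hfU (subset_tsupport _ h0))
    refine h1.trans (ENNReal.toReal_le_of_le_ofReal (le_max_right _ _) ((hc k).trans ?_))
    exact ENNReal.ofReal_le_ofReal (le_max_left _ _)
  have h2 : ∫ x, f x ∂ν ≤ max c 0 :=
    le_of_tendsto (h f f.continuous hfc) (Eventually.of_forall hle)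
  have h3 : ν.real S ≤ ∫ x, f x ∂ν := by
    rw [← integral_indicator_one hS.measurableSet]
    refine integral_mono ((integrable_indicator_iff hS.measurableSet).2
      (integrableOn_const hS.measure_lt_top.ne))
      (f.continuous.integrable_of_hasCompactSupport hfc) fun x => ?_
    by_cases hx : x ∈ S
    · rw [indicator_of_mem hx, hf1 hx]
    · rw [indicator_of_notMem hx]; exact (hf01 x).1
  rw [← ofReal_measureReal hS.measure_lt_top.ne]
  refine (ENNReal.ofReal_le_ofReal (h3.trans h2)).trans (le_of_eq ?_)
  rcases le_total c 0 with h | h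
  · rw [max_eq_right h, ENNReal.ofReal_of_nonpos h, ENNReal.ofReal_zero]
  · rw [max_eq_left h]

theorem VagueTendsto.isNice (h : VagueTendsto F μ ν) [ν.Regular] (hμ : ∀ k, IsNice s Λ (μ k)) :
    IsNice s Λ ν := fun x r hr =>
  h.measure_le_of_isOpen (fun k => (hμ k).isLocallyFinite) isOpen_ball fun k => hμ k x r hr

theorem VagueTendsto.le_measure_ball (h : VagueTendsto F μ ν) [IsLocallyFiniteMeasure ν]
    (hloc : ∀ k, IsLocallyFiniteMeasure (μ k)) {r r' c : ℝ} (hrr : r < r')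
    (hc : ∀ᶠ k in F, c ≤ (μ k).real (ball 0 r)) : c ≤ ν.real (ball 0 r') := by
  obtain ⟨f, hf1, hfc, hfU, hf01⟩ := exists_continuousMap_one_of_isCompact_subset_isOpen
    (isCompact_closedBall (0 : RSpace d) r) (isOpen_ball (x := (0 : RSpace d)) (ε := r'))
    (closedBall_subset_ball hrr)
  have h1 : ∀ᶠ k in F, c ≤ ∫ x, f x ∂(μ k) := by
    filter_upwards [hc] with k hk
    refine hk.trans ?_
    rw [← integral_indicator_one measurableSet_ball]
    refine integral_mono ((integrable_indicator_iff measurableSet_ball).2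
      (integrableOn_const measure_ball_lt_top.ne))
      (f.continuous.integrable_of_hasCompactSupport hfc) fun x => ?_
    by_cases hx : x ∈ ball (0 : RSpace d) r
    · rw [indicator_of_mem hx, hf1 (ball_subset_closedBall hx)]
    · rw [indicator_of_notMem hx]; exact (hf01 x).1
  refine (ge_of_tendsto (h f f.continuous hfc) h1).trans ?_
  rw [← integral_indicator_one measurableSet_ball]
  refine integral_mono (f.continuous.integrable_of_hasCompactSupport hfc)
    ((integrable_indicator_iff measurableSet_ball).2 (integrableOn_const
      measure_ball_lt_top.ne)) fun x => ?_
  by_cases hx : x ∈ ball (0 : RSpace d) r'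
  · rw [indicator_of_mem hx]; exact (hf01 x).2
  · rw [indicator_of_notMem hx]
    refine le_of_eq ?_
    by_contra h0
    exact hx (hfU (subset_tsupport _ h0))

variable {E : Type*} [NormedAddCommGroup E] [NormedSpace ℝ E] [FiniteDimensional ℝ E]

omit [F.NeBot] in
theorem VagueTendsto.tendsto_integral (h : VagueTendsto F μ ν) [IsLocallyFiniteMeasure ν]
    (hloc : ∀ k, IsLocallyFiniteMeasure (μ k)) {f : RSpace d → E} (hf : Continuous f)
    (hfc : HasCompactSupport f) :
    Tendsto (fun k => ∫ x, f x ∂(μ k)) F (𝓝 (∫ x, f x ∂ν)) := by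
  have : CompleteSpace E := FiniteDimensional.complete ℝ E
  let e := (Module.finBasis ℝ E).equivFunL
  have key : Tendsto (fun k => e (∫ x, f x ∂(μ k))) F (𝓝 (e (∫ x, f x ∂ν))) := by
    rw [tendsto_pi_nhds]
    intro i
    let l : E →L[ℝ] ℝ := (ContinuousLinearMap.proj (R := ℝ) (φ := fun _ => ℝ) i).comp (e : E →L[ℝ] _)
    have h1 : ∀ (m : Measure (RSpace d)), IsLocallyFiniteMeasure m →
        e (∫ x, f x ∂m) i = ∫ x, l (f x) ∂m := by
      intro m _
      exact (l.integral_comp_comm (hf.integrable_of_hasCompactSupport hfc)).symm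
    simp_rw [fun k => h1 (μ k) (hloc k), h1 ν inferInstance]
    exact h (fun x => l (f x)) (l.continuous.comp hf) (hfc.comp_left l.map_zero)
  have := (e.symm.continuous.tendsto _).comp key
  simpa [Function.comp_def] using this

omit [F.NeBot] [NormedSpace ℝ E] [FiniteDimensional ℝ E] in
theorem tendsto_of_approx {a : ℕ → E} {l : E}
    (h : ∀ ε > 0, ∃ b : ℕ → E, ∃ m : E, Tendsto b F (𝓝 m) ∧ (∀ᶠ k in F, ‖a k - b k‖ ≤ ε) ∧
      ‖l - m‖ ≤ ε) : Tendsto a F (𝓝 l) := by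
  rw [Metric.tendsto_nhds]
  intro ε hε
  obtain ⟨b, m, hb, hab, hlm⟩ := h (ε / 4) (by positivity)
  filter_upwards [hab, Metric.tendsto_nhds.1 hb (ε / 4) (by positivity)] with k h1 h2
  rw [dist_eq_norm] at h2 ⊢
  calc ‖a k - l‖ = ‖(a k - b k) + (b k - m) - (l - m)‖ := by congr 1; abel
    _ ≤ ‖a k - b k‖ + ‖b k - m‖ + ‖l - m‖ :=
      (norm_sub_le _ _).trans (add_le_add_left (norm_add_le _ _) _)
    _ < ε := by linarith

omit [F.NeBot] in
-- The partial integrals in x are equicontinuous in y, uniformly over nice measures, so their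
-- convergence on a finite net is uniform convergence. Vague convergence is then applied once more,
-- to the limiting partial integral.
theorem VagueTendsto.tendsto_integral_prod (h : VagueTendsto F μ ν)
    (hμ : ∀ k, IsNice s Λ (μ k)) (hν : IsNice s Λ ν) {f : RSpace d × RSpace d → E}
    (hf : Continuous f) (hfc : HasCompactSupport f) :
    Tendsto (fun k => ∫ p, f p ∂((μ k).prod (μ k))) F (𝓝 (∫ p, f p ∂(ν.prod ν))) := by
  have hloc := fun k => (hμ k).isLocallyFinite
  have hlocν := hν.isLocallyFinite
  obtain ⟨ρ, hρ0, hρ⟩ := hfc.isCompact.isBounded.subset_ball_lt 0 0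
  have hf0 : ∀ x y, ¬ (‖x‖ < ρ ∧ ‖y‖ < ρ) → f (x, y) = 0 := by
    intro x y hxy
    by_contra h0
    have := hρ (subset_tsupport _ h0)
    rw [mem_ball_zero_iff, Prod.norm_def, max_lt_iff] at this
    exact hxy this
  set M := |Λ * ρ ^ s| with hM
  have hM0 : 0 ≤ M := abs_nonneg _
  have hmass : ∀ m : Measure (RSpace d), IsNice s Λ m → m.real (ball 0 ρ) ≤ M := by
    intro m hm
    refine ENNReal.toReal_le_of_le_ofReal (abs_nonneg _) ((hm 0 ρ hρ0).trans ?_)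
    exact ENNReal.ofReal_le_ofReal (le_abs_self _)
  have hbound : ∀ m : Measure (RSpace d), IsNice s Λ m → ∀ (u : RSpace d → E) (c : ℝ), 0 ≤ c →
      (∀ x, ‖u x‖ ≤ c) → (∀ x, ρ ≤ ‖x‖ → u x = 0) → ‖∫ x, u x ∂m‖ ≤ c * M := by
    intro m hm u c hc hu hu0
    have := hm.isLocallyFinite
    rw [← setIntegral_eq_integral_of_forall_compl_eq_zero (s := ball (0 : RSpace d) ρ)]
    · exact (norm_setIntegral_le_of_norm_le_const measure_ball_lt_top fun x _ => hu x).trans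
        (mul_le_mul_of_nonneg_left (hmass m hm) hc)
    · intro x hx
      exact hu0 x (by simpa using hx)
  have hslice : ∀ y, Continuous fun x => f (x, y) := fun y => by fun_prop
  have hslicec : ∀ y, HasCompactSupport fun x => f (x, y) := fun y =>
    HasCompactSupport.intro (isCompact_closedBall (0 : RSpace d) ρ) fun x hx => by
      rw [mem_closedBall_zero_iff, not_le] at hx
      exact hf0 x y fun h => by linarith [h.1]
  have hfi : ∀ m : Measure (RSpace d), IsLocallyFiniteMeasure m → Integrable f (m.prod m) :=
    fun m _ => hf.integrable_of_hasCompactSupport hfc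
  set G : Measure (RSpace d) → RSpace d → E := fun m y => ∫ x, f (x, y) ∂m with hG
  have hG0 : ∀ m y, ρ ≤ ‖y‖ → G m y = 0 := by
    intro m y hy
    have : ∀ x, f (x, y) = 0 := fun x => hf0 x y fun h => by linarith [h.2]
    simp [hG, this]
  have hdiff : ∀ ε > 0, ∃ δ > 0, ∀ m : Measure (RSpace d), IsNice s Λ m → ∀ y y', dist y y' < δ →
      ‖G m y - G m y'‖ ≤ ε * M := by
    intro ε hε
    obtain ⟨δ, hδ, hδ'⟩ := Metric.uniformContinuous_iff.1
      (hfc.uniformContinuous_of_continuous hf) ε hε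
    refine ⟨δ, hδ, fun m hm y y' hyy => ?_⟩
    have := hm.isLocallyFinite
    rw [hG]
    dsimp only
    rw [← integral_sub ((hslice y).integrable_of_hasCompactSupport (hslicec y))
      ((hslice y').integrable_of_hasCompactSupport (hslicec y'))]
    refine hbound m hm _ ε hε.le (fun x => ?_) fun x hx => ?_
    · have := hδ' (a := (x, y)) (b := (x, y')) (by simpa [Prod.dist_eq] using hyy)
      rw [dist_eq_norm] at this
      exact this.le
    · rw [hf0 x y fun h => by linarith [h.1], hf0 x y' fun h => by linarith [h.1], sub_zero]
  have hGcont : ∀ m : Measure (RSpace d), IsNice s Λ m → Continuous (G m) := by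
    intro m hm
    rw [Metric.continuous_iff']
    intro y ε hε
    obtain ⟨δ, hδ, hδ'⟩ := hdiff (ε / (2 * (M + 1))) (by positivity)
    filter_upwards [ball_mem_nhds y hδ] with y' hy'
    rw [dist_eq_norm]
    refine (hδ' m hm y' y hy').trans_lt ?_
    rw [div_mul_eq_mul_div, div_lt_iff₀ (by positivity)]
    nlinarith
  have hGc : ∀ m, HasCompactSupport (G m) := fun m =>
    HasCompactSupport.intro (isCompact_closedBall (0 : RSpace d) ρ) fun x hx => by
      rw [mem_closedBall_zero_iff, not_le] at hx
      exact hG0 m x hx.le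
  have hunif : ∀ ε > 0, ∀ᶠ k in F, ∀ y, ‖G (μ k) y - G ν y‖ ≤ ε := by
    intro ε hε
    obtain ⟨δ, hδ, hδ'⟩ := hdiff (ε / (3 * (M + 1))) (by positivity)
    have hsmall : ε / (3 * (M + 1)) * M ≤ ε / 3 := by
      rw [div_mul_eq_mul_div, div_le_iff₀ (by positivity)]
      nlinarith
    obtain ⟨t, -, htfin, ht⟩ := (isCompact_closedBall (0 : RSpace d) ρ).finite_cover_balls hδ
    have h1 : ∀ᶠ k in F, ∀ y ∈ t, ‖G (μ k) y - G ν y‖ ≤ ε / 3 := by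
      rw [htfin.eventually_all]
      intro y _
      have h2 := h.tendsto_integral hloc (hslice y) (hslicec y)
      filter_upwards [Metric.tendsto_nhds.1 h2 (ε / 3) (by positivity)] with k hk
      rw [dist_eq_norm] at hk
      exact hk.le
    filter_upwards [h1] with k hk y
    by_cases hy : ρ ≤ ‖y‖
    · rw [hG0 _ y hy, hG0 _ y hy, sub_zero, norm_zero]; exact hε.le
    · obtain ⟨y', hy't, hyy'⟩ := mem_iUnion₂.1 (ht (mem_closedBall_zero_iff.2 (not_le.1 hy).le))
      have a1 := hδ' (μ k) (hμ k) y y' hyy'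
      have a2 := hδ' ν hν y' y (by rwa [dist_comm])
      calc ‖G (μ k) y - G ν y‖
          = ‖(G (μ k) y - G (μ k) y') + (G (μ k) y' - G ν y') + (G ν y' - G ν y)‖ := by
            congr 1; abel
        _ ≤ ‖G (μ k) y - G (μ k) y'‖ + ‖G (μ k) y' - G ν y'‖ + ‖G ν y' - G ν y‖ := norm_add₃_le
        _ ≤ ε := by linarith [hk y' hy't]
  have e1 : ∀ m : Measure (RSpace d), IsNice s Λ m →
      ∫ p, f p ∂(m.prod m) = ∫ y, G m y ∂m := by
    intro m hm
    have := hm.isLocallyFinite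
    exact integral_prod_symm _ (hfi m this)
  rw [e1 ν hν]
  simp_rw [fun k => e1 (μ k) (hμ k)]
  refine tendsto_of_approx fun ε hε => ?_
  refine ⟨fun k => ∫ y, G ν y ∂(μ k), ∫ y, G ν y ∂ν,
    h.tendsto_integral hloc (hGcont ν hν) (hGc ν), ?_, by simpa using hε.le⟩
  filter_upwards [hunif (ε / (M + 1)) (by positivity)] with k hk
  rw [← integral_sub ((hGcont _ (hμ k)).integrable_of_hasCompactSupport (hGc _))
    ((hGcont ν hν).integrable_of_hasCompactSupport (hGc ν))]
  refine (hbound (μ k) (hμ k) _ _ (by positivity) hk fun x hx => ?_).trans ?_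
  · rw [hG0 _ x hx, hG0 _ x hx, sub_zero]
  · rw [div_mul_eq_mul_div, div_le_iff₀ (by positivity)]
    nlinarith

end VagueConvergence

/-! ### Continuity of the pairing and of T̄(1) under vague limits -/

section Limits

variable {d d' : ℕ} {s C Λ T α : ℝ} {K : RSpace d → CSpace d'} {F : Filter ℕ}
  {μ : ℕ → Measure (RSpace d)} {ν : Measure (RSpace d)} {f g φ : RSpace d → ℂ}

/-- A continuous cut-off that vanishes for `‖u‖ ≤ τ / 2` and is `1` for `‖u‖ ≥ τ`. -/
noncomputable def farCut (τ : ℝ) (u : RSpace d) : ℝ := max 0 (min 1 (2 * ‖u‖ / τ - 1))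

theorem farCut_eq_one {τ : ℝ} (hτ : 0 < τ) {u : RSpace d} (hu : τ ≤ ‖u‖) : farCut τ u = 1 := by
  have : 1 ≤ ‖u‖ / τ := (one_le_div hτ).2 hu
  have h : (1 : ℝ) ≤ 2 * ‖u‖ / τ - 1 := by rw [mul_div_assoc]; linarith
  simp [farCut, min_eq_left h]

theorem farCut_eq_zero {τ : ℝ} (hτ : 0 < τ) {u : RSpace d} (hu : ‖u‖ ≤ τ / 2) :
    farCut τ u = 0 := by
  have h : 2 * ‖u‖ / τ - 1 ≤ 0 := by rw [sub_nonpos, div_le_one hτ]; linarith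
  exact max_eq_left ((min_le_right _ _).trans h)

theorem farCut_mem (τ : ℝ) (u : RSpace d) : 0 ≤ farCut τ u ∧ farCut τ u ≤ 1 :=
  ⟨le_max_left _ _, max_le zero_le_one (min_le_left _ _)⟩

theorem continuous_farCut_smul (hK : KernelBounds s C K) {τ : ℝ} (hτ : 0 < τ) :
    Continuous fun u => farCut τ u • K u := by
  rw [continuous_iff_continuousAt]
  intro u
  rcases eq_or_ne u 0 with rfl | hu
  · have h1 : (fun u : RSpace d => farCut τ u • K u) =ᶠ[𝓝 0] fun _ => 0 := by
      filter_upwards [ball_mem_nhds (0 : RSpace d) (by positivity : 0 < τ / 2)] with v hv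
      rw [farCut_eq_zero hτ (mem_ball_zero_iff.1 hv).le, zero_smul]
    exact continuousAt_const.congr h1.symm
  · have h1 : ContinuousAt K u := hK.cont.continuousAt (isOpen_compl_singleton.mem_nhds hu)
    have h2 : Continuous (farCut (d := d) τ) := by unfold farCut; fun_prop
    exact h2.continuousAt.smul h1

/-- Removing a τ-neighbourhood of the diagonal with `farCut` leaves a continuous compactly supported
integrand and changes the pairing by at most cτ, uniformly over nice measures. -/
theorem VagueTendsto.tendsto_pairing (h : VagueTendsto F μ ν) (hK : KernelBounds s C K)
    (hΛ : 0 < Λ) (hμ : ∀ k, IsNice s Λ (μ k)) (hν : IsNice s Λ ν) (hf : IsLip0 f)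
    (hg : IsLip0 g) :
    Tendsto (fun k => pairing K (μ k) f g) F (𝓝 (pairing K ν f g)) := by
  obtain ⟨ρ, hρ, hfρ, hgρ⟩ := exists_common_radius hf hg
  obtain ⟨L, hL0, hL⟩ := hf.exists_antisymm_le hg
  have hgc := growthConst_pos (p := s - 1) (q := s) (by linarith)
  set c := L * (growthConst (s - 1) s * Λ * (Λ * ρ ^ s)) with hc
  have hc0 : 0 < c := by positivity
  have happrox : ∀ τ > 0, ∀ m : Measure (RSpace d), IsNice s Λ m →
      ‖pairing K m f g - ∫ p, farCut τ (p.1 - p.2) • pairInt K f g p ∂(m.prod m)‖ ≤ c * τ := by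
    intro τ hτ m hm
    have := hm.isLocallyFinite
    have hi := integrable_pairInt hK hΛ hm hf hg
    have hcm : Measurable fun p : RSpace d × RSpace d => farCut τ (p.1 - p.2) := by
      unfold farCut; fun_prop
    have hi2 : Integrable (fun p => farCut τ (p.1 - p.2) • pairInt K f g p) (m.prod m) := by
      refine hi.norm.mono' (hcm.aestronglyMeasurable.smul hi.1) (ae_of_all _ fun p => ?_)
      rw [norm_smul, Real.norm_of_nonneg (farCut_mem _ _).1]
      exact mul_le_of_le_one_left (norm_nonneg _) (farCut_mem _ _).2
    rw [pairing_eq, ← integral_sub hi hi2]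
    have h1 : ‖∫ p, (pairInt K f g p - farCut τ (p.1 - p.2) • pairInt K f g p) ∂(m.prod m)‖ₑ ≤
        ENNReal.ofReal (c * τ) := by
      refine (enorm_integral_le_lintegral_enorm _).trans ?_
      calc _ ≤ ∫⁻ p, ({P : RSpace d × RSpace d | P.2 ∈ ball 0 ρ ∧ P.1 ∈ ball P.2 τ}).indicator
            (fun p => ‖pairInt K f g p‖ₑ) p ∂(m.prod m) := by
            refine lintegral_mono fun p => ?_
            by_cases hp : p ∈ {P : RSpace d × RSpace d | P.2 ∈ ball 0 ρ ∧ P.1 ∈ ball P.2 τ}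
            · rw [indicator_of_mem hp]
              nth_rewrite 1 [← one_smul ℝ (pairInt K f g p)]
              rw [← sub_smul, enorm_smul]
              refine mul_le_of_le_one_left' ?_
              rw [← ofReal_norm, ← ENNReal.ofReal_one]
              refine ENNReal.ofReal_le_ofReal ?_
              have := farCut_mem τ (p.1 - p.2)
              rw [Real.norm_of_nonneg (by linarith)]
              linarith
            · rw [indicator_of_notMem hp]
              by_cases hp2 : p.2 ∈ ball (0 : RSpace d) ρ
              · have h3 : τ ≤ ‖p.1 - p.2‖ := by
                  by_contra! h4
                  exact hp ⟨hp2, by rwa [mem_ball, dist_eq_norm]⟩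
                simp [farCut_eq_one hτ h3]
              · simp [pairInt_eq_zero hfρ hgρ fun h => hp2 h.2]
        _ = ∫⁻ p in {P : RSpace d × RSpace d | P.2 ∈ ball 0 ρ ∧ P.1 ∈ ball P.2 τ},
            ‖pairInt K f g p‖ₑ ∂(m.prod m) :=
            lintegral_indicator (measurableSet_near_diagonal _ _ _) _
        _ ≤ ENNReal.ofReal L * (ENNReal.ofReal (growthConst (s - 1) s * Λ * τ) *
              ENNReal.ofReal (Λ * ρ ^ s)) :=
            (lintegral_pairInt_near_le hK hΛ hm hτ hL).trans (by gcongr; exact hm 0 ρ hρ)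
        _ = _ := by
            rw [← ENNReal.ofReal_mul (by positivity), ← ENNReal.ofReal_mul hL0.le]
            congr 1; rw [hc]; ring
    rw [← ofReal_norm] at h1
    exact (ENNReal.ofReal_le_ofReal_iff (by positivity)).1 h1
  refine tendsto_of_approx fun ε hε => ?_
  have hτ : 0 < ε / c := by positivity
  have hcτ : c * (ε / c) = ε := by field_simp
  refine ⟨fun k => ∫ p, farCut (ε / c) (p.1 - p.2) • pairInt K f g p ∂((μ k).prod (μ k)),
    ∫ p, farCut (ε / c) (p.1 - p.2) • pairInt K f g p ∂(ν.prod ν), ?_, ?_, ?_⟩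
  · refine h.tendsto_integral_prod hμ hν ?_ ?_
    · have h1 := hf.continuous
      have h2 := hg.continuous
      have h3 : Continuous fun p : RSpace d × RSpace d =>
          farCut (ε / c) (p.1 - p.2) • K (p.1 - p.2) :=
        (continuous_farCut_smul hK hτ).comp (continuous_fst.sub continuous_snd)
      have h4 : (fun p : RSpace d × RSpace d => farCut (ε / c) (p.1 - p.2) • pairInt K f g p) =
          fun p => ((1 / 2 : ℂ) * (f p.2 * g p.1 - g p.2 * f p.1)) •
            (farCut (ε / c) (p.1 - p.2) • K (p.1 - p.2)) := by
        ext1 p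
        rw [pairInt, smul_comm]
      rw [h4]
      have h5 : Continuous fun p : RSpace d × RSpace d =>
          (1 / 2 : ℂ) * (f p.2 * g p.1 - g p.2 * f p.1) := by fun_prop
      exact h5.smul h3
    · refine HasCompactSupport.intro ((isCompact_closedBall (0 : RSpace d) ρ).prod
        (isCompact_closedBall (0 : RSpace d) ρ)) fun p hp => ?_
      rw [pairInt_eq_zero hfρ hgρ, smul_zero]
      exact fun h => hp ⟨ball_subset_closedBall h.1, ball_subset_closedBall h.2⟩
  · exact Eventually.of_forall fun k => (happrox _ hτ _ (hμ k)).trans hcτ.le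
  · exact (happrox _ hτ _ hν).trans hcτ.le

/-- None of the measures charges the unit ball, so K may be replaced by the continuous function
`farCut 1 • K` in the potential at 0. -/
theorem VagueTendsto.tendsto_mainPart (h : VagueTendsto F μ ν) (hK : KernelBounds s C K)
    (hΛ : 0 < Λ) (hμ : ∀ k, IsNice s Λ (μ k)) (hν : IsNice s Λ ν)
    (hμ0 : ∀ k, μ k (ball 0 1) = 0) (hν0 : ν (ball 0 1) = 0) (hφ : IsLip0 φ) (hg : IsLip0 g)
    {c : ℕ → ℂ} (hc : Tendsto c F (𝓝 1)) :
    Tendsto (fun k => mainPart K (μ k) (fun x => c k * φ x) g 0) F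
      (𝓝 (mainPart K ν φ g 0)) := by
  have hloc := fun k => (hμ k).isLocallyFinite
  have hlocν := hν.isLocallyFinite
  have e1 : ∀ m : Measure (RSpace d), m (ball 0 1) = 0 →
      ∫ y, g y • K (y - 0) ∂m = ∫ y, g y • (farCut 1 y • K y) ∂m := by
    intro m hm
    have h1 : ∀ᵐ y ∂m, 1 ≤ ‖y‖ := by
      rw [ae_iff]
      refine measure_mono_null (fun y hy => ?_) hm
      simpa using hy
    refine integral_congr_ae ?_
    filter_upwards [h1] with y hy
    rw [farCut_eq_one one_pos hy, one_smul, sub_zero]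
  simp only [mainPart]
  rw [e1 ν hν0]
  simp_rw [fun k => e1 (μ k) (hμ0 k), pairing_const_mul_left]
  refine Tendsto.sub ?_ ?_
  · refine h.tendsto_integral hloc (hg.continuous.smul (continuous_farCut_smul hK one_pos)) ?_
    exact hg.2.smul_right
  · have := hc.smul (h.tendsto_pairing hK hΛ hμ hν hφ hg)
    rwa [one_smul] at this

theorem exists_isLip0_integral_eq_one [IsLocallyFiniteMeasure ν] (hν : ν ≠ 0) :
    ∃ φ, IsLip0 φ ∧ ∫ x, φ x ∂ν = 1 := by
  obtain ⟨R, hR, hpos⟩ : ∃ R > 0, 0 < ν (ball 0 R) := by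
    by_contra! hcon
    refine hν (Measure.measure_univ_eq_zero.1 ?_)
    rw [← iUnion_ball_nat 0]
    refine measure_iUnion_null fun n => ?_
    refine measure_mono_null (ball_subset_ball (le_max_left (n : ℝ) 1)) ?_
    exact le_antisymm (hcon _ (by positivity)) bot_le
  have hL := (isCut_cutoff (d := d) hR).isLip0
  have hne : ∫ x, cutoff R x ∂ν ≠ 0 := by
    have h1 : ∫ x, cutoff R x ∂ν = ((∫ x, ‖cutoff R x‖ ∂ν : ℝ) : ℂ) := by
      rw [← integral_complex_ofReal]
      refine integral_congr_ae (ae_of_all _ fun y => ?_)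
      dsimp only
      rw [cutoff, Complex.norm_real, Real.norm_eq_abs, abs_of_nonneg (le_max_left _ _)]
    have h2 : ν.real (ball 0 R) ≤ ∫ x, ‖cutoff R x‖ ∂ν := by
      rw [← integral_indicator_one measurableSet_ball]
      refine integral_mono ((integrable_indicator_iff measurableSet_ball).2
        (integrableOn_const measure_ball_lt_top.ne)) hL.integrable.norm fun y => ?_
      by_cases hy : y ∈ ball (0 : RSpace d) R
      · rw [indicator_of_mem hy, cutoff_eq_one hR (mem_ball_zero_iff.1 hy).le]
        simp
      · rw [indicator_of_notMem hy]; exact norm_nonneg _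
    have h3 : 0 < ν.real (ball 0 R) := ENNReal.toReal_pos hpos.ne' measure_ball_lt_top.ne
    rw [h1]
    exact_mod_cast (h3.trans_le h2).ne'
  refine ⟨fun x => (∫ x, cutoff R x ∂ν)⁻¹ * cutoff R x, hL.const_mul _, ?_⟩
  rw [integral_const_mul, inv_mul_cancel₀ hne]

/-- A function normalised for the limit is only nearly normalised for `μ k`; the factors `c k` → 1
correct this. Independence of the normalising function disposes of the arbitrary `ψ k`. The
remaining tails are at most a/R, uniformly in k. -/
theorem VagueTendsto.tendsto_Tbar [F.NeBot] (h : VagueTendsto F μ ν) (hK : KernelBounds s C K)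
    (hΛ : 0 < Λ) (hμ : ∀ k, IsNice s Λ (μ k)) (hν : IsNice s Λ ν)
    (hd : ∀ k, PairDecay s T K (μ k))
    (hμ0 : ∀ k, μ k (ball 0 1) = 0) (hν0 : ν (ball 0 1) = 0) (hφ : IsLip0 φ)
    (hφ1 : ∫ x, φ x ∂ν = 1) {ψ : ℕ → RSpace d → ℂ} (hψ : ∀ k, IsLip0 (ψ k))
    (hψ1 : ∀ k, ∫ x, ψ k x ∂(μ k) = 1) :
    Tendsto (fun k => Tbar K (μ k) (ψ k) 0) F (𝓝 (Tbar K ν φ 0)) := by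
  have hloc := fun k => (hμ k).isLocallyFinite
  have hlocν := hν.isLocallyFinite
  have hI := h.tendsto_integral hloc hφ.continuous hφ.2
  rw [hφ1] at hI
  have hc := hI.inv₀ one_ne_zero
  rw [inv_one] at hc
  have hne := hI.eventually_ne one_ne_zero
  set c : ℕ → ℂ := fun k => (∫ x, φ x ∂(μ k))⁻¹ with hcdef
  have hbd : ∀ᶠ k in F, ‖c k‖ ≤ 2 := by
    have := hc.norm
    rw [norm_one] at this
    filter_upwards [this.eventually_lt_const (by norm_num : (1 : ℝ) < 2)] with k hk using hk.le
  obtain ⟨ρ, hρ, hφρ⟩ := hφ.exists_radius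
  obtain ⟨B, hB, hφB⟩ := hφ.exists_bound
  have hT := hK.tailConst_pos hΛ
  set a := tailConst s C Λ * (2 * B) * ρ ^ (s + 1) with ha
  have ha0 : 0 < a := by positivity
  refine tendsto_of_approx fun ε hε => ?_
  set R := max (2 * ρ) (a / ε) with hR
  have hR0 : 0 < R := lt_max_of_lt_left (by positivity)
  have haR : a / R ≤ ε := by
    rw [div_le_iff₀ hR0]
    have : a / ε ≤ R := le_max_right _ _
    rw [div_le_iff₀ hε] at this
    linarith
  have hcut := isCut_cutoff (d := d) hR0
  refine ⟨fun k => mainPart K (μ k) (fun x => c k * φ x) (cutoff R) 0, mainPart K ν φ (cutoff R) 0,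
    h.tendsto_mainPart hK hΛ hμ hν hμ0 hν0 hφ hcut.isLip0 hc, ?_, ?_⟩
  · filter_upwards [hne, hbd] with k hk1 hk2
    have hpot := hasPotential_of_ball_null (μ := μ k) hK.s_pos (hμ0 k)
    have hn1 : ∫ x, c k * φ x ∂(μ k) = 1 := by
      rw [integral_const_mul, hcdef, inv_mul_cancel₀ hk1]
    rw [Tbar_eq_Tbar hK hΛ (hμ k) (hd k) hpot (hψ k) (hψ1 k) (hφ.const_mul (c k)) hn1]
    refine (norm_Tbar_sub_mainPart_le hK hΛ (hμ k) (B := 2 * B) hρ (by positivity)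
      (le_max_left _ _) (by simpa using hρ.le) hpot (hφ.const_mul (c k)) (fun y => ?_)
      (fun y hy => by rw [hφρ y hy, mul_zero]) hn1 hcut).trans haR
    rw [norm_mul]
    exact mul_le_mul hk2 (hφB y) (norm_nonneg _) (by norm_num)
  · refine (norm_Tbar_sub_mainPart_le hK hΛ hν (B := 2 * B) hρ (by positivity)
      (le_max_left _ _) (by simpa using hρ.le) (hasPotential_of_ball_null hK.s_pos hν0) hφ
      (fun y => (hφB y).trans (by linarith)) hφρ hφ1 hcut).trans haR

/-- A function of mean zero for the limit becomes one for `μ k` after subtracting a multiple `c k` →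
0 of a fixed φ. The uniform decay of the pairings then passes to the limit. -/
theorem VagueTendsto.isReflectionless [F.NeBot] (h : VagueTendsto F μ ν)
    (hK : KernelBounds s C K) (hα : 0 < α)
    (hΛ : 0 < Λ) (hμ : ∀ k, IsNice s Λ (μ k)) (hν : IsNice s Λ ν) (hν0 : ν ≠ 0)
    (hd : ∀ k, PairDecay s T K (μ k)) : IsReflectionless s α K ν := by
  have hloc := fun k => (hμ k).isLocallyFinite
  have hlocν := hν.isLocallyFinite
  refine isReflectionless_of_tendsto hα hK hΛ hν fun f hf hf0 => ?_
  obtain ⟨φ, hφ, hφ1⟩ := exists_isLip0_integral_eq_one hν0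
  obtain ⟨ρ, hρ, hfρ, hφρ⟩ := exists_common_radius hf hφ
  obtain ⟨B, hB, hfB⟩ := hf.exists_bound
  obtain ⟨D, hD, hφD⟩ := hφ.exists_bound
  have hIφ := h.tendsto_integral hloc hφ.continuous hφ.2
  have hIf := h.tendsto_integral hloc hf.continuous hf.2
  rw [hφ1] at hIφ
  rw [hf0] at hIf
  have hne := hIφ.eventually_ne one_ne_zero
  set c : ℕ → ℂ := fun k => (∫ x, f x ∂(μ k)) / ∫ x, φ x ∂(μ k) with hcdef
  have hc : Tendsto c F (𝓝 0) := by
    have := hIf.div hIφ one_ne_zero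
    rwa [zero_div] at this
  have hbd : ∀ᶠ k in F, ‖c k‖ ≤ 1 := by
    have := hc.norm
    rw [norm_zero] at this
    filter_upwards [this.eventually_lt_const one_pos] with k hk using hk.le
  have key : ∀ R, 2 * ρ ≤ R → ‖pairing K ν f (cutoff R)‖ ≤ T * (B + D) * ρ ^ (s + 1) / R := by
    intro R hR
    have hcut := isCut_cutoff (d := d) (by linarith : 0 < R)
    have hlim : Tendsto (fun k => pairing K (μ k) (fun x => f x - c k * φ x) (cutoff R)) F
        (𝓝 (pairing K ν f (cutoff R))) := by
      have h1 := (h.tendsto_pairing hK hΛ hμ hν hf hcut.isLip0).sub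
        (hc.smul (h.tendsto_pairing hK hΛ hμ hν hφ hcut.isLip0))
      rw [zero_smul, sub_zero] at h1
      refine h1.congr fun k => ?_
      rw [pairing_sub_left hK hΛ (hμ k) hf (hφ.const_mul (c k)) hcut.isLip0,
        pairing_const_mul_left]
    refine le_of_tendsto hlim.norm ?_
    filter_upwards [hne, hbd] with k hk1 hk2
    refine hd k _ (hf.sub (hφ.const_mul (c k))) ?_ ρ (B + D) R hρ (by positivity) hR
      (fun y => ?_) (fun y hy => ?_) _ hcut
    · rw [integral_sub hf.integrable (hφ.const_mul (c k)).integrable, integral_const_mul, hcdef,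
        div_mul_cancel₀ _ hk1, sub_self]
    · refine (norm_sub_le _ _).trans (add_le_add (hfB y) ?_)
      rw [norm_mul]
      calc _ ≤ 1 * D := mul_le_mul hk2 (hφD y) (norm_nonneg _) zero_le_one
        _ = D := one_mul D
    · rw [hfρ y hy.le, hφρ y hy.le, mul_zero, sub_zero]
  have l2 : Tendsto (fun R : ℝ => T * (B + D) * ρ ^ (s + 1) / R) atTop (𝓝 0) :=
    tendsto_const_nhds.div_atTop tendsto_id
  refine squeeze_zero_norm' ?_ l2
  filter_upwards [eventually_ge_atTop (2 * ρ)] with R hR using key R hR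

end Limits

/-! ### The extremal problem -/

section Extremal

variable {d d' : ℕ} {s C Λ T α : ℝ} {K : RSpace d → CSpace d'}
  {μ ν : Measure (RSpace d)} {f g φ : RSpace d → ℂ}

theorem volume_ball_le (z : RSpace d) {t : ℝ} (ht : 0 < t) :
    volume (ball z t) ≤ ENNReal.ofReal (volume.real (ball (0 : RSpace d) 1) * t ^ (d : ℝ)) := by
  rw [Measure.addHaar_ball_of_pos _ _ ht, finrank_euclideanSpace_fin, Real.rpow_natCast, mul_comm,
    ENNReal.ofReal_mul measureReal_nonneg, ofReal_measureReal measure_ball_lt_top.ne]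

/-- By Tonelli: the integral over x of |x - y|^(-s) on a unit ball about y is bounded in y because s
< d. -/
theorem ae_hasPotential [IsLocallyFiniteMeasure μ] (hs : 0 < s) (hsd : s < d) :
    ∀ᵐ x ∂(volume : Measure (RSpace d)), HasPotential s μ x := by
  set c := growthConst s d * volume.real (ball (0 : RSpace d) 1) * 1 ^ ((d : ℝ) - s) with hc
  have hvol : ∀ z : RSpace d, ∫⁻ x in ball z 1, ‖x - z‖ₑ ^ (-s) ≤ ENNReal.ofReal c := fun z =>
    lintegral_ball_rpow_le (by linarith) hsd measureReal_nonneg one_pos volume z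
      fun t ht _ => volume_ball_le z ht
  have key : ∀ n : ℕ, ∀ᵐ x ∂(volume.restrict (ball (0 : RSpace d) n)), HasPotential s μ x := by
    intro n
    set U := {P : RSpace d × RSpace d | P.2 ∈ ball P.1 1} with hU
    have hUm : MeasurableSet U := by
      have : IsOpen U := by
        simp only [hU, mem_ball]
        exact isOpen_lt (by fun_prop) continuous_const
      exact this.measurableSet
    set F : RSpace d × RSpace d → ENNReal := U.indicator fun P => ‖P.2 - P.1‖ₑ ^ (-s) with hF
    have hFm : Measurable F := Measurable.indicator (by fun_prop) hUm
    have e1 : ∀ x, ∫⁻ y, F (x, y) ∂μ = ∫⁻ y in ball x 1, ‖y - x‖ₑ ^ (-s) ∂μ := by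
      intro x
      rw [← lintegral_indicator measurableSet_ball]
      rfl
    have hfin : ∫⁻ x in ball (0 : RSpace d) n, ∫⁻ y, F (x, y) ∂μ ≠ ⊤ := by
      rw [lintegral_lintegral_swap (show AEMeasurable (Function.uncurry fun x y => F (x, y)) _ from hFm.aemeasurable)]
      refine ne_of_lt (lt_of_le_of_lt ?_ (?_ : ENNReal.ofReal c * μ (ball 0 (n + 1)) < ⊤))
      · calc _ ≤ ∫⁻ y, (ball (0 : RSpace d) (n + 1)).indicator (fun _ => ENNReal.ofReal c) y ∂μ := by
              refine lintegral_mono fun y => ?_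
              by_cases hy : y ∈ ball (0 : RSpace d) (n + 1)
              · rw [indicator_of_mem hy]
                refine le_trans ((lintegral_mono' Measure.restrict_le_self le_rfl).trans
                  (le_of_eq ?_)) (hvol y)
                rw [← lintegral_indicator measurableSet_ball]
                refine lintegral_congr fun x => ?_
                by_cases hx : x ∈ ball y 1
                · rw [indicator_of_mem hx, hF,
                    indicator_of_mem (show (x, y) ∈ U from mem_ball_comm.1 hx)]
                  dsimp only
                  rw [← enorm_neg, neg_sub]
                · rw [indicator_of_notMem hx, hF,
                    indicator_of_notMem (show (x, y) ∉ U from fun h => hx (mem_ball_comm.1 h))]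
              · refine (le_of_eq ?_).trans zero_le
                rw [← lintegral_zero (μ := volume.restrict (ball (0 : RSpace d) n))]
                refine setLIntegral_congr_fun measurableSet_ball fun x hx => ?_
                rw [hF, indicator_of_notMem]
                intro h
                refine hy ?_
                have h1 : dist y x < 1 := h
                have h2 := dist_triangle y x 0
                rw [mem_ball] at hx ⊢
                linarith
        _ = _ := by rw [lintegral_indicator measurableSet_ball, setLIntegral_const]
      · exact ENNReal.mul_lt_top ENNReal.ofReal_lt_top measure_ball_lt_top
    filter_upwards [ae_lt_top hFm.lintegral_prod_right' hfin] with x hx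
    rw [e1] at hx
    exact hx
  have h2 := ae_restrict_iUnion_iff (μ := (volume : Measure (RSpace d)))
    (fun n : ℕ => ball (0 : RSpace d) n) (fun x => HasPotential s μ x)
  rw [iUnion_ball_nat, Measure.restrict_univ] at h2
  exact h2.2 key

theorem hasPotential_of_measure_ball_eq_zero [IsLocallyFiniteMeasure μ] (hs : 0 < s)
    {x : RSpace d} {t : ℝ} (ht : 0 < t) (h : μ (ball x t) = 0) : HasPotential s μ x := by
  have h1 : ∀ᵐ y ∂μ, t ≤ ‖y - x‖ := by
    rw [ae_iff]
    refine measure_mono_null (fun y hy => ?_) h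
    simpa [dist_eq_norm] using hy
  refine lt_of_le_of_lt (lintegral_mono_ae (g := fun _ => ENNReal.ofReal (t ^ (-s))) ?_) ?_
  · refine ae_restrict_of_ae ?_
    filter_upwards [h1] with y hy
    rw [← ofReal_norm, ENNReal.ofReal_rpow_of_pos (by linarith)]
    exact ENNReal.ofReal_le_ofReal (Real.rpow_le_rpow_of_nonpos ht hy (by linarith))
  · rw [setLIntegral_const]
    exact ENNReal.mul_lt_top ENNReal.ofReal_lt_top measure_ball_lt_top

theorem tendsto_potential_zero (hs : 0 < s) (hμ : IsNice s Λ μ) {x : RSpace d}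
    (hx : HasPotential s μ x) : Tendsto (potential s μ x) (𝓝[>] 0) (𝓝 0) := by
  have h1 : Tendsto (fun t : ℝ => (μ.restrict (ball x 1)) (ball x t)) (𝓝[>] 0) (𝓝 0) := by
    have h2 : Tendsto (fun t : ℝ => ENNReal.ofReal (Λ * t ^ s)) (𝓝[>] 0) (𝓝 0) := by
      have h := (Real.continuousAt_rpow_const 0 s (Or.inr hs.le)).tendsto.const_mul Λ
      rw [Real.zero_rpow hs.ne', mul_zero] at h
      simpa using ENNReal.tendsto_ofReal (h.mono_left nhdsWithin_le_nhds)
    refine tendsto_of_tendsto_of_tendsto_of_le_of_le' tendsto_const_nhds h2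
      (Eventually.of_forall fun _ => zero_le) ?_
    filter_upwards [self_mem_nhdsWithin] with t ht
    exact (Measure.restrict_apply_le _ _).trans (hμ x t ht)
  have h3 := tendsto_setLIntegral_zero (μ := μ.restrict (ball x 1)) hx.ne h1
  refine h3.congr' ?_
  filter_upwards [Ioc_mem_nhdsGT one_pos] with t ht
  rw [Measure.restrict_restrict measurableSet_ball, inter_eq_left.2 (ball_subset_ball ht.2)]
  rfl

theorem rescale_ne_zero [IsLocallyFiniteMeasure μ] (hμ0 : μ ≠ 0) (a : RSpace d) {r : ℝ}
    (hr : 0 < r) : rescale s a r μ ≠ 0 := by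
  intro h
  have h2 : μ (ball a (r * ((infDist a μ.support + 1) / r))) = 0 := by
    by_contra hne
    have h3 := (rescale_ball_pos (s := s) (a := a) (μ := μ) hr 0 ((infDist a μ.support + 1) / r)).2
    rw [smul_zero, add_zero] at h3
    have h4 := h3 (pos_iff_ne_zero.2 hne)
    rw [h] at h4
    simp at h4
  rw [mul_div_cancel₀ _ hr.ne'] at h2
  exact (measure_ball_pos_of_infDist_lt hμ0 (lt_add_one _)).ne' h2

theorem Tbar_rescale_zero (hK : KernelBounds s C K) (hΛ : 0 < Λ) (hμ : IsNice s Λ μ)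
    (hd : PairDecay s T K μ) {a : RSpace d} {r : ℝ} (hr : 0 < r) (hpot : HasPotential s μ a)
    (hφ : IsLip0 φ) (hφ1 : ∫ y, φ y ∂μ = 1) {ψ : RSpace d → ℂ} (hψ : IsLip0 ψ)
    (hψ1 : ∫ y, ψ y ∂(rescale s a r μ) = 1) :
    Tbar K (rescale s a r μ) ψ 0 = Tbar K μ φ a := by
  have ha : a + r • (0 : RSpace d) = a := by simp
  have h1 := Tbar_rescale hK hΛ hμ hr (x := 0) (by rwa [ha]) hψ hψ1
  rw [ha] at h1
  rw [h1]
  exact Tbar_eq_Tbar hK hΛ hμ hd hpot ((hψ.comp_rescaleMap hr).const_mul _)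
    (by rw [← hψ1, integral_rescale_density hr]) hφ hφ1

theorem PairDecay.rescale (hK : KernelBounds s C K) (hΛ : 0 < Λ) (hμ : IsNice s Λ μ)
    (hd : PairDecay s T K μ) (a : RSpace d) {r : ℝ} (hr : 0 < r) :
    PairDecay s (tailConst s C Λ) K (rescale s a r μ) :=
  (hd.isReflectionless_rescale (α := 1) one_pos hK hΛ hμ hr).pairDecay hK hΛ (hμ.rescale hr)

/-- Zooming in by the factor t/R at x preserves the value, and carries the potential over `ball x
t`, which tends to 0 with t, to the potential over `ball 0 R`. Since x is in the support, the zoomed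
measures charge `ball 0 2`, as the smallness estimate requires. -/
theorem Tbar_eq_zero_of_mem_support (hK : KernelBounds s C K) (hΛ : 0 < Λ) (hsd : s < d)
    (hμ : IsNice s Λ μ) (hd : PairDecay s T K μ) (hφ : IsLip0 φ) (hφ1 : ∫ y, φ y ∂μ = 1)
    {x : RSpace d} (hx : x ∈ μ.support) (hpot : HasPotential s μ x) : Tbar K μ φ x = 0 := by
  have := hμ.isLocallyFinite
  rw [← norm_le_zero_iff]
  refine le_of_forall_pos_le_add fun ε hε => ?_
  rw [zero_add]
  obtain ⟨R, hR, c, hc, hsmall⟩ := exists_small_potential hK hΛ hsd hε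
  have hμ0 : μ ≠ 0 := Measure.nonempty_support_iff.1 ⟨x, hx⟩
  have h1 : ∀ᶠ t in 𝓝[>] (0 : ℝ), potential s μ x t ≤ ENNReal.ofReal c :=
    (tendsto_potential_zero hK.s_pos hμ hpot).eventually_le_const (by simpa using hc)
  obtain ⟨t, ht, ht0⟩ := (h1.and self_mem_nhdsWithin).exists
  have ht0 : 0 < t := ht0
  have hr : 0 < t / R := by positivity
  have := (hμ.rescale (s := s) (a := x) hr).isLocallyFinite
  obtain ⟨ψ, hψ, hψ1⟩ := exists_isLip0_integral_eq_one (rescale_ne_zero (s := s) hμ0 x hr)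
  have ha : x + (t / R) • (0 : RSpace d) = x := by simp
  rw [← Tbar_rescale_zero hK hΛ hμ hd hr hpot hφ hφ1 hψ hψ1]
  refine hsmall _ _ ψ (hμ.rescale hr) (hd.rescale hK hΛ hμ x hr) ?_
    (HasPotential.rescale hμ hK.s_pos hr (by rwa [ha])) hψ hψ1 ?_
  · rw [rescale_ball_pos hr, ha]
    exact (Measure.mem_support_iff_forall x).1 hx _ (ball_mem_nhds x (by positivity))
  · rw [potential_rescale hr, ha, div_mul_cancel₀ _ hR.ne']
    exact ht

/-- In the difference of the truncations the pairing cancels, and what remains is an integral of K(y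
- x) - K(y) over |y| ≥ 1, which converges absolutely and is linear in |x|. -/
theorem norm_Tbar_sub_le (hK : KernelBounds s C K) (hΛ : 0 < Λ) (hμ : IsNice s Λ μ)
    (h0 : μ (ball 0 1) = 0) (hφ : IsLip0 φ) (hφ1 : ∫ y, φ y ∂μ = 1) {x : RSpace d}
    (hx : ‖x‖ ≤ 1 / 2) :
    ‖Tbar K μ φ x - Tbar K μ φ 0‖ ≤ 2 * C * growthConst (s + 1) s * Λ * ‖x‖ := by
  have := hμ.isLocallyFinite
  have hs := hK.s_pos
  have hC := hK.C_pos
  have hgc := growthConst_pos (p := s + 1) (q := s) (by linarith)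
  have hpx : HasPotential s μ x := by
    refine hasPotential_of_measure_ball_eq_zero hs (t := 1 / 2) (by norm_num)
      (measure_mono_null (ball_subset_ball' ?_) h0)
    rw [dist_zero_right]; linarith
  have hp0 := hasPotential_of_ball_null hs h0
  have l1 := tendsto_mainPart_cutoff hK hΛ hμ hpx hφ hφ1 cutoff 0 isCut_cutoff_sub_zero
  have l2 := tendsto_mainPart_cutoff hK hΛ hμ hp0 hφ hφ1 cutoff 0 isCut_cutoff_sub_zero
  refine le_of_tendsto (l1.sub l2).norm ?_
  filter_upwards [eventually_gt_atTop 0] with R hR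
  have hcut := isCut_cutoff (d := d) hR
  have e1 : mainPart K μ φ (cutoff R) x - mainPart K μ φ (cutoff R) 0 =
      ∫ y, cutoff R y • (K (y - x) - K (y - 0)) ∂μ := by
    simp only [mainPart, smul_sub]
    rw [integral_sub (integrable_smul_kernel hK hcut.isLip0 hpx)
      (integrable_smul_kernel hK hcut.isLip0 hp0)]
    abel
  have h1 : ∀ᵐ y ∂μ, 1 ≤ ‖y‖ := by
    rw [ae_iff]
    refine measure_mono_null (fun y hy => ?_) h0
    simpa using hy
  rw [e1]
  have h2 : ‖∫ y, cutoff R y • (K (y - x) - K (y - 0)) ∂μ‖ₑ ≤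
      ENNReal.ofReal (2 * C * growthConst (s + 1) s * Λ * ‖x‖) := by
    refine (enorm_integral_le_lintegral_enorm _).trans ?_
    calc _ ≤ ∫⁻ y, (ball 0 1)ᶜ.indicator (fun y => ENNReal.ofReal (2 * (C * ‖x‖)) *
          ‖y - 0‖ₑ ^ (-(s + 1))) y ∂μ := by
          refine lintegral_mono_ae ?_
          filter_upwards [h1] with y hy
          rw [indicator_of_mem (by simpa using hy), enorm_smul, sub_zero]
          have h3 := hK.diff x 0 y (by rintro rfl; simp at hy; linarith) (by linarith)
            (by rw [norm_zero]; positivity)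
          rw [sub_zero, sub_zero] at h3
          rw [ENNReal.ofReal_mul (by norm_num), mul_assoc]
          refine mul_le_mul' ?_ h3
          rw [← ofReal_norm]
          exact ENNReal.ofReal_le_ofReal (hcut.norm_le_two y)
      _ = ENNReal.ofReal (2 * (C * ‖x‖)) * ∫⁻ y in (ball 0 1)ᶜ, ‖y - 0‖ₑ ^ (-(s + 1)) ∂μ := by
          rw [lintegral_indicator measurableSet_ball.compl, lintegral_const_mul _ (by fun_prop)]
      _ ≤ ENNReal.ofReal (2 * (C * ‖x‖)) *
            ENNReal.ofReal (growthConst (s + 1) s * Λ * 1 ^ (s - (s + 1))) :=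
          mul_le_mul_right (hμ.lintegral_compl_ball_le hΛ (by linarith) one_pos 0) _
      _ = _ := by
          rw [← ENNReal.ofReal_mul (by positivity), Real.one_rpow]
          congr 1; ring
  rw [← ofReal_norm] at h2
  exact (ENNReal.ofReal_le_ofReal_iff (by positivity)).1 h2

/-- By continuity at 0, a value above the essential supremum would be exceeded on a ball of positive
volume. -/
theorem enorm_Tbar_le_eLpNorm (hK : KernelBounds s C K) (hΛ : 0 < Λ) (hμ : IsNice s Λ μ)
    (h0 : μ (ball 0 1) = 0) (hφ : IsLip0 φ) (hφ1 : ∫ y, φ y ∂μ = 1) :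
    ‖Tbar K μ φ 0‖ₑ ≤ eLpNorm (Tbar K μ φ) ⊤ volume := by
  rw [eLpNorm_exponent_top]
  by_contra! hlt
  have hcont : ContinuousAt (Tbar K μ φ) 0 := by
    rw [ContinuousAt, tendsto_iff_norm_sub_tendsto_zero]
    have h1 : Tendsto (fun x : RSpace d => 2 * C * growthConst (s + 1) s * Λ * ‖x‖) (𝓝 0)
        (𝓝 0) := by
      have : Tendsto (fun x : RSpace d => 2 * C * growthConst (s + 1) s * Λ * ‖x‖) (𝓝 0)
          (𝓝 (2 * C * growthConst (s + 1) s * Λ * ‖(0 : RSpace d)‖)) :=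
        (Continuous.tendsto (by fun_prop) _)
      simpa using this
    refine squeeze_zero' (Eventually.of_forall fun _ => norm_nonneg _) ?_ h1
    filter_upwards [closedBall_mem_nhds (0 : RSpace d) (by norm_num : (0 : ℝ) < 1 / 2)] with x hx
    exact norm_Tbar_sub_le hK hΛ hμ h0 hφ hφ1 (mem_closedBall_zero_iff.1 hx)
  have h1 := hcont.enorm.eventually (lt_mem_nhds hlt)
  obtain ⟨r, hr, h2⟩ := Metric.eventually_nhds_iff_ball.1 h1
  have h3 := ae_iff.1 (enorm_ae_le_eLpNormEssSup (Tbar K μ φ) volume)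
  refine (measure_ball_pos volume (0 : RSpace d) hr).ne' (measure_mono_null (fun x hx => ?_) h3)
  simpa using h2 x hx

/-- The class of measures in the extremal problem, normalised at the origin. -/
structure IsAdmissible (s Λ C : ℝ) (K : RSpace d → CSpace d') (μ : Measure (RSpace d))
    (φ : RSpace d → ℂ) : Prop where
  nice : IsNice s Λ μ
  decay : PairDecay s (tailConst s C Λ) K μ
  null : μ (ball 0 1) = 0
  pos : 0 < μ (ball 0 2)
  lip : IsLip0 φ
  one : ∫ y, φ y ∂μ = 1

/-- Zooming in at x with r the distance to the support makes the open unit ball null and leaves mass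
in the ball of radius 2. -/
theorem exists_admissible (hK : KernelBounds s C K) (hΛ : 0 < Λ)
    (hμ : IsNice s Λ μ) (hd : PairDecay s T K μ) (hφ : IsLip0 φ) (hφ1 : ∫ y, φ y ∂μ = 1)
    (hμ0 : μ ≠ 0) {x : RSpace d} (hx : x ∉ μ.support) (hpot : HasPotential s μ x) :
    ∃ (m : Measure (RSpace d)) (ψ : RSpace d → ℂ), IsAdmissible s Λ C K m ψ ∧
      Tbar K m ψ 0 = Tbar K μ φ x := by
  have := hμ.isLocallyFinite
  set r := infDist x μ.support with hr
  have hr0 : 0 < r :=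
    (Measure.isClosed_support.notMem_iff_infDist_pos (Measure.nonempty_support hμ0)).1 hx
  have := (hμ.rescale (s := s) (a := x) hr0).isLocallyFinite
  obtain ⟨ψ, hψ, hψ1⟩ := exists_isLip0_integral_eq_one (rescale_ne_zero (s := s) hμ0 x hr0)
  have ha : x + r • (0 : RSpace d) = x := by simp
  refine ⟨rescale s x r μ, ψ, ⟨hμ.rescale hr0, hd.rescale hK hΛ hμ x hr0, ?_, ?_, hψ, hψ1⟩,
    Tbar_rescale_zero hK hΛ hμ hd hr0 hpot hφ hφ1 hψ hψ1⟩
  · rw [rescale_ball hr0, ha, mul_one, hr, measure_ball_infDist, mul_zero]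
  · rw [rescale_ball_pos hr0, ha]
    exact measure_ball_pos_of_infDist_lt hμ0 (by linarith)

/-- A maximising sequence has a vague limit, at which the value at 0 is the supremum. The conclusion
leaves out that the limit charges `ball 0 2`, since its support may come no closer than distance 2.
-/
theorem exists_extremal (hK : KernelBounds s C K) (hΛ : 0 < Λ) (hsd : s < d)
    (hμ : IsNice s Λ μ) (hd : PairDecay s (tailConst s C Λ) K μ) (hφ : IsLip0 φ)
    (hφ1 : ∫ y, φ y ∂μ = 1)
    (hne : ¬ ∀ᵐ x ∂(volume : Measure (RSpace d)), Tbar K μ φ x = 0) :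
    ∃ (ν : Measure (RSpace d)) (ψ : RSpace d → ℂ) (S : ℝ), IsNice s Λ ν ∧
      PairDecay s (tailConst s C Λ) K ν ∧ ν (ball 0 1) = 0 ∧ IsLip0 ψ ∧ ∫ y, ψ y ∂ν = 1 ∧
      ‖Tbar K ν ψ 0‖ = S ∧ ∀ (m : Measure (RSpace d)) (χ : RSpace d → ℂ),
        IsAdmissible s Λ C K m χ → ‖Tbar K m χ 0‖ ≤ S := by
  have := hμ.isLocallyFinite
  have hs := hK.s_pos
  have hμ0 : μ ≠ 0 := by
    rintro rfl
    simp at hφ1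
  set V : Set ℝ := {v | ∃ (m : Measure (RSpace d)) (χ : RSpace d → ℂ),
    IsAdmissible s Λ C K m χ ∧ ‖Tbar K m χ 0‖ = v} with hV
  obtain ⟨B, hB⟩ := exists_Tbar_bound hK hΛ hsd
  have hbdd : BddAbove V := by
    refine ⟨B, ?_⟩
    rintro _ ⟨m, χ, h, rfl⟩
    exact hB m _ χ h.nice h.decay h.null h.pos h.lip h.one
  obtain ⟨x, hxpot, hx0⟩ : ∃ x, HasPotential s μ x ∧ Tbar K μ φ x ≠ 0 := by
    by_contra! hcon
    refine hne ?_
    filter_upwards [ae_hasPotential (μ := μ) hs hsd] with x hx using hcon x hx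
  have hxs : x ∉ μ.support := fun h =>
    hx0 (Tbar_eq_zero_of_mem_support hK hΛ hsd hμ hd hφ hφ1 h hxpot)
  obtain ⟨m₀, χ₀, hadm₀, hval₀⟩ := exists_admissible hK hΛ hμ hd hφ hφ1 hμ0 hxs hxpot
  have hmem₀ : ‖Tbar K m₀ χ₀ 0‖ ∈ V := ⟨m₀, χ₀, hadm₀, rfl⟩
  have hSpos : 0 < sSup V := by
    refine lt_of_lt_of_le ?_ (le_csSup hbdd hmem₀)
    rw [hval₀]
    exact norm_pos_iff.2 hx0
  obtain ⟨u, -, hu, huV⟩ := exists_seq_tendsto_sSup ⟨_, hmem₀⟩ hbdd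
  choose m χ hadm hval using huV
  have hnice := fun k => (hadm k).nice
  have hloc := fun k => (hnice k).isLocallyFinite
  obtain ⟨ν, hreg, hvague⟩ := exists_vague_limit hnice
  have hνnice := hvague.isNice hnice
  have hνnull : ν (ball 0 1) = 0 := by
    have := hvague.measure_le_of_isOpen hloc isOpen_ball (c := 0)
      (fun k => by rw [(hadm k).null]; exact zero_le)
    simpa using this
  have hu' : Tendsto u (hyperfilter ℕ : Filter ℕ) (𝓝 (sSup V)) :=
    hu.mono_left Nat.hyperfilter_le_atTop
  obtain ⟨R, hR, c, hc, hsmall⟩ := exists_small_potential hK hΛ hsd (half_pos hSpos)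
  -- No escape of mass: if `ball 0 R` had mass below c, the value at 0 would be at most half the
  -- supremum, which is impossible far along the sequence.
  have hmass : ∀ᶠ k in (hyperfilter ℕ : Filter ℕ), c ≤ (m k).real (ball 0 R) := by
    filter_upwards [hu'.eventually (lt_mem_nhds (half_lt_self hSpos))] with k hk
    by_contra! hlt
    refine absurd (hsmall (m k) _ (χ k) (hnice k) (hadm k).decay (hadm k).pos
      (hasPotential_of_ball_null hs (hadm k).null) (hadm k).lip (hadm k).one ?_) ?_
    · refine (potential_le_of_ball_null hs (hadm k).null R).trans ?_
      rw [← ofReal_measureReal measure_ball_lt_top.ne]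
      exact ENNReal.ofReal_le_ofReal hlt.le
    · rw [hval k, not_le]; exact hk
  have hνmass := hvague.le_measure_ball hloc (lt_add_one R) hmass
  have hν0 : ν ≠ 0 := by
    rintro rfl
    simp at hνmass
    linarith
  have hνloc := hνnice.isLocallyFinite
  obtain ⟨ψ, hψ, hψ1⟩ := exists_isLip0_integral_eq_one hν0
  have hrefl := hvague.isReflectionless (α := 1) hK one_pos hΛ hnice hνnice hν0
    fun k => (hadm k).decay
  have hlim := hvague.tendsto_Tbar hK hΛ hnice hνnice (fun k => (hadm k).decay)
    (fun k => (hadm k).null) hνnull hψ hψ1 (fun k => (hadm k).lip) (fun k => (hadm k).one)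
  refine ⟨ν, ψ, sSup V, hνnice, hrefl.pairDecay hK hΛ hνnice, hνnull, hψ, hψ1, ?_, ?_⟩
  · refine tendsto_nhds_unique hlim.norm ?_
    simpa only [hval] using hu'
  · intro m χ h
    exact le_csSup hbdd ⟨m, χ, h, rfl⟩

/-- A dilation by the distance from 0 to the support brings that distance to 1 without changing the
value at 0. Almost every x has finite potential; there T̄(1) is 0 on the support, and off it is the
value of an admissible measure, hence at most S. -/
theorem exists_extremal_measure (hK : KernelBounds s C K) (hα : 0 < α) (hΛ : 0 < Λ) (hsd : s < d)
    (hμ : IsNice s Λ μ) (hd : PairDecay s (tailConst s C Λ) K μ) (hφ : IsLip0 φ)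
    (hφ1 : ∫ y, φ y ∂μ = 1)
    (hne : ¬ ∀ᵐ x ∂(volume : Measure (RSpace d)), Tbar K μ φ x = 0) :
    ∃ m : Measure (RSpace d), IsNice s Λ m ∧ IsReflectionless s α K m ∧
      m.support.Nonempty ∧ infDist 0 m.support = 1 ∧
      ∀ φ₀ : RSpace d → ℂ, IsLip0 φ₀ → ∫ x, φ₀ x ∂m = 1 →
        ‖Tbar K m φ₀ 0‖ₑ = eLpNorm (Tbar K m φ₀) ⊤ volume := by
  have hs := hK.s_pos
  obtain ⟨ν, ψ, S, hν, hνd, hν0, hψ, hψ1, hS, hmax⟩ := exists_extremal hK hΛ hsd hμ hd hφ hφ1 hne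
  have hνloc := hν.isLocallyFinite
  have hνne : ν ≠ 0 := by
    rintro rfl
    simp at hψ1
  set r := infDist 0 ν.support with hr
  have hr1 : 1 ≤ r := le_infDist_of_ball_null hνne hν0
  have hr0 : 0 < r := by linarith
  set m := rescale s 0 r ν with hm
  have hmn : IsNice s Λ m := hν.rescale hr0
  have hmloc := hmn.isLocallyFinite
  have hmne : m ≠ 0 := rescale_ne_zero hνne 0 hr0
  have hmd : PairDecay s (tailConst s C Λ) K m := hνd.rescale hK hΛ hν 0 hr0
  have hmnull : m (ball 0 1) = 0 := by
    rw [hm, rescale_ball hr0, smul_zero, add_zero, mul_one, hr, measure_ball_infDist, mul_zero]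
  refine ⟨m, hmn, hνd.isReflectionless_rescale hα hK hΛ hν hr0, Measure.nonempty_support hmne,
    ?_, fun φ₀ hφ₀ hφ₀1 => ?_⟩
  · refine le_antisymm (le_of_forall_pos_lt_add fun ε hε => infDist_support_le ?_)
      (le_infDist_of_ball_null hmne hmnull)
    rw [hm, rescale_ball_pos hr0, smul_zero, add_zero]
    exact measure_ball_pos_of_infDist_lt hνne (by nlinarith)
  · refine le_antisymm (enorm_Tbar_le_eLpNorm hK hΛ hmn hmnull hφ₀ hφ₀1) ?_
    have hval : ‖Tbar K m φ₀ 0‖ = S := by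
      rw [hm, Tbar_rescale_zero hK hΛ hν hνd hr0 (hasPotential_of_ball_null hs hν0) hψ hψ1 hφ₀
        hφ₀1, hS]
    rw [eLpNorm_exponent_top]
    refine essSup_le_of_ae_le _ ?_
    filter_upwards [ae_hasPotential (μ := m) hs hsd] with x hx
    have hle : ‖Tbar K m φ₀ x‖ ≤ S := by
      by_cases hxs : x ∈ m.support
      · rw [Tbar_eq_zero_of_mem_support hK hΛ hsd hmn hmd hφ₀ hφ₀1 hxs hx, norm_zero, ← hS]
        exact norm_nonneg _
      · obtain ⟨m', χ, hadm, he⟩ := exists_admissible hK hΛ hmn hmd hφ₀ hφ₀1 hmne hxs hx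
        rw [← he]
        exact hmax m' χ hadm
    rw [← ofReal_norm, ← ofReal_norm, hval]
    exact ENNReal.ofReal_le_ofReal hle

end Extremal

/-! ### Sums of dilated Schwartz functions -/

section Multiplier

theorem contDiff_tsum_dilate {E F : Type*} [NormedAddCommGroup E] [NormedSpace ℝ E]
    [NormedAddCommGroup F] [NormedSpace ℝ F] [CompleteSpace F] (h : 𝓢(E, F)) (c q : ℕ → ℝ) (n : ℕ)
    (hsum : ∀ i ≤ n, Summable fun j => |c j| * |q j| ^ i) :
    ContDiff ℝ n fun ξ => ∑' j, c j • h (q j • ξ) := by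
  choose S hS0 hS using fun i => h.decay 0 i
  have hd : ∀ j, ContDiff ℝ n fun ξ => h (q j • ξ) := fun j =>
    (h.smooth n).comp (contDiff_id.const_smul (q j))
  refine contDiff_tsum (N := (n : ℕ∞)) (v := fun i j => |c j| * |q j| ^ i * S i)
    (fun j => (hd j).const_smul (c j)) (fun i hi => (hsum i (by exact_mod_cast hi)).mul_right _) ?_
  intro i j ξ hi
  have hi' : (i : WithTop ℕ∞) ≤ n := by exact_mod_cast hi
  rw [iteratedFDeriv_const_smul_apply' ((hd j).of_le hi').contDiffAt,
    iteratedFDeriv_comp_const_smul (q j) (h.smooth i), norm_smul, norm_smul, norm_pow,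
    Real.norm_eq_abs, Real.norm_eq_abs, mul_assoc]
  have := hS i (q j • ξ)
  rw [pow_zero, one_mul] at this
  gcongr

theorem summable_two_pow_rpow {a : ℝ} (ha : a < 0) : Summable fun j : ℕ => ((2 : ℝ) ^ j) ^ a := by
  have : (fun j : ℕ => ((2 : ℝ) ^ j) ^ a) = fun j : ℕ => ((2 : ℝ) ^ a) ^ j := by
    funext j
    rw [← Real.rpow_natCast, ← Real.rpow_natCast, ← Real.rpow_mul (by norm_num),
      ← Real.rpow_mul (by norm_num), mul_comm]
  rw [this]
  exact summable_geometric_of_lt_one (by positivity) (Real.rpow_lt_one_of_one_lt_of_neg (by norm_num) ha)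

variable {d d' : ℕ} {s C b : ℝ} {K m : RSpace d → CSpace d'}

/-- The Schwartz function `‖ξ‖ ^ (2 * p) • k ξ`. -/
noncomputable def normPowMul (p : ℕ) (k : 𝓢(RSpace d, CSpace d')) : 𝓢(RSpace d, CSpace d') :=
  SchwartzMap.smulLeftCLM (𝕜 := ℝ) _ (fun ξ : RSpace d => (‖ξ‖ ^ 2) ^ p) k

theorem normPowMul_apply (p : ℕ) (k : 𝓢(RSpace d, CSpace d')) (ξ : RSpace d) :
    normPowMul p k ξ = (‖ξ‖ ^ 2) ^ p • k ξ :=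
  SchwartzMap.smulLeftCLM_apply_apply
    ((Function.hasTemperateGrowth_norm_sq (RSpace d)).pow p) k ξ

/-- Powers of the dilation factor are traded for negative powers of |ξ|: q^b becomes q^(b-2p) with p
as large as desired, which makes sums over q = 2^j converge away from the origin. -/
theorem dilate_eq_normPowMul (p : ℕ) (k : 𝓢(RSpace d, CSpace d')) (b : ℝ) {ξ : RSpace d}
    (hξ : ξ ≠ 0) {q : ℝ} (hq : 0 < q) :
    q ^ b • k (q • ξ) = ((‖ξ‖ ^ 2) ^ p)⁻¹ • (q ^ (b - 2 * p) • normPowMul p k (q • ξ)) := by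
  have h1 : 0 < ‖ξ‖ := norm_pos_iff.2 hξ
  rw [normPowMul_apply, smul_smul, smul_smul, norm_smul, Real.norm_of_nonneg hq.le]
  congr 1
  rw [Real.rpow_sub hq, show (2 : ℝ) * p = ((2 * p : ℕ) : ℝ) by push_cast; ring, Real.rpow_natCast,
    mul_pow, mul_pow, ← pow_mul q]
  field_simp

theorem exists_norm_dilate_le (k : 𝓢(RSpace d, CSpace d')) (b : ℝ) (p : ℕ) : ∃ S, 0 ≤ S ∧
    ∀ ξ : RSpace d, ξ ≠ 0 → ∀ q : ℝ, 0 < q →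
      ‖q ^ b • k (q • ξ)‖ ≤ ((‖ξ‖ ^ 2) ^ p)⁻¹ * S * q ^ (b - 2 * p) := by
  obtain ⟨S, hS0, hS⟩ := (normPowMul p k).decay 0 0
  refine ⟨S, hS0.le, fun ξ hξ q hq => ?_⟩
  rw [dilate_eq_normPowMul p k b hξ hq, norm_smul, norm_smul, norm_inv, norm_pow, norm_pow,
    norm_norm, Real.norm_of_nonneg (by positivity : (0 : ℝ) ≤ q ^ (b - 2 * p))]
  have := hS (q • ξ)
  rw [pow_zero, one_mul, norm_iteratedFDeriv_zero] at this
  rw [mul_assoc, mul_comm S]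
  gcongr

/-- Each derivative of order i costs a factor q^i, so p is chosen according to the order n of
smoothness required; the series with |ξ|^(-2p) taken out then converges in C^n. -/
theorem contDiffAt_tsum_dilate (k : 𝓢(RSpace d, CSpace d')) (b : ℝ) {ξ : RSpace d} (hξ : ξ ≠ 0) :
    ContDiffAt ℝ ∞ (fun ξ => ∑' j : ℕ, ((2 : ℝ) ^ j) ^ b • k ((2 : ℝ) ^ j • ξ)) ξ := by
  rw [contDiffAt_infty]
  intro n
  obtain ⟨p, hp⟩ := exists_nat_gt (b + n)
  have h1 : ContDiff ℝ n fun ξ => ∑' j : ℕ,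
      ((2 : ℝ) ^ j) ^ (b - 2 * p) • normPowMul p k ((2 : ℝ) ^ j • ξ) := by
    refine contDiff_tsum_dilate (normPowMul p k) (fun j => ((2 : ℝ) ^ j) ^ (b - 2 * p))
      (fun j => (2 : ℝ) ^ j) n fun i hi => ?_
    have hi' : (i : ℝ) ≤ n := by exact_mod_cast hi
    have hp0 : (0 : ℝ) ≤ p := Nat.cast_nonneg p
    refine (summable_two_pow_rpow (a := b - 2 * p + i) (by linarith)).congr fun j => ?_
    have hq : (0 : ℝ) < 2 ^ j := by positivity
    rw [abs_of_pos (by positivity), abs_of_pos hq, Real.rpow_add hq, Real.rpow_natCast]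
  have h2 : ContDiffAt ℝ n (fun ξ : RSpace d => ((‖ξ‖ ^ 2) ^ p)⁻¹) ξ :=
    ContDiffAt.inv ((contDiff_norm_sq ℝ).pow p).contDiffAt
      (pow_ne_zero _ (pow_ne_zero _ (norm_ne_zero_iff.2 hξ)))
  refine (h2.smul h1.contDiffAt).congr_of_eventuallyEq ?_
  filter_upwards [isOpen_ne.mem_nhds hξ] with η hη
  change _ = ((‖η‖ ^ 2) ^ p)⁻¹ • ∑' j : ℕ,
    ((2 : ℝ) ^ j) ^ (b - 2 * p) • normPowMul p k ((2 : ℝ) ^ j • η)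
  rw [← tsum_const_smul'']
  exact tsum_congr fun j => dilate_eq_normPowMul p k b hη (by positivity)

theorem integral_fourier_smul_eq_of_integrable {f : RSpace d → ℂ} {g : RSpace d → CSpace d'}
    (hf : Integrable f) (hg : Integrable g) : ∫ ξ, 𝓕 f ξ • g ξ = ∫ x, f x • 𝓕 g x := by
  simpa using! VectorFourier.integral_fourierIntegral_smul_eq_flip (L := innerₗ (RSpace d))
    Real.continuous_fourierChar continuous_inner hf hg

theorem fourier_comp_inv_smul {F : Type*} [NormedAddCommGroup F] [NormedSpace ℂ F]
    (g : RSpace d → F) {q : ℝ} (hq : 0 < q) (ξ : RSpace d) :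
    𝓕 (fun x => g (q⁻¹ • x)) ξ = q ^ d • 𝓕 g (q • ξ) := by
  rw [Real.fourier_eq, Real.fourier_eq]
  have h := Measure.integral_comp_inv_smul volume
    (fun x : RSpace d => Real.fourierChar (-(inner ℝ x (q • ξ))) • g x) q
  rw [finrank_euclideanSpace_fin, abs_of_pos (by positivity)] at h
  rw [← h]
  refine integral_congr_ae (Eventually.of_forall fun x => ?_)
  dsimp only
  rw [inner_smul_left, inner_smul_right]
  congr 3
  simp
  field_simp

theorem lintegral_mul_rpow_le (hs : 0 < s) (hsd : s < d) {f : RSpace d → ENNReal} {A : ENNReal}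
    (hA : ∀ x, f x ≤ A) (y : RSpace d) :
    ∫⁻ x, f x * ‖x - y‖ₑ ^ (-s) ≤
      A * ENNReal.ofReal (growthConst s d * volume.real (ball (0 : RSpace d) 1)) + ∫⁻ x, f x := by
  rw [← lintegral_add_compl _ (measurableSet_ball (x := y) (ε := 1))]
  refine add_le_add ?_ ?_
  · refine (lintegral_mono fun x => mul_le_mul_left (hA x) _).trans ?_
    rw [lintegral_const_mul _ (by fun_prop)]
    gcongr
    have := lintegral_ball_rpow_le (by linarith : (0 : ℝ) < d) hsd measureReal_nonneg one_pos volume y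
      fun t ht _ => volume_ball_le y ht
    simpa using this
  · refine le_trans ?_ (setLIntegral_le_lintegral (ball y 1)ᶜ f)
    refine setLIntegral_mono' measurableSet_ball.compl fun x hx => ?_
    refine mul_le_of_le_one_right' ?_
    rw [mem_compl_iff, mem_ball, not_lt, dist_eq_norm] at hx
    rw [← ofReal_norm, ENNReal.ofReal_rpow_of_pos (by linarith)]
    rw [← ENNReal.ofReal_one]
    exact ENNReal.ofReal_le_ofReal (Real.rpow_le_one_of_one_le_of_nonpos hx (by linarith))

end Multiplier

/-! ### Dyadic decomposition of the kernel -/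

section Multiplier

variable {d d' : ℕ} {s C b : ℝ} {K m : RSpace d → CSpace d'}

theorem lintegral_smul_kernel_lt_top (hK : KernelBounds s C K) (hsd : s < d) {f : RSpace d → ℂ}
    {A : ℝ} (hA : ∀ x, ‖f x‖ ≤ A) (hf : Integrable f) (y : RSpace d) :
    ∫⁻ x, ‖f x‖ₑ * ‖x - y‖ₑ ^ (-s) < ⊤ := by
  refine (lintegral_mul_rpow_le hK.s_pos hsd (A := ENNReal.ofReal A) (fun x => ?_) y).trans_lt ?_
  · rw [← ofReal_norm]
    exact ENNReal.ofReal_le_ofReal (hA x)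
  · exact ENNReal.add_lt_top.2 ⟨ENNReal.mul_lt_top ENNReal.ofReal_lt_top ENNReal.ofReal_lt_top,
      hf.hasFiniteIntegral⟩

theorem integrable_smul_kernel_volume (hK : KernelBounds s C K) (hsd : s < d) {f : RSpace d → ℂ}
    {A : ℝ} (hA : ∀ x, ‖f x‖ ≤ A) (hf : Integrable f) : Integrable fun x => f x • K x := by
  refine ⟨hf.1.smul hK.measurable.aestronglyMeasurable, ?_⟩
  refine lt_of_le_of_lt (lintegral_mono fun x => ?_)
    (lintegral_smul_kernel_lt_top hK hsd hA hf 0)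
  rw [enorm_smul, sub_zero]
  gcongr
  exact hK.size x

/-- A smooth cut-off function, `1` on the unit ball and supported in the ball of radius `2`. -/
noncomputable def unitBump (d : ℕ) : ContDiffBump (0 : RSpace d) := ⟨1, 2, one_pos, one_lt_two⟩

/-- The part of the kernel in the shell `1 ≤ ‖x‖ ≤ 4`. -/
noncomputable def shellKernel (K : RSpace d → CSpace d') (x : RSpace d) : CSpace d' :=
  (unitBump d ((2 : ℝ)⁻¹ • x) - unitBump d x) • K x

theorem shellKernel_eq_zero_of_le {x : RSpace d} (hx : ‖x‖ ≤ 1) : shellKernel K x = 0 := by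
  have h1 : unitBump d x = 1 :=
    (unitBump d).one_of_mem_closedBall (by simpa [unitBump] using hx)
  have h2 : unitBump d ((2 : ℝ)⁻¹ • x) = 1 :=
    (unitBump d).one_of_mem_closedBall (by
      simp [unitBump, norm_smul]
      linarith)
  rw [shellKernel, h1, h2, sub_self, zero_smul]

theorem shellKernel_eq_zero_of_ge {x : RSpace d} (hx : 4 ≤ ‖x‖) : shellKernel K x = 0 := by
  have h1 : unitBump d x = 0 :=
    (unitBump d).zero_of_le_dist (by
      simp [unitBump]
      linarith)
  have h2 : unitBump d ((2 : ℝ)⁻¹ • x) = 0 :=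
    (unitBump d).zero_of_le_dist (by
      simp [unitBump, norm_smul]
      linarith)
  rw [shellKernel, h1, h2, sub_self, zero_smul]

theorem hasCompactSupport_shellKernel : HasCompactSupport (shellKernel K) := by
  refine HasCompactSupport.intro (isCompact_closedBall (0 : RSpace d) 4) fun x hx => ?_
  rw [mem_closedBall_zero_iff, not_le] at hx
  exact shellKernel_eq_zero_of_ge hx.le

theorem contDiff_shellKernel (hsm : IsSmoothKernel K) : ContDiff ℝ ∞ (shellKernel K) := by
  rw [contDiff_iff_contDiffAt]
  intro x
  rcases eq_or_ne x 0 with rfl | hx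
  · refine (contDiffAt_const (c := (0 : CSpace d'))).congr_of_eventuallyEq ?_
    filter_upwards [ball_mem_nhds (0 : RSpace d) one_pos] with y hy
    exact shellKernel_eq_zero_of_le (mem_ball_zero_iff.1 hy).le
  · have h1 : ContDiff ℝ ∞ fun x : RSpace d => unitBump d ((2 : ℝ)⁻¹ • x) - unitBump d x :=
      ((unitBump d).contDiff.comp (contDiff_const_smul _)).sub (unitBump d).contDiff
    exact h1.contDiffAt.smul ((hsm x hx).contDiffAt (isOpen_compl_singleton.mem_nhds hx))

/-- By homogeneity the dilated shells are differences of consecutive cut-offs times K, and the sum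
telescopes. -/
theorem sum_shellKernel (hK : KernelBounds s C K) (N : ℕ) {x : RSpace d} (hx : x ≠ 0) :
    unitBump d x • K x + ∑ j ∈ Finset.range N,
      ((2 : ℝ) ^ j) ^ (-s) • shellKernel K (((2 : ℝ) ^ j)⁻¹ • x) =
    unitBump d (((2 : ℝ) ^ N)⁻¹ • x) • K x := by
  have h1 : ∀ j : ℕ, ((2 : ℝ) ^ j) ^ (-s) • shellKernel K (((2 : ℝ) ^ j)⁻¹ • x) =
      unitBump d (((2 : ℝ) ^ (j + 1))⁻¹ • x) • K x - unitBump d (((2 : ℝ) ^ j)⁻¹ • x) • K x := by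
    intro j
    have hq : (0 : ℝ) < 2 ^ j := by positivity
    rw [shellKernel, hK.homogeneous _ x (inv_pos.2 hq) hx, smul_smul, smul_smul, smul_smul,
      ← sub_smul, pow_succ, mul_inv_rev]
    congr 1
    rw [Real.inv_rpow hq.le]
    have : ((2 : ℝ) ^ j) ^ (-s) ≠ 0 := (Real.rpow_pos_of_pos hq _).ne'
    field_simp
  rw [Finset.sum_congr rfl fun j _ => h1 j,
    Finset.sum_range_sub (fun j => unitBump d (((2 : ℝ) ^ j)⁻¹ • x) • K x)]
  simp

theorem integral_smul_sum_shellKernel_tendsto (hK : KernelBounds s C K) (hsd : s < d)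
    (hsm : IsSmoothKernel K) {f : RSpace d → ℂ} {A : ℝ} (hA : ∀ x, ‖f x‖ ≤ A) (hf : Integrable f) :
    Tendsto (fun N => (∫ x, f x • unitBump d x • K x) + ∑ j ∈ Finset.range N,
      ∫ x, f x • ((2 : ℝ) ^ j) ^ (-s) • shellKernel K (((2 : ℝ) ^ j)⁻¹ • x)) atTop
      (𝓝 (∫ x, f x • K x)) := by
  have hne : ∀ᵐ x : RSpace d, x ≠ 0 := by
    have : Nontrivial (RSpace d) := by
      have hd : 0 < d := by
        have : (0 : ℝ) < d := hK.s_pos.trans hsd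
        exact_mod_cast this
      have : Nonempty (Fin d) := ⟨⟨0, hd⟩⟩
      infer_instance
    exact Measure.ae_ne volume 0
  have hint := integrable_smul_kernel_volume hK hsd hA hf
  have hb : ∀ x y : RSpace d, ‖f x • unitBump d y • K x‖ ≤ ‖f x • K x‖ := fun x y => by
    rw [smul_comm, norm_smul, Real.norm_of_nonneg (unitBump d).nonneg]
    exact mul_le_of_le_one_left (norm_nonneg _) (unitBump d).le_one
  have hmeas : ∀ c : ℝ, AEStronglyMeasurable (fun x => f x • unitBump d (c • x) • K x) :=
    fun c => hf.1.smul (((unitBump d).continuous.comp (continuous_const_smul c)).aestronglyMeasurable.smul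
      hK.measurable.aestronglyMeasurable)
  have hint' : ∀ c : ℝ, Integrable (fun x => f x • unitBump d (c • x) • K x) := fun c =>
    hint.mono (hmeas c) (Eventually.of_forall fun x => hb x _)
  have h0 : Integrable (fun x => f x • unitBump d x • K x) := by simpa using hint' 1
  have hshell : ∀ j : ℕ, Integrable
      (fun x => f x • ((2 : ℝ) ^ j) ^ (-s) • shellKernel K (((2 : ℝ) ^ j)⁻¹ • x)) := by
    intro j
    have hc : Continuous fun x : RSpace d =>
        ((2 : ℝ) ^ j) ^ (-s) • shellKernel K (((2 : ℝ) ^ j)⁻¹ • x) := by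
      have := (contDiff_shellKernel hsm).continuous
      fun_prop
    obtain ⟨B, hB⟩ := hasCompactSupport_shellKernel.exists_bound_of_continuous
      (contDiff_shellKernel hsm).continuous (f := shellKernel K)
    refine hf.smul_bdd (((2 : ℝ) ^ j) ^ (-s) * B) hc.aestronglyMeasurable
      (Eventually.of_forall fun x => ?_)
    rw [norm_smul, Real.norm_of_nonneg (by positivity)]
    gcongr
    exact hB _
  have heq : ∀ N : ℕ, (∫ x, f x • unitBump d x • K x) + ∑ j ∈ Finset.range N,
      ∫ x, f x • ((2 : ℝ) ^ j) ^ (-s) • shellKernel K (((2 : ℝ) ^ j)⁻¹ • x) =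
      ∫ x, f x • unitBump d (((2 : ℝ) ^ N)⁻¹ • x) • K x := by
    intro N
    rw [← integral_finsetSum _ fun j _ => hshell j,
      ← integral_add h0 (integrable_finsetSum _ fun j _ => hshell j)]
    refine integral_congr_ae ?_
    filter_upwards [hne] with x hx
    rw [← sum_shellKernel hK N hx, smul_add, Finset.smul_sum]
  simp only [heq]
  refine tendsto_integral_of_dominated_convergence _ (fun N => hmeas _) hint.norm
    (fun N => Eventually.of_forall fun x => hb x _) (Eventually.of_forall fun x => ?_)
  refine tendsto_const_nhds.congr' ?_
  obtain ⟨N₀, hN₀⟩ := pow_unbounded_of_one_lt ‖x‖ (one_lt_two (α := ℝ))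
  filter_upwards [eventually_ge_atTop N₀] with N hN
  have h1 : unitBump d (((2 : ℝ) ^ N)⁻¹ • x) = 1 := by
    refine (unitBump d).one_of_mem_closedBall ?_
    have : (2 : ℝ) ^ N₀ ≤ 2 ^ N := pow_le_pow_right₀ one_le_two hN
    simp only [unitBump, mem_closedBall_zero_iff, norm_smul, norm_inv, norm_pow, Real.norm_two]
    rw [inv_mul_le_iff₀ (by positivity)]
    linarith
  rw [h1, one_smul]

theorem integrable_unitBump_smul (hK : KernelBounds s C K) (hsd : s < d) (n : ℕ) :
    Integrable fun x : RSpace d => ‖x‖ ^ n * ‖unitBump d x • K x‖ := by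
  have hc : Continuous fun x : RSpace d => (((‖x‖ ^ n * unitBump d x : ℝ)) : ℂ) :=
    Complex.continuous_ofReal.comp (by have := (unitBump d).continuous; fun_prop)
  have hcs : HasCompactSupport fun x : RSpace d => (((‖x‖ ^ n * unitBump d x : ℝ)) : ℂ) := by
    refine HasCompactSupport.comp_left (g := fun r : ℝ => (r : ℂ)) ?_ Complex.ofReal_zero
    exact (unitBump d).hasCompactSupport.mul_left
  obtain ⟨A, hA⟩ := hcs.exists_bound_of_continuous hc
  refine (integrable_smul_kernel_volume hK hsd hA (hc.integrable_of_hasCompactSupport hcs)).norm.congr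
    (Eventually.of_forall fun x => ?_)
  dsimp only
  rw [norm_smul, norm_smul, Complex.norm_real, norm_mul, norm_pow, norm_norm, mul_assoc]

/-- The Fourier transform of a homogeneous kernel, as a series. -/
noncomputable def kernelSymbol (b : ℝ) (K : RSpace d → CSpace d') (k : 𝓢(RSpace d, CSpace d'))
    (ξ : RSpace d) : CSpace d' :=
  𝓕 (fun x : RSpace d => unitBump d x • K x) ξ + ∑' j : ℕ, ((2 : ℝ) ^ j) ^ b • k ((2 : ℝ) ^ j • ξ)

theorem contDiffOn_kernelSymbol (hK : KernelBounds s C K) (hsd : s < d) (b : ℝ)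
    (k : 𝓢(RSpace d, CSpace d')) : ContDiffOn ℝ ∞ (kernelSymbol b K k) {0}ᶜ := by
  intro ξ hξ
  refine ContDiffAt.contDiffWithinAt (ContDiffAt.add ?_ (contDiffAt_tsum_dilate k b hξ))
  exact (Real.contDiff_fourier fun n _ => integrable_unitBump_smul hK hsd n).contDiffAt

end Multiplier

/-! ### Smoothness of the multiplier away from the origin -/

section Multiplier

variable {d d' : ℕ} {s C b : ℝ} {K m : RSpace d → CSpace d'}

theorem continuousOn_angular (hm : ContinuousOn m (sphere 0 1)) (b : ℝ) :
    ContinuousOn (fun ξ : RSpace d => (1 / ‖ξ‖ ^ b) • m (‖ξ‖⁻¹ • ξ)) {0}ᶜ := by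
  have h0 : ∀ ξ ∈ ({0}ᶜ : Set (RSpace d)), ‖ξ‖ ≠ 0 := fun ξ hξ => norm_ne_zero_iff.2 hξ
  have h1 : ContinuousOn (fun ξ : RSpace d => ‖ξ‖⁻¹ • ξ) {0}ᶜ :=
    (continuousOn_id.norm.inv₀ h0).smul continuousOn_id
  have h2 : ContinuousOn (fun ξ : RSpace d => 1 / ‖ξ‖ ^ b) {0}ᶜ := by
    refine continuousOn_const.div (continuousOn_id.norm.rpow_const fun ξ hξ => Or.inl (h0 ξ hξ))
      fun ξ hξ => ?_
    exact (Real.rpow_pos_of_pos (norm_pos_iff.2 hξ) _).ne'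
  refine h2.smul (hm.comp h1 fun ξ hξ => ?_)
  simp [norm_smul, inv_mul_cancel₀ (h0 ξ hξ)]

theorem continuous_smul_of_tsupport {F : Type*} [NormedAddCommGroup F] [NormedSpace ℝ F]
    [NormedSpace ℂ F] {U : Set (RSpace d)} (hU : IsOpen U)
    {f : RSpace d → ℂ} (hf : Continuous f) (hfU : tsupport f ⊆ U) {M : RSpace d → F}
    (hM : ContinuousOn M U) : Continuous fun ξ => f ξ • M ξ := by
  refine continuous_of_tsupport fun ξ hξ => ?_
  exact hf.continuousAt.smul (hM.continuousAt (hU.mem_nhds (hfU (tsupport_smul_subset_left f M hξ))))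

theorem integrable_smul_of_tsupport {F : Type*} [NormedAddCommGroup F] [NormedSpace ℝ F]
    [NormedSpace ℂ F] {U : Set (RSpace d)} (hU : IsOpen U)
    {f : RSpace d → ℂ} (hf : Continuous f) (hfc : HasCompactSupport f) (hfU : tsupport f ⊆ U)
    {M : RSpace d → F} (hM : ContinuousOn M U) : Integrable fun ξ => f ξ • M ξ :=
  (continuous_smul_of_tsupport hU hf hfU hM).integrable_of_hasCompactSupport hfc.smul_right

/-- The Fourier transform of the part of the kernel in a shell. -/
noncomputable def shellSymbol (hsm : IsSmoothKernel K) : 𝓢(RSpace d, CSpace d') :=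
  𝓕 ((hasCompactSupport_shellKernel (K := K)).toSchwartzMap (contDiff_shellKernel hsm))

theorem shellSymbol_apply (hsm : IsSmoothKernel K) (ξ : RSpace d) :
    shellSymbol hsm ξ = 𝓕 (shellKernel K) ξ := by
  rw [shellSymbol, SchwartzMap.fourier_coe]
  rfl

theorem integral_fourier_smul_shellKernel (hsm : IsSmoothKernel K) (f : 𝓢(RSpace d, ℂ)) {q : ℝ}
    (hq : 0 < q) : ∫ x, 𝓕 f x • q ^ (-s) • shellKernel K (q⁻¹ • x) =
      ∫ ξ, f ξ • q ^ ((d : ℝ) - s) • shellSymbol hsm (q • ξ) := by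
  have hc := (contDiff_shellKernel hsm).continuous
  have h1 : Integrable fun x : RSpace d => q ^ (-s) • shellKernel K (q⁻¹ • x) := by
    have h2 : Integrable (shellKernel K) :=
      hc.integrable_of_hasCompactSupport hasCompactSupport_shellKernel
    exact (h2.comp_smul (inv_ne_zero hq.ne')).smul (q ^ (-s))
  have h2 := integral_fourier_smul_eq_of_integrable f.integrable h1
  rw [SchwartzMap.fourier_coe, h2]
  refine integral_congr_ae (Eventually.of_forall fun ξ => ?_)
  dsimp only
  have h3 : 𝓕 (fun x : RSpace d => q ^ (-s) • shellKernel K (q⁻¹ • x)) ξ =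
      q ^ (-s) • 𝓕 (fun x : RSpace d => shellKernel K (q⁻¹ • x)) ξ := by
    simp only [Real.fourier_eq]
    rw [← integral_smul]
    exact integral_congr_ae (Eventually.of_forall fun x => smul_comm _ _ _)
  rw [h3, fourier_comp_inv_smul _ hq, smul_smul, shellSymbol_apply, ← Real.rpow_natCast,
    ← Real.rpow_add hq, neg_add_eq_sub]

theorem hasSum_integral_dilate (k : 𝓢(RSpace d, CSpace d')) (b : ℝ) {f : RSpace d → ℂ}
    (hf : Continuous f) (hfc : HasCompactSupport f) (hf0 : tsupport f ⊆ {0}ᶜ) :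
    HasSum (fun j : ℕ => ∫ ξ, f ξ • ((2 : ℝ) ^ j) ^ b • k ((2 : ℝ) ^ j • ξ))
      (∫ ξ, f ξ • ∑' j : ℕ, ((2 : ℝ) ^ j) ^ b • k ((2 : ℝ) ^ j • ξ)) := by
  obtain ⟨p, hp⟩ := exists_nat_gt b
  obtain ⟨S, hS0, hS⟩ := exists_norm_dilate_le k b p
  have hsum : Summable fun j : ℕ => ((2 : ℝ) ^ j) ^ (b - 2 * p) :=
    summable_two_pow_rpow (by have : (0 : ℝ) ≤ p := Nat.cast_nonneg p; linarith)
  have hb : ∀ (j : ℕ) (ξ : RSpace d), ‖f ξ • ((2 : ℝ) ^ j) ^ b • k ((2 : ℝ) ^ j • ξ)‖ ≤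
      (‖f ξ‖ * (((‖ξ‖ ^ 2) ^ p)⁻¹ * S)) * ((2 : ℝ) ^ j) ^ (b - 2 * p) := by
    intro j ξ
    by_cases h : f ξ = 0
    · simp [h]
    · rw [norm_smul, mul_assoc]
      gcongr
      exact hS ξ (hf0 (subset_tsupport _ h)) _ (by positivity)
  refine hasSum_integral_of_dominated_convergence
    (fun j ξ => (‖f ξ‖ * (((‖ξ‖ ^ 2) ^ p)⁻¹ * S)) * ((2 : ℝ) ^ j) ^ (b - 2 * p)) (fun j => ?_)
    (fun j => Eventually.of_forall fun ξ => hb j ξ)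
    (Eventually.of_forall fun ξ => hsum.mul_left _) ?_ (Eventually.of_forall fun ξ => ?_)
  · have := k.continuous
    exact Continuous.aestronglyMeasurable (by fun_prop)
  · simp only [tsum_mul_left]
    refine Integrable.mul_const ?_ _
    have h1 : ContinuousOn (fun ξ : RSpace d => ((‖ξ‖ ^ 2) ^ p)⁻¹ * S) {0}ᶜ := by
      refine ContinuousOn.mul (ContinuousOn.inv₀ (by fun_prop) fun ξ hξ => ?_) continuousOn_const
      exact pow_ne_zero _ (pow_ne_zero _ (norm_ne_zero_iff.2 hξ))
    refine (integrable_smul_of_tsupport isOpen_compl_singleton hf hfc hf0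
      (Complex.continuous_ofReal.comp_continuousOn h1)).norm.congr (Eventually.of_forall fun ξ => ?_)
    simp only [Function.comp_apply, norm_smul, Complex.norm_real]
    rw [Real.norm_of_nonneg (by positivity)]
  · by_cases h : f ξ = 0
    · simp [h, hasSum_zero]
    · refine HasSum.const_smul _ (Summable.hasSum (Summable.of_norm_bounded
        (hsum.mul_left (((‖ξ‖ ^ 2) ^ p)⁻¹ * S)) fun j => ?_))
      exact hS ξ (hf0 (subset_tsupport _ h)) _ (by positivity)

/-- For a test function supported away from 0, the pairing of its Fourier transform with K is
computed twice: from the assumed multiplier, and shell by shell from the decomposition. The two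
symbols agree almost everywhere, hence everywhere off 0 by continuity. -/
theorem multiplier_eqOn_kernelSymbol (hK : KernelBounds s C K) (hsd : s < d)
    (hsm : IsSmoothKernel K) (hm : ContinuousOn m (sphere 0 1)) (h : HasAngularMultiplier s K m) :
    EqOn (fun ξ : RSpace d => (1 / ‖ξ‖ ^ ((d : ℝ) - s)) • m (‖ξ‖⁻¹ • ξ))
      (kernelSymbol ((d : ℝ) - s) K (shellSymbol hsm)) {0}ᶜ := by
  set M := fun ξ : RSpace d => (1 / ‖ξ‖ ^ ((d : ℝ) - s)) • m (‖ξ‖⁻¹ • ξ) with hM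
  set M' := kernelSymbol ((d : ℝ) - s) K (shellSymbol hsm) with hM'
  have hMc : ContinuousOn M {0}ᶜ := continuousOn_angular hm _
  have hMc' : ContinuousOn M' {0}ᶜ := (contDiffOn_kernelSymbol hK hsd _ _).continuousOn
  have hopen : IsOpen ({0}ᶜ : Set (RSpace d)) := isOpen_compl_singleton
  refine Measure.eqOn_open_of_ae_eq (μ := volume) ?_ hopen hMc hMc'
  rw [Filter.EventuallyEq, ae_restrict_iff' hopen.measurableSet]
  have key := hopen.ae_eq_zero_of_integral_contDiff_smul_eq_zero (μ := volume)
    ((hMc.sub hMc').locallyIntegrableOn hopen.measurableSet) fun g hg hgc hg0 => ?_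
  · filter_upwards [key] with ξ hξ h0
    exact sub_eq_zero.1 (hξ h0)
  set f : RSpace d → ℂ := fun ξ => (g ξ : ℂ) with hf
  have hfs : ContDiff ℝ ∞ f := Complex.ofRealCLM.contDiff.comp hg
  have hfc : HasCompactSupport f := hgc.comp_left (g := fun r : ℝ => (r : ℂ)) Complex.ofReal_zero
  have hf0 : tsupport f ⊆ {0}ᶜ := by
    refine subset_trans (closure_mono fun ξ hξ => ?_) hg0
    simpa [hf] using hξ
  have e1 : ∀ ξ, g ξ • (M - M') ξ = f ξ • M ξ - f ξ • M' ξ := fun ξ => by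
    simp only [hf, Complex.coe_smul, Pi.sub_apply, smul_sub]
  simp only [e1]
  rw [integral_sub (integrable_smul_of_tsupport hopen hfs.continuous hfc hf0 hMc)
    (integrable_smul_of_tsupport hopen hfs.continuous hfc hf0 hMc'), sub_eq_zero]
  set F : 𝓢(RSpace d, ℂ) := hfc.toSchwartzMap hfs with hF
  obtain ⟨A, hA0, hA⟩ := (𝓕 F).decay 0 0
  simp only [pow_zero, one_mul, norm_iteratedFDeriv_zero] at hA
  have l1 := integral_smul_sum_shellKernel_tendsto hK hsd hsm hA (𝓕 F).integrable
  rw [h F] at l1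
  have hlow : Continuous (𝓕 fun x : RSpace d => unitBump d x • K x) :=
    (Real.contDiff_fourier (N := 0) fun n _ => integrable_unitBump_smul hK hsd n).continuous
  have hlowi : Integrable fun x : RSpace d => unitBump d x • K x := by
    have h1 := integrable_unitBump_smul hK hsd 0
    simp only [pow_zero, one_mul] at h1
    exact (integrable_norm_iff ((unitBump d).continuous.aestronglyMeasurable.smul
      hK.measurable.aestronglyMeasurable)).1 h1
  have h2 := hasSum_integral_dilate (shellSymbol hsm) ((d : ℝ) - s) hfs.continuous hfc hf0
  have l2 := (h2.tendsto_sum_nat).const_add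
    (∫ ξ, f ξ • 𝓕 (fun x : RSpace d => unitBump d x • K x) ξ)
  have hlowe : ∫ x, 𝓕 F x • unitBump d x • K x =
      ∫ ξ, f ξ • 𝓕 (fun x : RSpace d => unitBump d x • K x) ξ := by
    rw [SchwartzMap.fourier_coe, integral_fourier_smul_eq_of_integrable F.integrable hlowi]
    rfl
  have hj : ∀ j : ℕ, ∫ x, 𝓕 F x • ((2 : ℝ) ^ j) ^ (-s) • shellKernel K (((2 : ℝ) ^ j)⁻¹ • x) =
      ∫ ξ, f ξ • ((2 : ℝ) ^ j) ^ ((d : ℝ) - s) • shellSymbol hsm ((2 : ℝ) ^ j • ξ) := fun j =>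
    integral_fourier_smul_shellKernel hsm F (by positivity)
  simp only [hlowe, hj] at l1
  have h4 := tendsto_nhds_unique l1 l2
  have hi1 : Integrable fun ξ => f ξ • 𝓕 (fun x : RSpace d => unitBump d x • K x) ξ :=
    integrable_smul_of_tsupport hopen hfs.continuous hfc hf0 hlow.continuousOn
  have hi2 : Integrable fun ξ => f ξ •
      ∑' j : ℕ, ((2 : ℝ) ^ j) ^ ((d : ℝ) - s) • shellSymbol hsm ((2 : ℝ) ^ j • ξ) :=
    integrable_smul_of_tsupport hopen hfs.continuous hfc hf0 fun ξ hξ =>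
      (contDiffAt_tsum_dilate _ _ hξ).continuousAt.continuousWithinAt
  rw [← integral_add hi1 hi2] at h4
  refine h4.trans (integral_congr_ae (Eventually.of_forall fun ξ => ?_))
  exact (smul_add _ _ _).symm

/-- The angular part is only assumed continuous; its smoothness comes from that of K. It is needed
so that division by the multiplier preserves smooth test functions. -/
theorem contDiffOn_multiplier (hK : KernelBounds s C K) (hsd : s < d)
    (hsm : IsSmoothKernel K) (hm : ContinuousOn m (sphere 0 1)) (h : HasAngularMultiplier s K m) :
    ContDiffOn ℝ ∞ (fun ξ : RSpace d => (1 / ‖ξ‖ ^ ((d : ℝ) - s)) • m (‖ξ‖⁻¹ • ξ)) {0}ᶜ :=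
  (contDiffOn_kernelSymbol hK hsd _ _).congr (multiplier_eqOn_kernelSymbol hK hsd hsm hm h)

end Multiplier

/-! ### Inverting convolution with the kernel -/

section Deconvolution

variable {d d' : ℕ} {s C : ℝ} {K m : RSpace d → CSpace d'}

theorem contDiff_mul_of_tsupport {U : Set (RSpace d)} (hU : IsOpen U) {f h : RSpace d → ℂ}
    (hf : ContDiff ℝ ∞ f) (hfU : tsupport f ⊆ U) (hh : ContDiffOn ℝ ∞ h U) :
    ContDiff ℝ ∞ fun ξ => f ξ * h ξ := by
  rw [contDiff_iff_contDiffAt]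
  intro ξ
  by_cases hξ : ξ ∈ tsupport f
  · exact hf.contDiffAt.mul ((hh ξ (hfU hξ)).contDiffAt (hU.mem_nhds (hfU hξ)))
  · refine (contDiffAt_const (c := (0 : ℂ))).congr_of_eventuallyEq ?_
    filter_upwards [(isClosed_tsupport f).isOpen_compl.mem_nhds hξ] with η hη
    rw [image_eq_zero_of_notMem_tsupport hη, zero_mul]

theorem contDiffOn_conj_div_norm_sq {U : Set (RSpace d)} {M : RSpace d → CSpace d'}
    (hM : ContDiffOn ℝ ∞ M U) (h0 : ∀ ξ ∈ U, M ξ ≠ 0) (j : Fin d') :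
    ContDiffOn ℝ ∞ (fun ξ => (starRingEnd ℂ (M ξ j)) * (((‖M ξ‖ ^ 2)⁻¹ : ℝ) : ℂ)) U := by
  have h1 : ContDiffOn ℝ ∞ (fun ξ => M ξ j) U :=
    ((EuclideanSpace.proj j : CSpace d' →L[ℂ] ℂ).restrictScalars ℝ).contDiff.comp_contDiffOn hM
  have h2 : ContDiffOn ℝ ∞ (fun ξ => starRingEnd ℂ (M ξ j)) U :=
    Complex.conjCLE.contDiff.comp_contDiffOn h1
  have h3 : ContDiffOn ℝ ∞ (fun ξ => (‖M ξ‖ ^ 2)⁻¹) U :=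
    (hM.norm_sq ℝ).inv fun ξ hξ => pow_ne_zero _ (norm_ne_zero_iff.2 (h0 ξ hξ))
  exact h2.mul (Complex.ofRealCLM.contDiff.comp_contDiffOn h3)

theorem sum_conj_div_norm_sq {v : CSpace d'} (hv : v ≠ 0) :
    ∑ j, (starRingEnd ℂ (v j)) * (((‖v‖ ^ 2)⁻¹ : ℝ) : ℂ) * v j = 1 := by
  have h1 : (‖v‖ ^ 2 : ℝ) = ∑ j, ‖v j‖ ^ 2 := EuclideanSpace.norm_sq_eq v
  have h2 : ∀ j, (starRingEnd ℂ (v j)) * (((‖v‖ ^ 2)⁻¹ : ℝ) : ℂ) * v j =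
      (((‖v‖ ^ 2)⁻¹ : ℝ) : ℂ) * ((‖v j‖ ^ 2 : ℝ) : ℂ) := by
    intro j
    rw [Complex.ofReal_pow, ← Complex.conj_mul']
    ring
  have h3 : (‖v‖ ^ 2 : ℝ) ≠ 0 := pow_ne_zero _ (norm_ne_zero_iff.2 hv)
  rw [Finset.sum_congr rfl fun j _ => h2 j, ← Finset.mul_sum, ← Complex.ofReal_sum, ← h1,
    ← Complex.ofReal_mul, inv_mul_cancel₀ h3, Complex.ofReal_one]

theorem contDiff_fourierChar_inner (y : RSpace d) :
    ContDiff ℝ ∞ fun ξ : RSpace d => (Real.fourierChar (inner ℝ ξ y) : ℂ) := by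
  simp only [Real.fourierChar_apply]
  refine Complex.contDiff_exp.comp (ContDiff.mul (Complex.ofRealCLM.contDiff.comp ?_) contDiff_const)
  exact contDiff_const.mul (contDiff_id.inner ℝ contDiff_const)

theorem fourier_mul_fourierChar (f : 𝓢(RSpace d, ℂ)) (y x : RSpace d) :
    𝓕 (fun ξ : RSpace d => (Real.fourierChar (inner ℝ ξ y) : ℂ) * f ξ) x = 𝓕⁻ f (y - x) := by
  rw [SchwartzMap.fourierInv_coe, Real.fourier_eq, Real.fourierInv_eq]
  refine integral_congr_ae (Eventually.of_forall fun ξ => ?_)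
  dsimp only
  rw [inner_sub_right, sub_eq_add_neg, AddChar.map_add_eq_mul, Circle.smul_def, Circle.smul_def,
    Circle.coe_mul, smul_eq_mul, smul_eq_mul]
  ring

/-- With M the multiplier, the functions g conj(M_j)/|M|² are smooth with compact support off 0, and
multiplied by M_j they add up to g. Their inverse Fourier transforms are the ψ_j; these have mean
zero because g vanishes at the origin. -/
theorem exists_convolution_eq (hK : KernelBounds s C K) (hsd : s < d) (hsm : IsSmoothKernel K)
    (hnd : IsNondegenerate s K) {g : RSpace d → ℂ} (hg : ContDiff ℝ ∞ g) (hgc : HasCompactSupport g)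
    (hg0 : tsupport g ⊆ {0}ᶜ) :
    ∃ ψ : Fin d' → 𝓢(RSpace d, ℂ), (∀ j, ∫ x, ψ j x = 0) ∧
      ∀ y, ∑ j, (∫ x, ψ j x • K (y - x)) j = 𝓕⁻ g y := by
  obtain ⟨m, hmc, hm, hm0⟩ := hnd
  set M := fun ξ : RSpace d => (1 / ‖ξ‖ ^ ((d : ℝ) - s)) • m (‖ξ‖⁻¹ • ξ) with hM
  have hMs : ContDiffOn ℝ ∞ M {0}ᶜ := contDiffOn_multiplier hK hsd hsm hmc hm
  have hM0 : ∀ ξ ∈ ({0}ᶜ : Set (RSpace d)), M ξ ≠ 0 := by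
    intro ξ hξ
    have h1 : 0 < ‖ξ‖ := norm_pos_iff.2 hξ
    refine smul_ne_zero (one_div_ne_zero (Real.rpow_pos_of_pos h1 _).ne') (hm0 _ ?_)
    simp [norm_smul, inv_mul_cancel₀ h1.ne']
  have hopen : IsOpen ({0}ᶜ : Set (RSpace d)) := isOpen_compl_singleton
  set q : Fin d' → RSpace d → ℂ := fun j ξ =>
    g ξ * ((starRingEnd ℂ (M ξ j)) * (((‖M ξ‖ ^ 2)⁻¹ : ℝ) : ℂ)) with hq
  have hqs : ∀ j, ContDiff ℝ ∞ (q j) := fun j =>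
    contDiff_mul_of_tsupport hopen hg hg0 (contDiffOn_conj_div_norm_sq hMs hM0 j)
  have hqc : ∀ j, HasCompactSupport (q j) := fun j => hgc.mul_right
  set Q : Fin d' → 𝓢(RSpace d, ℂ) := fun j => (hqc j).toSchwartzMap (hqs j) with hQ
  have hQq : ∀ j ξ, Q j ξ = q j ξ := fun j ξ => rfl
  have hsum : ∀ ξ, ∑ j, q j ξ * M ξ j = g ξ := by
    intro ξ
    by_cases h : g ξ = 0
    · simp [hq, h]
    · have h2 := sum_conj_div_norm_sq (hM0 ξ (hg0 (subset_tsupport _ h)))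
      simp only [hq, mul_assoc] at h2 ⊢
      rw [← Finset.mul_sum, h2, mul_one]
  refine ⟨fun j => 𝓕⁻ (Q j), fun j => ?_, fun y => ?_⟩
  · have h1 : 𝓕 (𝓕⁻ (Q j)) = Q j := FourierTransform.fourier_fourierInv_eq _
    have h2 : 𝓕 (𝓕⁻ (Q j)) 0 = ∫ x, 𝓕⁻ (Q j) x := by
      rw [SchwartzMap.fourier_coe, Real.fourier_eq]
      simp
    rw [← h2, h1, hQq, hq]
    have : g 0 = 0 := image_eq_zero_of_notMem_tsupport fun h => hg0 h rfl
    simp [this]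
  · set e : RSpace d → ℂ := fun ξ => (Real.fourierChar (inner ℝ ξ y) : ℂ) with he
    have hes : ContDiff ℝ ∞ e := contDiff_fourierChar_inner y
    have hEs : ∀ j, ContDiff ℝ ∞ fun ξ => e ξ * q j ξ := fun j => hes.mul (hqs j)
    have hEc : ∀ j, HasCompactSupport fun ξ => e ξ * q j ξ := fun j => (hqc j).mul_left
    have hE0 : ∀ j, tsupport (fun ξ => e ξ * q j ξ) ⊆ {0}ᶜ := fun j =>
      ((tsupport_mul_subset_right).trans tsupport_mul_subset_left).trans hg0
    have h1 : ∀ j, ∫ x, 𝓕⁻ (Q j) x • K (y - x) = ∫ ξ, (e ξ * q j ξ) • M ξ := by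
      intro j
      -- After x ↦ y - x the Schwartz factor is the Fourier transform of a modulated q_j, to which
      -- the multiplier identity applies.
      rw [← integral_sub_left_eq_self (fun x => 𝓕⁻ (Q j) x • K (y - x)) volume y]
      refine Eq.trans ?_ (hm ((hEc j).toSchwartzMap (hEs j)))
      refine integral_congr_ae (Eventually.of_forall fun x => ?_)
      dsimp only
      rw [sub_sub_cancel, ← fourier_mul_fourierChar]
      rfl
    have h2 : ∀ j, (∫ ξ, (e ξ * q j ξ) • M ξ) j = ∫ ξ, e ξ * (q j ξ * M ξ j) := by
      intro j
      have h3 := (EuclideanSpace.proj j : CSpace d' →L[ℂ] ℂ).integral_comp_comm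
        (integrable_smul_of_tsupport hopen (hEs j).continuous (hEc j) (hE0 j) hMs.continuousOn)
      refine h3.symm.trans (integral_congr_ae (Eventually.of_forall fun ξ => ?_))
      simp [mul_assoc]
    have h4 : ∀ j, Integrable fun ξ => e ξ * (q j ξ * M ξ j) := by
      intro j
      have h5 : ContinuousOn (fun ξ => M ξ j) {0}ᶜ :=
        (EuclideanSpace.proj j : CSpace d' →L[ℂ] ℂ).continuous.comp_continuousOn
          hMs.continuousOn
      refine (integrable_smul_of_tsupport hopen (hEs j).continuous (hEc j) (hE0 j) h5).congr
        (Eventually.of_forall fun ξ => ?_)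
      simp [mul_assoc]
    simp only [h1, h2]
    rw [← integral_finsetSum _ fun j _ => h4 j, Real.fourierInv_eq]
    refine integral_congr_ae (Eventually.of_forall fun ξ => ?_)
    dsimp only
    rw [← Finset.mul_sum, hsum, Circle.smul_def, smul_eq_mul]

end Deconvolution

/-! ### Averages of the truncated potential against Schwartz functions -/

section Averages

variable {d d' : ℕ} {s C Λ : ℝ} {K : RSpace d → CSpace d'}
  {μ : Measure (RSpace d)} {φ g : RSpace d → ℂ}

theorem exists_norm_schwartz_le (ψ : 𝓢(RSpace d, ℂ)) (n : ℕ) :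
    ∃ A, 0 ≤ A ∧ ∀ x, ‖ψ x‖ ≤ A * (1 + ‖x‖) ^ (-(n : ℝ)) := by
  refine ⟨2 ^ n * (Finset.Iic (n, 0)).sup (fun m => SchwartzMap.seminorm ℝ m.1 m.2) ψ,
    by positivity, fun x => ?_⟩
  have h := SchwartzMap.one_add_le_sup_seminorm_apply (𝕜 := ℝ) (m := (n, 0)) le_rfl le_rfl ψ x
  rw [norm_iteratedFDeriv_zero] at h
  rw [Real.rpow_neg (by positivity), Real.rpow_natCast, ← div_eq_mul_inv,
    le_div_iff₀ (by positivity), mul_comm]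
  exact h

theorem IsNice.integrable_one_add_norm (hΛ : 0 < Λ) (hμ : IsNice s Λ μ) {r : ℝ}
    (hr0 : 0 ≤ r) (hr : s < r) : Integrable (fun x => (1 + ‖x‖) ^ (-r)) μ := by
  refine ⟨(Measurable.aestronglyMeasurable (by fun_prop)), ?_⟩
  rw [HasFiniteIntegral, ← lintegral_add_compl _ (measurableSet_ball (x := (0 : RSpace d)) (ε := 1))]
  refine ENNReal.add_lt_top.2 ⟨?_, ?_⟩
  · refine (setLIntegral_mono' (g := fun _ => 1) measurableSet_ball fun x _ => ?_).trans_lt ?_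
    · rw [Real.enorm_of_nonneg (by positivity), ← ENNReal.ofReal_one]
      refine ENNReal.ofReal_le_ofReal (Real.rpow_le_one_of_one_le_of_nonpos ?_ (by linarith))
      linarith [norm_nonneg x]
    · rw [setLIntegral_one]
      exact (hμ 0 1 one_pos).trans_lt ENNReal.ofReal_lt_top
  · refine lt_of_le_of_lt (setLIntegral_mono' measurableSet_ball.compl fun x hx => ?_)
      ((hμ.lintegral_compl_ball_le hΛ hr one_pos 0).trans_lt ENNReal.ofReal_lt_top)
    rw [mem_compl_iff, mem_ball_zero_iff, not_lt] at hx
    rw [Real.enorm_of_nonneg (by positivity), sub_zero, ← ofReal_norm,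
      ENNReal.ofReal_rpow_of_pos (by linarith)]
    exact ENNReal.ofReal_le_ofReal
      (Real.rpow_le_rpow_of_nonpos (by linarith) (by linarith) (by linarith))

theorem norm_integral_cutoff_le (hK : KernelBounds s C K) (hΛ : 0 < Λ) (hμ : IsNice s Λ μ)
    {R : ℝ} (hR : 0 < R) {x : RSpace d} (hx : HasPotential s μ x) :
    ‖∫ y, cutoff R y • K (y - x) ∂μ‖ ≤ (potential s μ x 1).toReal + Λ * (2 * R) ^ s := by
  have h1 : ∫⁻ y, ‖cutoff R y • K (y - x)‖ₑ ∂μ ≤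
      potential s μ x 1 + ENNReal.ofReal (Λ * (2 * R) ^ s) := by
    rw [← lintegral_add_compl _ (measurableSet_ball (x := x) (ε := 1))]
    have hc : ∀ y : RSpace d, ‖cutoff R y‖ₑ ≤ 1 := fun y => by
      rw [← ofReal_norm, ← ENNReal.ofReal_one]
      exact ENNReal.ofReal_le_ofReal (cutoff_norm_le R y)
    refine add_le_add (lintegral_mono fun y => ?_) ?_
    · rw [enorm_smul]
      exact (mul_le_mul' (hc y) (hK.size _)).trans (one_mul _).le
    · refine le_trans ?_ (hμ 0 (2 * R) (by positivity))
      rw [← lintegral_indicator_one measurableSet_ball]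
      refine le_trans (setLIntegral_mono' measurableSet_ball.compl fun y hy => ?_)
        (setLIntegral_le_lintegral (ball x 1)ᶜ _)
      rw [mem_compl_iff, mem_ball, not_lt, dist_eq_norm] at hy
      by_cases h : y ∈ ball (0 : RSpace d) (2 * R)
      · rw [indicator_of_mem h, enorm_smul, Pi.one_apply]
        refine mul_le_one' (hc y) ?_
        rw [← ofReal_norm, ← ENNReal.ofReal_one]
        refine ENNReal.ofReal_le_ofReal ?_
        have := hK.norm_le_of_le one_pos hy
        simpa using this
      · rw [mem_ball_zero_iff, not_lt] at h
        rw [cutoff_eq_zero hR (by linarith), zero_smul, enorm_zero]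
        exact zero_le
  have h2 := (enorm_integral_le_lintegral_enorm _).trans h1
  rw [← ofReal_norm, ← ENNReal.ofReal_toReal (show potential s μ x 1 ≠ ⊤ from hx.ne),
    ← ENNReal.ofReal_add ENNReal.toReal_nonneg (by positivity)] at h2
  exact (ENNReal.ofReal_le_ofReal_iff (add_nonneg ENNReal.toReal_nonneg (by positivity))).1 h2

theorem one_add_norm_rpow_le {r : ℝ} (hr : 0 ≤ r) {x y : RSpace d} (h : ‖x - y‖ ≤ 1) :
    (1 + ‖x‖) ^ (-r) ≤ 2 ^ r * (1 + ‖y‖) ^ (-r) := by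
  have h1 : 1 + ‖y‖ ≤ 2 * (1 + ‖x‖) := by
    have := norm_sub_norm_le y x
    rw [norm_sub_rev] at this
    linarith [norm_nonneg x]
  have h2 := Real.rpow_le_rpow_of_nonpos (by positivity) h1 (neg_nonpos.2 hr)
  rw [Real.mul_rpow (by norm_num) (by positivity), Real.rpow_neg (by norm_num : (0 : ℝ) ≤ 2),
    inv_mul_le_iff₀ (by positivity)] at h2
  exact h2

theorem measurable_potential [SFinite μ] : Measurable fun x => potential s μ x 1 := by
  have h1 : IsOpen {P : RSpace d × RSpace d | P.2 ∈ ball P.1 1} := by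
    simp only [mem_ball]
    exact isOpen_lt (by fun_prop) continuous_const
  have h2 : Measurable ({P : RSpace d × RSpace d | P.2 ∈ ball P.1 1}.indicator
      fun P => ‖P.2 - P.1‖ₑ ^ (-s)) := Measurable.indicator (by fun_prop) h1.measurableSet
  convert h2.lintegral_prod_right' (ν := μ) using 2 with x
  rw [potential, ← lintegral_indicator measurableSet_ball]
  rfl

/-- By Tonelli, x is integrated first: on a unit ball about y the weight is comparable to its value
at y, which is μ-integrable for r > s. This is part of the majorant for dominated convergence. -/
theorem lintegral_mul_potential_lt_top (hs : 0 < s) (hsd : s < d) (hΛ : 0 < Λ) (hμ : IsNice s Λ μ)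
    {r : ℝ} (hr0 : 0 ≤ r) (hr : s < r) :
    ∫⁻ x : RSpace d, ENNReal.ofReal ((1 + ‖x‖) ^ (-r)) * potential s μ x 1 < ⊤ := by
  have := hμ.isLocallyFinite
  set U := {P : RSpace d × RSpace d | P.2 ∈ ball P.1 1} with hU
  have hUm : MeasurableSet U := by
    have : IsOpen U := by
      simp only [hU, mem_ball]
      exact isOpen_lt (by fun_prop) continuous_const
    exact this.measurableSet
  set F : RSpace d × RSpace d → ENNReal := U.indicator fun P =>
    ENNReal.ofReal ((1 + ‖P.1‖) ^ (-r)) * ‖P.2 - P.1‖ₑ ^ (-s) with hF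
  have hFm : Measurable F := Measurable.indicator (by fun_prop) hUm
  have e1 : ∀ x, ∫⁻ y, F (x, y) ∂μ = ENNReal.ofReal ((1 + ‖x‖) ^ (-r)) * potential s μ x 1 := by
    intro x
    rw [potential, ← lintegral_const_mul _ (by fun_prop), ← lintegral_indicator measurableSet_ball]
    rfl
  have hvol : ∀ z : RSpace d, ∫⁻ x in ball z 1, ‖x - z‖ₑ ^ (-s) ≤
      ENNReal.ofReal (growthConst s d * volume.real (ball (0 : RSpace d) 1) * 1 ^ ((d : ℝ) - s)) :=
    fun z => lintegral_ball_rpow_le (by linarith) hsd measureReal_nonneg one_pos volume z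
      fun t ht _ => volume_ball_le z ht
  set c := growthConst s d * volume.real (ball (0 : RSpace d) 1) * 1 ^ ((d : ℝ) - s)
  rw [← lintegral_congr e1, lintegral_lintegral_swap
    (show AEMeasurable (Function.uncurry fun x y => F (x, y)) _ from hFm.aemeasurable)]
  refine lt_of_le_of_lt (lintegral_mono (g := fun y =>
    ENNReal.ofReal (2 ^ r * (1 + ‖y‖) ^ (-r)) * ENNReal.ofReal c) fun y => ?_) ?_
  · refine le_trans ?_ (mul_le_mul_right (hvol y) _)
    rw [← lintegral_const_mul _ (by fun_prop), ← lintegral_indicator measurableSet_ball]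
    refine lintegral_mono fun x => ?_
    by_cases hx : x ∈ ball y 1
    · rw [indicator_of_mem hx, hF, indicator_of_mem (show (x, y) ∈ U from mem_ball_comm.1 hx)]
      refine mul_le_mul' (ENNReal.ofReal_le_ofReal (one_add_norm_rpow_le hr0 ?_)) ?_
      · rw [mem_ball, dist_eq_norm] at hx
        exact hx.le
      · rw [← enorm_neg, neg_sub]
    · rw [indicator_of_notMem hx, hF,
        indicator_of_notMem (show (x, y) ∉ U from fun h => hx (mem_ball_comm.1 h))]
  · rw [lintegral_mul_const _ (by fun_prop)]
    refine ENNReal.mul_lt_top ?_ ENNReal.ofReal_lt_top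
    exact ((hμ.integrable_one_add_norm hΛ hr0 hr).const_mul (2 ^ r)).lintegral_lt_top

theorem integrable_prod_smul_kernel (hK : KernelBounds s C K) (hsd : s < d)
    [IsLocallyFiniteMeasure μ] (hg : IsLip0 g) (ψ : 𝓢(RSpace d, ℂ)) :
    Integrable (fun P : RSpace d × RSpace d => g P.1 • ψ P.2 • K (P.1 - P.2))
      (μ.prod volume) := by
  have hgm := hg.continuous.measurable
  have hψm := ψ.continuous.measurable
  have hKm := hK.measurable
  have hm : Measurable fun P : RSpace d × RSpace d => g P.1 • ψ P.2 • K (P.1 - P.2) := by fun_prop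
  refine ⟨hm.aestronglyMeasurable, ?_⟩
  obtain ⟨A, hA0, hA⟩ := ψ.decay 0 0
  simp only [pow_zero, one_mul, norm_iteratedFDeriv_zero] at hA
  set D := ENNReal.ofReal A * ENNReal.ofReal (growthConst s d * volume.real (ball (0 : RSpace d) 1)) +
    ∫⁻ x, ‖ψ x‖ₑ with hD
  have hDt : D < ⊤ := ENNReal.add_lt_top.2 ⟨ENNReal.mul_lt_top ENNReal.ofReal_lt_top
    ENNReal.ofReal_lt_top, ψ.integrable.hasFiniteIntegral⟩
  rw [HasFiniteIntegral, lintegral_prod _ hm.enorm.aemeasurable]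
  refine lt_of_le_of_lt (lintegral_mono (g := fun y => ‖g y‖ₑ * D) fun y => ?_) ?_
  · simp only [enorm_smul]
    rw [lintegral_const_mul _ (by fun_prop)]
    gcongr
    refine le_trans (lintegral_mono fun x => ?_) (lintegral_mul_rpow_le hK.s_pos hsd
      (f := fun x => ‖ψ x‖ₑ) (A := ENNReal.ofReal A) (fun x => ?_) y)
    · dsimp only
      rw [← enorm_neg (x - y), neg_sub]
      gcongr
      exact hK.size _
    · rw [← ofReal_norm]
      exact ENNReal.ofReal_le_ofReal (hA x)
  · rw [lintegral_mul_const _ (by fun_prop)]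
    exact ENNReal.mul_lt_top (hg.integrable (μ := μ)).hasFiniteIntegral hDt

/-- Fubini; the pairing in `mainPart` does not depend on x and disappears because ψ has mean zero.
-/
theorem integral_smul_convolution (hK : KernelBounds s C K) (hsd : s < d)
    [IsLocallyFiniteMeasure μ] (hg : IsLip0 g) {ψ : 𝓢(RSpace d, ℂ)} (hψ : ∫ x, ψ x = 0) (φ : RSpace d → ℂ) :
    ∫ y, g y • (∫ x, ψ x • K (y - x)) ∂μ = ∫ x, ψ x • mainPart K μ φ g x := by
  have hint := integrable_prod_smul_kernel (μ := μ) hK hsd hg ψ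
  have h1 := integral_integral_swap (f := fun y x => g y • ψ x • K (y - x)) hint
  have h2 : Integrable fun x => ψ x • ∫ y, g y • K (y - x) ∂μ := by
    refine hint.integral_prod_right.congr (Eventually.of_forall fun x => ?_)
    dsimp only
    rw [← integral_smul]
    exact integral_congr_ae (Eventually.of_forall fun y => smul_comm _ _ _)
  simp only [mainPart, smul_sub]
  rw [integral_sub h2 (ψ.integrable.smul_const _), integral_smul_const, hψ, zero_smul, sub_zero]
  simp only [← integral_smul]
  rw [h1]
  exact integral_congr_ae (Eventually.of_forall fun x =>
    integral_congr_ae (Eventually.of_forall fun y => smul_comm _ _ _))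

end Averages

/-! ### Consequences of T̄(1) = 0 for the Fourier transform of the measure -/

section Averages

variable {d d' : ℕ} {s C Λ : ℝ} {K : RSpace d → CSpace d'}
  {μ : Measure (RSpace d)} {φ g : RSpace d → ℂ}

/-- A majorant uniform in R. When R is large compared with |x|, the vanishing of T̄(1) at x makes
the truncation a tail. Otherwise R is at most a multiple of 1 + |x|, and comparison with the fixed
point x₀, where the truncations are bounded, permits crude estimates of the potential integrals. -/
theorem exists_norm_mainPart_le (hK : KernelBounds s C K) (hΛ : 0 < Λ) (hμ : IsNice s Λ μ)
    (hφ : IsLip0 φ) (hφ1 : ∫ y, φ y ∂μ = 1) {x₀ : RSpace d} (hx₀ : HasPotential s μ x₀)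
    (h₀ : Tbar K μ φ x₀ = 0) : ∃ A R₀ : ℝ, 0 ≤ A ∧ ∀ R, R₀ ≤ R → ∀ x, HasPotential s μ x →
      Tbar K μ φ x = 0 → ‖mainPart K μ φ (cutoff R) x‖ ≤
        (potential s μ x 1).toReal + A * (1 + ‖x‖) ^ (s + 1) := by
  have hs := hK.s_pos
  obtain ⟨ρ, hρ, hφρ⟩ := hφ.exists_radius
  obtain ⟨B, hB, hφB⟩ := hφ.exists_bound
  have h1 := tendsto_mainPart_cutoff hK hΛ hμ hx₀ hφ hφ1 cutoff 0 isCut_cutoff_sub_zero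
  rw [h₀] at h1
  obtain ⟨R₁, hR₁⟩ := eventually_atTop.1 (h1.norm.eventually_le_const (by simp : ‖(0 : CSpace d')‖ < 1))
  set T := tailConst s C Λ
  set P₀ := (potential s μ x₀ 1).toReal with hP₀
  have hP₀0 : 0 ≤ P₀ := ENNReal.toReal_nonneg
  refine ⟨|T| * B * (ρ + 1) ^ (s + 1) + (P₀ + 1 + 2 * Λ * (4 * (ρ + 1)) ^ s), max R₁ 1,
    by positivity, fun R hR x hx hTx => ?_⟩
  have hR1 : 1 ≤ R := (le_max_right _ _).trans hR
  have hR0 : 0 < R := by linarith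
  have hxn := norm_nonneg x
  have hρx : ρ + ‖x‖ ≤ (ρ + 1) * (1 + ‖x‖) := by nlinarith
  have hP : 0 ≤ (potential s μ x 1).toReal := ENNReal.toReal_nonneg
  rcases le_or_gt (2 * (ρ + ‖x‖)) R with hc | hc
  · have h2 := norm_Tbar_sub_mainPart_le hK hΛ hμ (by positivity) hB.le hc (by linarith) hx hφ hφB
      (fun y hy => hφρ y (by linarith)) hφ1 (isCut_cutoff hR0)
    rw [hTx, zero_sub, norm_neg] at h2
    have h3 : T * B * (ρ + ‖x‖) ^ (s + 1) / R ≤ |T| * B * ((ρ + 1) ^ (s + 1) * (1 + ‖x‖) ^ (s + 1)) := by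
      rw [← Real.mul_rpow (by positivity) (by positivity)]
      refine (div_le_div_of_nonneg_right (b := |T| * B * (ρ + ‖x‖) ^ (s + 1)) ?_ hR0.le).trans
        ((div_le_self (by positivity) hR1).trans ?_)
      · gcongr
        exact le_abs_self T
      · gcongr
    have h4 : 0 ≤ (P₀ + 1 + 2 * Λ * (4 * (ρ + 1)) ^ s) * (1 + ‖x‖) ^ (s + 1) := by positivity
    linarith
  · have h2 := norm_integral_cutoff_le hK hΛ hμ hR0 hx
    have h3 := norm_integral_cutoff_le hK hΛ hμ hR0 hx₀
    have h4 := hR₁ R ((le_max_left _ _).trans hR)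
    have h5 : mainPart K μ φ (cutoff R) x = ∫ y, cutoff R y • K (y - x) ∂μ -
        (∫ y, cutoff R y • K (y - x₀) ∂μ - mainPart K μ φ (cutoff R) x₀) := by
      simp only [mainPart]
      abel
    have h6 : ‖mainPart K μ φ (cutoff R) x‖ ≤
        (potential s μ x 1).toReal + (P₀ + 1 + 2 * Λ * (2 * R) ^ s) := by
      rw [h5]
      have h7 := norm_sub_le (∫ y, cutoff R y • K (y - x) ∂μ)
        (∫ y, cutoff R y • K (y - x₀) ∂μ - mainPart K μ φ (cutoff R) x₀)
      have h8 := norm_sub_le (∫ y, cutoff R y • K (y - x₀) ∂μ) (mainPart K μ φ (cutoff R) x₀)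
      linarith
    have h9 : (2 * R) ^ s ≤ (4 * (ρ + 1)) ^ s * (1 + ‖x‖) ^ (s + 1) := by
      calc (2 * R) ^ s ≤ (4 * (ρ + 1) * (1 + ‖x‖)) ^ s :=
            Real.rpow_le_rpow (by positivity) (by linarith) hs.le
        _ = (4 * (ρ + 1)) ^ s * (1 + ‖x‖) ^ s := Real.mul_rpow (by positivity) (by positivity)
        _ ≤ _ := by
            gcongr
            · linarith
            · linarith
    have h10 : 1 ≤ (1 + ‖x‖) ^ (s + 1) := Real.one_le_rpow (by linarith) (by linarith)
    have h11 : P₀ + 1 + 2 * Λ * (2 * R) ^ s ≤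
        (P₀ + 1 + 2 * Λ * (4 * (ρ + 1)) ^ s) * (1 + ‖x‖) ^ (s + 1) := by
      have h12 : P₀ + 1 ≤ (P₀ + 1) * (1 + ‖x‖) ^ (s + 1) :=
        le_mul_of_one_le_right (by positivity) h10
      have h13 : 2 * Λ * (2 * R) ^ s ≤ 2 * Λ * ((4 * (ρ + 1)) ^ s * (1 + ‖x‖) ^ (s + 1)) := by gcongr
      linarith
    have h14 : 0 ≤ |T| * B * (ρ + 1) ^ (s + 1) * (1 + ‖x‖) ^ (s + 1) := by positivity
    linarith

theorem aestronglyMeasurable_smul_mainPart (hK : KernelBounds s C K) (hsd : s < d)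
    [IsLocallyFiniteMeasure μ] (hg : IsLip0 g) (ψ : 𝓢(RSpace d, ℂ)) (φ : RSpace d → ℂ) :
    AEStronglyMeasurable (fun x => ψ x • mainPart K μ φ g x) := by
  have h := (integrable_prod_smul_kernel (μ := μ) hK hsd hg ψ).integral_prod_right.1.sub
    (ψ.continuous.aestronglyMeasurable.smul_const (pairing K μ φ g))
  refine h.congr (Eventually.of_forall fun x => ?_)
  simp only [mainPart, smul_sub, Pi.sub_apply, ← integral_smul]
  congr 1
  exact integral_congr_ae (Eventually.of_forall fun y => smul_comm _ _ _)

theorem tendsto_integral_smul_mainPart (hK : KernelBounds s C K) (hsd : s < d) (hΛ : 0 < Λ)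
    (hμ : IsNice s Λ μ) (hφ : IsLip0 φ) (hφ1 : ∫ y, φ y ∂μ = 1)
    (h0 : ∀ᵐ x ∂volume, Tbar K μ φ x = 0) (ψ : 𝓢(RSpace d, ℂ)) :
    Tendsto (fun R => ∫ x, ψ x • mainPart K μ φ (cutoff R) x) atTop (𝓝 0) := by
  have := hμ.isLocallyFinite
  have hs := hK.s_pos
  have hpot := ae_hasPotential (μ := μ) hs hsd
  obtain ⟨x₀, hx₀, hTx₀⟩ := (hpot.and h0).exists
  obtain ⟨A, R₀, hA, hR₀⟩ := exists_norm_mainPart_le hK hΛ hμ hφ hφ1 hx₀ hTx₀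
  obtain ⟨n, hn⟩ := exists_nat_gt (s + 1 + d)
  obtain ⟨B, hB0, hB⟩ := exists_norm_schwartz_le ψ n
  have hd0 : (0 : ℝ) ≤ d := Nat.cast_nonneg d
  have hi1 : Integrable fun x : RSpace d => (1 + ‖x‖) ^ (-(n : ℝ)) * (potential s μ x 1).toReal := by
    have h1 := lintegral_mul_potential_lt_top hs hsd hΛ hμ (r := n) (by positivity) (by linarith)
    refine (integrable_toReal_of_lintegral_ne_top
      ((Measurable.mul (by fun_prop) measurable_potential).aemeasurable) h1.ne).congr
      (Eventually.of_forall fun x => ?_)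
    simp only [Pi.mul_apply, ENNReal.toReal_mul]
    rw [ENNReal.toReal_ofReal (by positivity)]
  have hi2 : Integrable fun x : RSpace d => (1 + ‖x‖) ^ (-(n : ℝ)) * (A * (1 + ‖x‖) ^ (s + 1)) := by
    have h1 : Integrable fun x : RSpace d => (1 + ‖x‖) ^ (-((n : ℝ) - (s + 1))) := by
      refine _root_.integrable_one_add_norm ?_
      rw [finrank_euclideanSpace_fin]
      linarith
    refine (h1.const_mul A).congr (Eventually.of_forall fun x => ?_)
    dsimp only
    rw [neg_sub, sub_eq_add_neg, Real.rpow_add (by positivity)]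
    ring
  rw [show (0 : CSpace d') = ∫ x : RSpace d, (0 : CSpace d') by simp]
  refine tendsto_integral_filter_of_dominated_convergence
    (fun x => B * ((1 + ‖x‖) ^ (-(n : ℝ)) * (potential s μ x 1).toReal +
      (1 + ‖x‖) ^ (-(n : ℝ)) * (A * (1 + ‖x‖) ^ (s + 1)))) ?_ ?_ ((hi1.add hi2).const_mul B) ?_
  · filter_upwards [eventually_gt_atTop 0] with R hR
    exact aestronglyMeasurable_smul_mainPart hK hsd (isCut_cutoff hR).isLip0 ψ φ
  · filter_upwards [eventually_ge_atTop R₀] with R hR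
    filter_upwards [hpot, h0] with x hx hTx
    rw [norm_smul, ← mul_add, ← mul_assoc]
    gcongr
    · exact hB x
    · exact hR₀ R hR x hx hTx
  · filter_upwards [hpot, h0] with x hx hTx
    have h1 := tendsto_mainPart_cutoff hK hΛ hμ hx hφ hφ1 cutoff 0 isCut_cutoff_sub_zero
    rw [hTx] at h1
    simpa using h1.const_smul (ψ x)

theorem IsNice.integrable_schwartz (hΛ : 0 < Λ) (hμ : IsNice s Λ μ) (ψ : 𝓢(RSpace d, ℂ)) :
    Integrable ψ μ := by
  obtain ⟨n, hn⟩ := exists_nat_gt (max s 0)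
  obtain ⟨B, hB0, hB⟩ := exists_norm_schwartz_le ψ n
  have h1 := hμ.integrable_one_add_norm hΛ (r := n) (by positivity) ((le_max_left _ _).trans_lt hn)
  exact (h1.const_mul B).mono' ψ.continuous.aestronglyMeasurable (Eventually.of_forall hB)

/-- The inverse transform of G is a combination of the ψ_j * K. Truncated and integrated against μ,
it becomes the average of the truncations of T̄(1) against ψ_j, which tends to 0 by dominated
convergence. -/
theorem integral_fourierInv_eq_zero (hK : KernelBounds s C K) (hsd : s < d) (hΛ : 0 < Λ)
    (hsm : IsSmoothKernel K) (hnd : IsNondegenerate s K)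
    (hμ : IsNice s Λ μ) (hφ : IsLip0 φ) (hφ1 : ∫ y, φ y ∂μ = 1)
    (h0 : ∀ᵐ x ∂volume, Tbar K μ φ x = 0) (G : 𝓢(RSpace d, ℂ)) (hGc : HasCompactSupport G)
    (hG0 : tsupport G ⊆ {0}ᶜ) : ∫ y, 𝓕⁻ G y ∂μ = 0 := by
  have := hμ.isLocallyFinite
  obtain ⟨ψ, hψ0, hψ⟩ := exists_convolution_eq hK hsd hsm hnd (G.smooth ⊤) hGc hG0
  have hlim : Tendsto (fun R => ∫ y, cutoff R y * 𝓕⁻ G y ∂μ) atTop (𝓝 (∫ y, 𝓕⁻ G y ∂μ)) := by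
    have hi := hμ.integrable_schwartz hΛ (𝓕⁻ G)
    refine tendsto_integral_filter_of_dominated_convergence (fun y => ‖𝓕⁻ G y‖) ?_
      (Eventually.of_forall fun R => Eventually.of_forall fun y => ?_) hi.norm
      (Eventually.of_forall fun y => ?_)
    · filter_upwards [eventually_gt_atTop 0] with R hR
      exact ((isCut_cutoff hR).isLip0.continuous.mul (𝓕⁻ G).continuous).aestronglyMeasurable
    · rw [norm_mul]
      exact mul_le_of_le_one_left (norm_nonneg _) (cutoff_norm_le R y)
    · refine tendsto_const_nhds.congr' ?_
      filter_upwards [eventually_gt_atTop 0, eventually_ge_atTop ‖y‖] with R hR hRy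
      rw [cutoff_eq_one hR hRy, one_mul]
  have hlim0 : Tendsto (fun R => ∑ j, (∫ x, ψ j x • mainPart K μ φ (cutoff R) x) j) atTop (𝓝 0) := by
    have h1 : ∀ j, Tendsto (fun R => (∫ x, ψ j x • mainPart K μ φ (cutoff R) x) j) atTop (𝓝 0) :=
      fun j => ((EuclideanSpace.proj j : CSpace d' →L[ℂ] ℂ).continuous.tendsto 0).comp
        (tendsto_integral_smul_mainPart hK hsd hΛ hμ hφ hφ1 h0 (ψ j))
    simpa using tendsto_finsetSum Finset.univ fun j _ => h1 j
  refine tendsto_nhds_unique hlim (hlim0.congr' ?_)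
  filter_upwards [eventually_gt_atTop 0] with R hR
  have hg := (isCut_cutoff (d := d) hR).isLip0
  have hint : ∀ j, Integrable (fun y => cutoff R y • ∫ x, ψ j x • K (y - x)) μ := fun j => by
    refine (integrable_prod_smul_kernel (μ := μ) hK hsd hg (ψ j)).integral_prod_left.congr
      (Eventually.of_forall fun y => ?_)
    exact integral_smul (cutoff R y) fun x => ψ j x • K (y - x)
  have h2 : ∀ j, (∫ x, ψ j x • mainPart K μ φ (cutoff R) x) j =
      ∫ y, cutoff R y * (∫ x, ψ j x • K (y - x)) j ∂μ := by
    intro j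
    rw [← integral_smul_convolution hK hsd hg (hψ0 j) φ]
    exact ((EuclideanSpace.proj j : CSpace d' →L[ℂ] ℂ).integral_comp_comm (hint j)).symm
  have h3 : ∀ j, Integrable (fun y => cutoff R y * (∫ x, ψ j x • K (y - x)) j) μ := fun j =>
    (EuclideanSpace.proj j : CSpace d' →L[ℂ] ℂ).integrable_comp (hint j)
  rw [Finset.sum_congr rfl fun j _ => h2 j, ← integral_finsetSum _ fun j _ => h3 j]
  refine integral_congr_ae (Eventually.of_forall fun y => ?_)
  dsimp only
  rw [← Finset.mul_sum, hψ y, SchwartzMap.fourierInv_coe]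

end Averages

/-! ### A measure of growth s < d cannot have its Fourier transform supported at 0 -/

section Vanishing

variable {d d' : ℕ} {s C Λ : ℝ} {K : RSpace d → CSpace d'}
  {μ : Measure (RSpace d)} {φ h : RSpace d → ℂ}

theorem IsNice.exists_lintegral_dilate_le (hs : 0 < s) (hΛ : 0 < Λ) (hμ : IsNice s Λ μ)
    (ψ : 𝓢(RSpace d, ℂ)) : ∃ D, 0 ≤ D ∧ ∀ (ε : ℝ) (a : RSpace d), 0 < ε →
      ∫⁻ y, ‖ψ (ε • (y - a))‖ₑ ∂μ ≤ ENNReal.ofReal (D * ε ^ (-s)) := by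
  obtain ⟨n, hn⟩ := exists_nat_gt s
  obtain ⟨A, hA0, hA⟩ := exists_norm_schwartz_le ψ n
  have hn0 : (0 : ℝ) ≤ n := Nat.cast_nonneg n
  have hg : 0 < growthConst (n : ℝ) s := growthConst_pos hn.ne'
  refine ⟨A * (Λ + growthConst n s * Λ), by positivity, fun ε a hε => ?_⟩
  have hε' : 0 < ε⁻¹ := inv_pos.2 hε
  have h1 : ∀ y : RSpace d, ‖ε • (y - a)‖ = ε * ‖y - a‖ := fun y => by
    rw [norm_smul, Real.norm_of_nonneg hε.le]
  have hball : ∫⁻ y in ball a ε⁻¹, ‖ψ (ε • (y - a))‖ₑ ∂μ ≤ ENNReal.ofReal (A * (Λ * ε ^ (-s))) := by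
    refine (lintegral_mono (g := fun _ => ENNReal.ofReal A) fun y => ?_).trans ?_
    · rw [← ofReal_norm]
      refine ENNReal.ofReal_le_ofReal ((hA _).trans (mul_le_of_le_one_right hA0 ?_))
      exact Real.rpow_le_one_of_one_le_of_nonpos (by linarith [norm_nonneg (ε • (y - a))])
        (by linarith)
    · rw [setLIntegral_const, ENNReal.ofReal_mul hA0, Real.rpow_neg hε.le, ← Real.inv_rpow hε.le]
      gcongr
      exact hμ a _ hε'
  have hcompl : ∫⁻ y in (ball a ε⁻¹)ᶜ, ‖ψ (ε • (y - a))‖ₑ ∂μ ≤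
      ENNReal.ofReal (A * (growthConst n s * Λ * ε ^ (-s))) := by
    refine (setLIntegral_mono' (g := fun y => ENNReal.ofReal (A * ε ^ (-(n : ℝ))) *
      ‖y - a‖ₑ ^ (-(n : ℝ))) measurableSet_ball.compl fun y hy => ?_).trans ?_
    · rw [mem_compl_iff, mem_ball, not_lt, dist_eq_norm] at hy
      have hy0 : 0 < ‖y - a‖ := hε'.trans_le hy
      rw [← ofReal_norm, ← ofReal_norm, ENNReal.ofReal_rpow_of_pos hy0,
        ← ENNReal.ofReal_mul (by positivity), mul_assoc, ← Real.mul_rpow hε.le hy0.le]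
      refine ENNReal.ofReal_le_ofReal ((hA _).trans ?_)
      rw [h1]
      exact mul_le_mul_of_nonneg_left (Real.rpow_le_rpow_of_nonpos (mul_pos hε hy0)
        (le_add_of_nonneg_left zero_le_one) (neg_nonpos.2 hn0)) hA0
    · rw [lintegral_const_mul _ (by fun_prop)]
      refine (mul_le_mul_right (hμ.lintegral_compl_ball_le hΛ hn hε' a) _).trans (le_of_eq ?_)
      rw [← ENNReal.ofReal_mul (by positivity), Real.inv_rpow hε.le, ← Real.rpow_neg hε.le]
      congr 1
      have : ε ^ (-s) = ε ^ (-(n : ℝ)) * ε ^ (-(s - n)) := by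
        rw [← Real.rpow_add hε]
        congr 1
        ring
      rw [this]
      ring
  rw [← lintegral_add_compl _ (measurableSet_ball (x := a) (ε := ε⁻¹))]
  refine (add_le_add hball hcompl).trans (le_of_eq ?_)
  rw [← ENNReal.ofReal_add (by positivity) (by positivity)]
  congr 1
  ring

/-- The Schwartz function `e ^ (-2πi⟨ξ, a⟩) θ (ξ / t)`, where `θ` is a smooth cut-off function. -/
noncomputable def modulatedBump (a : RSpace d) {t : ℝ} (ht : 0 < t) : 𝓢(RSpace d, ℂ) :=
  HasCompactSupport.toSchwartzMap
    (f := fun ξ => (Real.fourierChar (inner ℝ ξ (-a)) : ℂ) * ((unitBump d (t⁻¹ • ξ) : ℝ) : ℂ))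
    (HasCompactSupport.mul_left
      (((unitBump d).hasCompactSupport.comp_smul (inv_ne_zero ht.ne')).comp_left
        (g := fun r : ℝ => (r : ℂ)) Complex.ofReal_zero))
    ((contDiff_fourierChar_inner (-a)).mul
      (Complex.ofRealCLM.contDiff.comp ((unitBump d).contDiff.comp (contDiff_const_smul _))))

theorem modulatedBump_apply (a : RSpace d) {t : ℝ} (ht : 0 < t) (ξ : RSpace d) :
    modulatedBump a ht ξ =
      (Real.fourierChar (inner ℝ ξ (-a)) : ℂ) * ((unitBump d (t⁻¹ • ξ) : ℝ) : ℂ) := rfl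

theorem modulatedBump_zero_apply {t : ℝ} (ht : 0 < t) (ξ : RSpace d) :
    modulatedBump 0 ht ξ = ((unitBump d (t⁻¹ • ξ) : ℝ) : ℂ) := by
  simp [modulatedBump_apply]

theorem fourierInv_modulatedBump (a : RSpace d) {t : ℝ} (ht : 0 < t) (y : RSpace d) :
    𝓕⁻ (modulatedBump a ht) y = (t : ℂ) ^ d * 𝓕⁻ (modulatedBump (0 : RSpace d) one_pos) (t • (y - a)) := by
  have h1 : 𝓕⁻ (modulatedBump a ht) y = 𝓕⁻ (modulatedBump (0 : RSpace d) ht) (-a - -y) := by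
    rw [← fourier_mul_fourierChar, SchwartzMap.fourierInv_coe, Real.fourierInv_eq_fourier_neg]
    refine congrArg (fun f : RSpace d → ℂ => (𝓕 f : RSpace d → ℂ) (-y)) (funext fun ξ => ?_)
    rw [modulatedBump_apply, modulatedBump_zero_apply]
  have h2 : ((modulatedBump (0 : RSpace d) ht : 𝓢(RSpace d, ℂ)) : RSpace d → ℂ) =
      fun ξ => modulatedBump (0 : RSpace d) one_pos (t⁻¹ • ξ) := by
    funext ξ
    rw [modulatedBump_zero_apply, modulatedBump_zero_apply, inv_one, one_smul]
  rw [h1, SchwartzMap.fourierInv_coe, SchwartzMap.fourierInv_coe, h2,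
    Real.fourierInv_eq_fourier_neg, fourier_comp_inv_smul _ ht, Real.fourierInv_eq_fourier_neg,
    Complex.real_smul, Complex.ofReal_pow]
  have e1 : t • -(-a - -y) = -(t • (y - a)) := by
    rw [← smul_neg]
    congr 1
    abel
  rw [e1]

/-- Bumps at two scales agree near 0, so their difference is supported off the origin and the
integral does not depend on the scale. At scale ε the integral is O(ε^d ε^(-s)), which tends to 0
because s < d. -/
theorem integral_fourierInv_modulatedBump (hs : 0 < s) (hsd : s < d) (hΛ : 0 < Λ) (hμ : IsNice s Λ μ)
    (h0 : ∀ G : 𝓢(RSpace d, ℂ), HasCompactSupport G → tsupport G ⊆ {0}ᶜ → ∫ y, 𝓕⁻ G y ∂μ = 0)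
    (a : RSpace d) {t : ℝ} (ht : 0 < t) : ∫ y, 𝓕⁻ (modulatedBump a ht) y ∂μ = 0 := by
  obtain ⟨D, hD0, hD⟩ := hμ.exists_lintegral_dilate_le hs hΛ (𝓕⁻ (modulatedBump (0 : RSpace d) one_pos))
  have hcs : ∀ {t : ℝ} (ht : 0 < t), HasCompactSupport (modulatedBump a ht) := fun ht =>
    HasCompactSupport.mul_left (((unitBump d).hasCompactSupport.comp_smul (inv_ne_zero ht.ne')).comp_left
        (g := fun r : ℝ => (r : ℂ)) Complex.ofReal_zero)
  have hone : ∀ {t : ℝ} (ht : 0 < t) (ξ : RSpace d), ‖ξ‖ ≤ t →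
      modulatedBump a ht ξ = (Real.fourierChar (inner ℝ ξ (-a)) : ℂ) := by
    intro t ht ξ hξ
    rw [modulatedBump_apply, (unitBump d).one_of_mem_closedBall, Complex.ofReal_one, mul_one]
    simp only [unitBump, mem_closedBall_zero_iff, norm_smul, norm_inv, Real.norm_of_nonneg ht.le]
    rwa [inv_mul_le_iff₀ ht, mul_one]
  have heq : ∀ ε (hε : 0 < ε), ∫ y, 𝓕⁻ (modulatedBump a ht) y ∂μ =
      ∫ y, 𝓕⁻ (modulatedBump a hε) y ∂μ := by
    intro ε hε
    have h1 := h0 (modulatedBump a ht - modulatedBump a hε) ((hcs ht).sub (hcs hε)) ?_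
    · rw [← sub_eq_zero, ← integral_sub (hμ.integrable_schwartz hΛ _) (hμ.integrable_schwartz hΛ _), ← h1]
      refine integral_congr_ae (Eventually.of_forall fun y => ?_)
      have h2 : 𝓕⁻ (modulatedBump a ht - modulatedBump a hε) =
        𝓕⁻ (modulatedBump a ht) - 𝓕⁻ (modulatedBump a hε) := map_sub (FourierTransform.fourierInvCLM ℂ 𝓢(RSpace d, ℂ)) _ _
      rw [h2]
      rfl
    · intro ξ hξ hξ0
      rw [mem_singleton_iff] at hξ0
      subst hξ0
      refine (notMem_tsupport_iff_eventuallyEq.2 ?_) hξ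
      filter_upwards [ball_mem_nhds (0 : RSpace d) (lt_min ht hε)] with η hη
      rw [mem_ball_zero_iff, lt_min_iff] at hη
      simp only [sub_apply, Pi.zero_apply]
      rw [hone ht η hη.1.le, hone hε η hη.2.le, sub_self]
  have hle : ∀ ε (hε : 0 < ε), ‖∫ y, 𝓕⁻ (modulatedBump a ht) y ∂μ‖ ≤ D * ε ^ ((d : ℝ) - s) := by
    intro ε hε
    rw [heq ε hε]
    have h1 : ‖∫ y, 𝓕⁻ (modulatedBump a hε) y ∂μ‖ₑ ≤ ENNReal.ofReal (D * ε ^ ((d : ℝ) - s)) := by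
      refine (enorm_integral_le_lintegral_enorm _).trans ?_
      rw [lintegral_congr fun y => by rw [fourierInv_modulatedBump a hε y, enorm_mul]]
      rw [lintegral_const_mul' _ _ enorm_ne_top]
      refine (mul_le_mul_right (hD ε a hε) _).trans (le_of_eq ?_)
      rw [← ofReal_norm, norm_pow, Complex.norm_real, Real.norm_of_nonneg hε.le,
        ← ENNReal.ofReal_mul (by positivity), sub_eq_add_neg, Real.rpow_add hε, Real.rpow_natCast]
      congr 1
      ring
    rw [← ofReal_norm] at h1
    exact (ENNReal.ofReal_le_ofReal_iff (by positivity)).1 h1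
  rw [← norm_le_zero_iff]
  have hlim : Tendsto (fun ε : ℝ => D * ε ^ ((d : ℝ) - s)) (𝓝[>] 0) (𝓝 0) := by
    have h := (Real.continuousAt_rpow_const 0 ((d : ℝ) - s) (Or.inr (by linarith))).tendsto.const_mul D
    rw [Real.zero_rpow (by linarith), mul_zero] at h
    exact h.mono_left nhdsWithin_le_nhds
  refine ge_of_tendsto hlim ?_
  filter_upwards [self_mem_nhdsWithin] with ε hε
  exact hle ε hε

theorem integral_unitBump_fourierInv :
    ∫ z, 𝓕⁻ (modulatedBump (0 : RSpace d) one_pos) z = 1 := by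
  have h1 : 𝓕 (𝓕⁻ (modulatedBump (0 : RSpace d) one_pos)) = modulatedBump (0 : RSpace d) one_pos :=
    FourierTransform.fourier_fourierInv_eq _
  have h2 : 𝓕 (𝓕⁻ (modulatedBump (0 : RSpace d) one_pos)) 0 =
      ∫ x, 𝓕⁻ (modulatedBump (0 : RSpace d) one_pos) x := by
    rw [SchwartzMap.fourier_coe, Real.fourier_eq]
    simp
  rw [← h2, h1, modulatedBump_zero_apply, smul_zero, (unitBump d).one_of_mem_closedBall (by simp [unitBump]),
    Complex.ofReal_one]

end Vanishing

/-! ### Approximate identities, and the non-vanishing of T̄(1) -/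

section Vanishing

variable {d d' : ℕ} {s C Λ : ℝ} {K : RSpace d → CSpace d'}
  {μ : Measure (RSpace d)} {φ h : RSpace d → ℂ}

/-- The convolution of `h` with the dilation `z ↦ t ^ d * ψ (t • z)`. -/
noncomputable def dilConv (h ψ : RSpace d → ℂ) (t : ℝ) (y : RSpace d) : ℂ :=
  ∫ z, h (y - t⁻¹ • z) * ψ z

theorem dilConv_eq (h ψ : RSpace d → ℂ) {t : ℝ} (ht : 0 < t) (y : RSpace d) :
    dilConv h ψ t y = ∫ a, h a * ((t : ℂ) ^ d * ψ (t • (y - a))) := by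
  rw [← integral_sub_left_eq_self _ volume y]
  have h1 := Measure.integral_comp_smul volume (fun z : RSpace d => h (y - t⁻¹ • z) * ψ z) t
  rw [finrank_euclideanSpace_fin, abs_of_pos (by positivity), eq_inv_smul_iff₀ (by positivity),
    ← integral_smul] at h1
  rw [dilConv, ← h1]
  refine integral_congr_ae (Eventually.of_forall fun a => ?_)
  dsimp only
  rw [sub_sub_cancel, inv_smul_smul₀ ht.ne', Complex.real_smul]
  push_cast
  ring

theorem continuous_dilConv_integrand (hh : IsLip0 h) (ψ : 𝓢(RSpace d, ℂ)) (t : ℝ) :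
    Continuous fun P : RSpace d × RSpace d => h (P.1 - t⁻¹ • P.2) * ψ P.2 := by
  have h1 := hh.continuous
  have h2 := ψ.continuous
  fun_prop

theorem tendsto_dilConv (hh : IsLip0 h) (ψ : 𝓢(RSpace d, ℂ)) (y : RSpace d) :
    Tendsto (fun t => dilConv h ψ t y) atTop (𝓝 (h y * ∫ z, ψ z)) := by
  obtain ⟨B, hB0, hB⟩ := hh.exists_bound
  rw [← integral_const_mul]
  refine tendsto_integral_filter_of_dominated_convergence (fun z => B * ‖ψ z‖)
    (Eventually.of_forall fun t => ?_)
    (Eventually.of_forall fun t => Eventually.of_forall fun z => ?_) (ψ.integrable.norm.const_mul B)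
    (Eventually.of_forall fun z => ?_)
  · exact ((continuous_dilConv_integrand hh ψ t).comp (Continuous.prodMk_right y)).aestronglyMeasurable
  · rw [norm_mul]
    gcongr
    exact hB _
  · refine Tendsto.mul_const _ ((hh.continuous.tendsto y).comp ?_)
    have : Tendsto (fun t : ℝ => y - t⁻¹ • z) atTop (𝓝 (y - (0 : ℝ) • z)) :=
      tendsto_const_nhds.sub (tendsto_inv_atTop_zero.smul_const z)
    simpa using this

theorem exists_norm_dilConv_le (hh : IsLip0 h) (ψ : 𝓢(RSpace d, ℂ)) (n : ℕ) :
    ∃ D, ∀ t, 1 ≤ t → ∀ y, ‖dilConv h ψ t y‖ ≤ D * (1 + ‖y‖) ^ (-(n : ℝ)) := by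
  obtain ⟨B, hB0, hB⟩ := hh.exists_bound
  obtain ⟨ρ, hρ0, hρ⟩ := hh.exists_radius
  obtain ⟨A, hA0, hA⟩ := exists_norm_schwartz_le ψ (n + (d + 1))
  have hi : Integrable fun z : RSpace d => (1 + ‖z‖) ^ (-((d : ℝ) + 1)) :=
    _root_.integrable_one_add_norm (by rw [finrank_euclideanSpace_fin]; linarith)
  refine ⟨B * A * (1 + ρ) ^ (n : ℝ) * ∫ z : RSpace d, (1 + ‖z‖) ^ (-((d : ℝ) + 1)), fun t ht y => ?_⟩
  have h1 : ∀ z, ‖h (y - t⁻¹ • z) * ψ z‖ ≤ B * A * (1 + ρ) ^ (n : ℝ) * (1 + ‖y‖) ^ (-(n : ℝ)) *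
      (1 + ‖z‖) ^ (-((d : ℝ) + 1)) := by
    intro z
    by_cases h0 : h (y - t⁻¹ • z) = 0
    · rw [h0, zero_mul, norm_zero]
      positivity
    · have h2 : ‖y - t⁻¹ • z‖ ≤ ρ := by
        by_contra! hc
        exact h0 (hρ _ hc)
      have h3 : ‖t⁻¹ • z‖ ≤ ‖z‖ := by
        rw [norm_smul, norm_inv, Real.norm_of_nonneg (by linarith)]
        exact mul_le_of_le_one_left (norm_nonneg z) (inv_le_one_of_one_le₀ ht)
      have h4 : 1 + ‖y‖ ≤ (1 + ρ) * (1 + ‖z‖) := by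
        have := norm_sub_norm_le y (t⁻¹ • z)
        nlinarith [norm_nonneg z]
      have h5 : (1 + ‖z‖) ^ (-(n : ℝ)) ≤ (1 + ρ) ^ (n : ℝ) * (1 + ‖y‖) ^ (-(n : ℝ)) := by
        have h6 := Real.rpow_le_rpow_of_nonpos (z := -(n : ℝ)) (by positivity) h4 (by simp)
        rw [Real.mul_rpow (by positivity) (by positivity), Real.rpow_neg (by positivity : 0 ≤ 1 + ρ),
          inv_mul_le_iff₀ (by positivity)] at h6
        exact h6
      have h7 := hA z
      have h8 : (1 + ‖z‖) ^ (-((n + (d + 1) : ℕ) : ℝ)) =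
          (1 + ‖z‖) ^ (-(n : ℝ)) * (1 + ‖z‖) ^ (-((d : ℝ) + 1)) := by
        rw [← Real.rpow_add (by positivity)]
        congr 1
        push_cast
        ring
      rw [h8] at h7
      calc ‖h (y - t⁻¹ • z) * ψ z‖ ≤ B * (A * (((1 + ρ) ^ (n : ℝ) * (1 + ‖y‖) ^ (-(n : ℝ))) *
            (1 + ‖z‖) ^ (-((d : ℝ) + 1)))) := by
            rw [norm_mul]
            gcongr
            · exact hB _
            · refine h7.trans ?_
              gcongr
        _ = _ := by ring
  refine (norm_integral_le_of_norm_le (hi.const_mul _) (Eventually.of_forall h1)).trans (le_of_eq ?_)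
  rw [integral_const_mul]
  ring

theorem tendsto_integral_dilConv (hΛ : 0 < Λ) (hμ : IsNice s Λ μ) (hh : IsLip0 h)
    (ψ : 𝓢(RSpace d, ℂ)) :
    Tendsto (fun t => ∫ y, dilConv h ψ t y ∂μ) atTop (𝓝 ((∫ y, h y ∂μ) * ∫ z, ψ z)) := by
  obtain ⟨n, hn⟩ := exists_nat_gt s
  obtain ⟨D, hD⟩ := exists_norm_dilConv_le hh ψ n
  rw [← integral_mul_const]
  refine tendsto_integral_filter_of_dominated_convergence
    (fun y => D * (1 + ‖y‖) ^ (-(n : ℝ))) (Eventually.of_forall fun t => ?_) ?_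
    ((hμ.integrable_one_add_norm hΛ n.cast_nonneg hn).const_mul D)
    (Eventually.of_forall fun y => tendsto_dilConv hh ψ y)
  · exact ((continuous_dilConv_integrand hh ψ t).stronglyMeasurable.integral_prod_right'
      (ν := volume)).aestronglyMeasurable
  · filter_upwards [eventually_ge_atTop 1] with t ht
    exact Eventually.of_forall (hD t ht)

/-- Fubini moves the mollifier from the test function onto μ, where the vanishing of the modulated
bumps applies. -/
theorem integral_dilConv (hs : 0 < s) (hΛ : 0 < Λ) (hμ : IsNice s Λ μ) (hh : IsLip0 h)
    (ψ : 𝓢(RSpace d, ℂ)) {t : ℝ} (ht : 0 < t) :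
    ∫ y, dilConv h ψ t y ∂μ = ∫ a, h a * ∫ y, (t : ℂ) ^ d * ψ (t • (y - a)) ∂μ := by
  have := hμ.isLocallyFinite
  simp only [dilConv_eq h ψ ht]
  have hc : Continuous fun P : RSpace d × RSpace d =>
      h P.1 * ((t : ℂ) ^ d * ψ (t • (P.2 - P.1))) := by
    have h1 := hh.continuous
    have h2 := ψ.continuous
    fun_prop
  have hint : Integrable (fun P : RSpace d × RSpace d => h P.1 * ((t : ℂ) ^ d * ψ (t • (P.2 - P.1))))
      (volume.prod μ) := by
    refine ⟨hc.aestronglyMeasurable, ?_⟩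
    obtain ⟨D, hD0, hD⟩ := hμ.exists_lintegral_dilate_le hs hΛ ψ
    rw [HasFiniteIntegral, lintegral_prod _ hc.measurable.enorm.aemeasurable]
    refine lt_of_le_of_lt (lintegral_mono (g := fun a => ‖h a‖ₑ *
      (‖(t : ℂ) ^ d‖ₑ * ENNReal.ofReal (D * t ^ (-s)))) fun a => ?_) ?_
    · simp only [enorm_mul]
      rw [lintegral_const_mul' _ _ enorm_ne_top, lintegral_const_mul' _ _ enorm_ne_top]
      gcongr
      exact hD t a ht
    · rw [lintegral_mul_const _ hh.continuous.measurable.enorm]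
      exact ENNReal.mul_lt_top (hh.integrable (μ := volume)).hasFiniteIntegral
        (ENNReal.mul_lt_top enorm_lt_top ENNReal.ofReal_lt_top)
  rw [← integral_integral_swap (f := fun a y => h a * ((t : ℂ) ^ d * ψ (t • (y - a)))) hint]
  simp only [integral_const_mul]

/-- If T̄(1) were 0 a.e., every mollification of μ by the inverse transform of a cut-off would
vanish. Tested against φ, these mollifications tend to ∫ φ dμ = 1. -/
theorem not_ae_Tbar_eq_zero (hK : KernelBounds s C K) (hsd : s < d) (hΛ : 0 < Λ)
    (hsm : IsSmoothKernel K) (hnd : IsNondegenerate s K)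
    (hμ : IsNice s Λ μ) (hφ : IsLip0 φ) (hφ1 : ∫ y, φ y ∂μ = 1) :
    ¬ ∀ᵐ x ∂volume, Tbar K μ φ x = 0 := by
  intro h0
  set Θ := 𝓕⁻ (modulatedBump (0 : RSpace d) one_pos) with hΘ
  have hlim := tendsto_integral_dilConv hΛ hμ hφ Θ
  rw [hφ1, hΘ, integral_unitBump_fourierInv, one_mul] at hlim
  refine zero_ne_one (α := ℂ) (tendsto_nhds_unique (tendsto_const_nhds.congr' ?_) hlim)
  filter_upwards [eventually_gt_atTop 0] with t ht
  rw [integral_dilConv hK.s_pos hΛ hμ hφ _ ht]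
  simp only [← fourierInv_modulatedBump _ ht]
  simp only [integral_fourierInv_modulatedBump hK.s_pos hsd hΛ hμ
    (integral_fourierInv_eq_zero hK hsd hΛ hsm hnd hμ hφ hφ1 h0) _ ht, mul_zero, integral_zero]

end Vanishing

end Reflectionless

/-! ### The proposition -/

theorem mainTheorem5 (d d' : ℕ) (s α Λ : ℝ) (hs0 : 0 < s) (hsd : s < d) (hΛ : 0 < Λ)
    (K : Reflectionless.RSpace d → Reflectionless.CSpace d')
    (hK : Reflectionless.IsCZKernel s α K)
    (hsmooth : Reflectionless.IsSmoothKernel K)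
    (hnondeg : Reflectionless.IsNondegenerate s K)
    (hexists : ∃ μ : MeasureTheory.Measure (Reflectionless.RSpace d),
      Reflectionless.IsNice s Λ μ ∧ Reflectionless.IsReflectionless s α K μ ∧ μ ≠ 0) :
    ∃ μ : MeasureTheory.Measure (Reflectionless.RSpace d),
      Reflectionless.IsNice s Λ μ ∧ Reflectionless.IsReflectionless s α K μ ∧
      μ.support.Nonempty ∧ Metric.infDist 0 μ.support = 1 ∧
      ∀ φ₀ : Reflectionless.RSpace d → ℂ, Reflectionless.IsLip0 φ₀ → ∫ x, φ₀ x ∂μ = 1 →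
        ‖Reflectionless.Tbar K μ φ₀ 0‖ₑ =
          MeasureTheory.eLpNorm (Reflectionless.Tbar K μ φ₀) ⊤ MeasureTheory.volume := by
  obtain ⟨C, hC⟩ := hK.exists_kernelBounds hs0 hsmooth
  obtain ⟨μ, hn, hr, h0⟩ := hexists
  have := hn.isLocallyFinite
  obtain ⟨φ, hφ, hφ1⟩ := Reflectionless.exists_isLip0_integral_eq_one h0
  exact Reflectionless.exists_extremal_measure hC hK.alpha_pos hΛ hsd hn
    (hr.pairDecay hC hΛ hn) hφ hφ1
    (Reflectionless.not_ae_Tbar_eq_zero hC hsd hΛ hsmooth hnondeg hn hφ hφ1)
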